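/- \textbf{Setting.} An instance $(S,\mathcal I)$ of unweighted interval set cover consists of a finite set $S\subset\mathbb R$ of points and a finite set $\mathcal I$ of closed intervals; its size is $n=|S|+|\mathcal I|$. A set cover is a subset $\mathcal A\subseteq\mathcal I$ such that every point of $S$ lies in some interval of $\mathcal A$; it is $\rho$-approximate if $|\mathcal A|\le\rho\,|\mathcal B|$ for every set cover $\mathcal B$. An update inserts or deletes a point of $S$ or an interval of $\mathcal I$. Algorithms are deterministic programs on a real RAM (integer and real registers, indirectly addressed integer and real memories; additions, subtractions, comparisons, loads, stores, outputs, tests and procedure calls cost one step each), with the real $\varepsilon$ given as part of the input. \textbf{Theorem.} There exist a dynamic data structure (one program) and absolute constants $C,c$ such that for every $\varepsilon>0$ and every initial instance the following holds. After the construction and after every sequence of updates the data structure maintains a set of intervals, its maintained solution, which depends only on the initial instance, on $\varepsilon$ and on the updates made so far, and which is a $(1+\varepsilon)$-approximate set cover of the current instance whenever that instance has a set cover. Let $n$ denote the size of the current instance and $k$ the size of the maintained solution. Then: \begin{itemize} \item the construction takes at most $C\,(n+1)\log^{c}(n+2)$ steps, i.e. $\widetilde O(n)$; \item an update takes $O(\log^3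 n/\varepsilon)$ amortized time for $\varepsilon\le 1$: in every sequence of updates and queries after the construction, the updates take in total at most $\sum C\log^3(n+2)/\min\{\varepsilon,1\}$ steps, where the sum is over the updates and $n$ is the size of the instance just before the respective update; \item a size query, which returns $k$, takes at most $C$ steps, i.e. $O(1)$; \item a membership query, which tells whether a given interval belongs to the maintained solution, takes at most $C\log(n+2)$ steps, i.e. $O(\log n)$; \item a reporting query, which outputs every interval of the maintained solution exactly once, takes at most $C\,(k\log(n+2)+1)$ steps, i.e. $O(k\log n)$. \end{itemize} -/

import Mathlib

noncomputable section

namespace DynCover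

/-! ## The machine: a real RAM with procedures

The machine has integer registers, real registers, an integer memory and a real memory
(both addressed indirectly through integer registers), and an output tape for pairs of reals.
Every elementary instruction, every test and every procedure call costs one step. The only
arithmetic is addition and (on the integers, truncated) subtraction, so the machine is a
restriction of the usual real RAM: no multiplication, no division, no rounding, and no
conversion between reals and integers. A program is a finite piece of syntax. -/

structure State where
  nreg : ℕ → ℕ
  rreg : ℕ → ℝ
  nmem : ℕ → ℕ
  rmem : ℕ → ℝ
  out : List (ℝ × ℝ)

/-- Tests on registers. -/
inductive Test where
  | natEq (i j : ℕ)
  | natLt (i j : ℕ)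
  | realEq (i j : ℕ)
  | realLt (i j : ℕ)

def Test.Holds : Test → State → Prop
  | .natEq i j, s => s.nreg i = s.nreg j
  | .natLt i j, s => s.nreg i < s.nreg j
  | .realEq i j, s => s.rreg i = s.rreg j
  | .realLt i j, s => s.rreg i < s.rreg j

/-- Elementary instructions; the first argument is the destination, `a` in a load or a store is
the integer register that holds the address. -/
inductive Instr where
  | nop
  | natConst (d k : ℕ)
  | natCopy (d i : ℕ)
  | natAdd (d i j : ℕ)
  | natSub (d i j : ℕ)
  | natLoad (d a : ℕ)
  | natStore (a i : ℕ)
  | realConst (d : ℕ) (q : ℚ)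
  | realCopy (d i : ℕ)
  | realAdd (d i j : ℕ)
  | realSub (d i j : ℕ)
  | realLoad (d a : ℕ)
  | realStore (a i : ℕ)
  | output (i j : ℕ)

def Instr.apply : Instr → State → State
  | .nop, s => s
  | .natConst d k, s => { s with nreg := Function.update s.nreg d k }
  | .natCopy d i, s => { s with nreg := Function.update s.nreg d (s.nreg i) }
  | .natAdd d i j, s => { s with nreg := Function.update s.nreg d (s.nreg i + s.nreg j) }
  | .natSub d i j, s => { s with nreg := Function.update s.nreg d (s.nreg i - s.nreg j) }
  | .natLoad d a, s => { s with nreg := Function.update s.nreg d (s.nmem (s.nreg a)) }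
  | .natStore a i, s => { s with nmem := Function.update s.nmem (s.nreg a) (s.nreg i) }
  | .realConst d q, s => { s with rreg := Function.update s.rreg d (q : ℝ) }
  | .realCopy d i, s => { s with rreg := Function.update s.rreg d (s.rreg i) }
  | .realAdd d i j, s => { s with rreg := Function.update s.rreg d (s.rreg i + s.rreg j) }
  | .realSub d i j, s => { s with rreg := Function.update s.rreg d (s.rreg i - s.rreg j) }
  | .realLoad d a, s => { s with rreg := Function.update s.rreg d (s.rmem (s.nreg a)) }
  | .realStore a i, s => { s with rmem := Function.update s.rmem (s.nreg a) (s.rreg i) }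
  | .output i j, s => { s with out := s.out ++ [(s.rreg i, s.rreg j)] }

/-- Commands. `call p` runs the `p`-th procedure of the program; procedures have no local
variables and may be recursive. -/
inductive Cmd where
  | instr (c : Instr)
  | seq (c₁ c₂ : Cmd)
  | ite (b : Test) (c₁ c₂ : Cmd)
  | loop (b : Test) (c : Cmd)
  | call (p : ℕ)

/-- `Exec procs c s t s'`: with procedure table `procs`, the command `c` started in state `s`
terminates in state `s'` after `t` steps. -/
inductive Exec (procs : List Cmd) : Cmd → State → ℕ → State → Prop
  | instr (c : Instr) (s : State) : Exec procs (.instr c) s 1 (c.apply s)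
  | seq {c₁ c₂ : Cmd} {s s' s'' : State} {t₁ t₂ : ℕ} :
      Exec procs c₁ s t₁ s' → Exec procs c₂ s' t₂ s'' →
      Exec procs (.seq c₁ c₂) s (t₁ + t₂) s''
  | iteTrue {b : Test} {c₁ c₂ : Cmd} {s s' : State} {t : ℕ} :
      b.Holds s → Exec procs c₁ s t s' → Exec procs (.ite b c₁ c₂) s (t + 1) s'
  | iteFalse {b : Test} {c₁ c₂ : Cmd} {s s' : State} {t : ℕ} :
      ¬ b.Holds s → Exec procs c₂ s t s' → Exec procs (.ite b c₁ c₂) s (t + 1) s'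
  | loopDone {b : Test} {c : Cmd} {s : State} :
      ¬ b.Holds s → Exec procs (.loop b c) s 1 s
  | loopStep {b : Test} {c : Cmd} {s s' s'' : State} {t₁ t₂ : ℕ} :
      b.Holds s → Exec procs c s t₁ s' → Exec procs (.loop b c) s' t₂ s'' →
      Exec procs (.loop b c) s (t₁ + t₂ + 1) s''
  | call {p : ℕ} {c : Cmd} {s s' : State} {t : ℕ} :
      procs[p]? = some c → Exec procs c s t s' → Exec procs (.call p) s (t + 1) s'

/-- The machine is deterministic: the final state and the number of steps are functions of the
command and the initial state. -/
theorem Exec.deterministic {procs : List Cmd} {c : Cmd} {s s₁ s₂ : State} {t₁ t₂ : ℕ}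
    (h₁ : Exec procs c s t₁ s₁) (h₂ : Exec procs c s t₂ s₂) : t₁ = t₂ ∧ s₁ = s₂ := by
  induction h₁ generalizing t₂ s₂ with
  | instr c s => cases h₂; exact ⟨rfl, rfl⟩
  | seq _ _ ih₁ ih₂ =>
    cases h₂ with
    | seq k₁ k₂ =>
      obtain ⟨rfl, rfl⟩ := ih₁ k₁
      obtain ⟨rfl, rfl⟩ := ih₂ k₂
      exact ⟨rfl, rfl⟩
  | iteTrue hb _ ih =>
    cases h₂ with
    | iteTrue _ k => obtain ⟨rfl, rfl⟩ := ih k; exact ⟨rfl, rfl⟩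
    | iteFalse hb' _ => exact absurd hb hb'
  | iteFalse hb _ ih =>
    cases h₂ with
    | iteTrue hb' _ => exact absurd hb' hb
    | iteFalse _ k => obtain ⟨rfl, rfl⟩ := ih k; exact ⟨rfl, rfl⟩
  | loopDone hb =>
    cases h₂ with
    | loopDone _ => exact ⟨rfl, rfl⟩
    | loopStep hb' _ _ => exact absurd hb' hb
  | loopStep hb _ _ ih₁ ih₂ =>
    cases h₂ with
    | loopDone hb' => exact absurd hb hb'
    | loopStep _ k₁ k₂ =>
      obtain ⟨rfl, rfl⟩ := ih₁ k₁
      obtain ⟨rfl, rfl⟩ := ih₂ k₂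
      exact ⟨rfl, rfl⟩
  | call hp _ ih =>
    cases h₂ with
    | call hp' k =>
      rw [hp] at hp'
      cases hp'
      obtain ⟨rfl, rfl⟩ := ih k
      exact ⟨rfl, rfl⟩

/-! ## Interval set cover -/

/-- An instance: a finite set of points and a finite set of closed intervals `[a, b]`, `a ≤ b`,
of the real line. -/
structure Inst where
  points : Finset ℝ
  intervals : Finset (NonemptyInterval ℝ)

namespace Inst

def size (X : Inst) : ℕ := X.points.card + X.intervals.card

/-- `A` is a set cover of `X`. -/
def IsCover (X : Inst) (A : Finset (NonemptyInterval ℝ)) : Prop :=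
  A ⊆ X.intervals ∧ ∀ p ∈ X.points, ∃ I ∈ A, I.fst ≤ p ∧ p ≤ I.snd

/-- `A` is a set cover of `X` of size at most `ρ` times the minimum size of a set cover. -/
def IsApproxCover (X : Inst) (ρ : ℝ) (A : Finset (NonemptyInterval ℝ)) : Prop :=
  X.IsCover A ∧ ∀ B, X.IsCover B → (A.card : ℝ) ≤ ρ * B.card

end Inst

inductive Update where
  | insertPoint (x : ℝ)
  | deletePoint (x : ℝ)
  | insertInterval (I : NonemptyInterval ℝ)
  | deleteInterval (I : NonemptyInterval ℝ)

inductive Query where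
  | size
  | member (I : NonemptyInterval ℝ)
  | report

inductive Op where
  | update (u : Update)
  | query (q : Query)

open Classical in
/-- The effect of an update on the instance. -/
def Inst.apply (X : Inst) : Update → Inst
  | .insertPoint x => { X with points := insert x X.points }
  | .deletePoint x => { X with points := X.points.erase x }
  | .insertInterval I => { X with intervals := insert I X.intervals }
  | .deleteInterval I => { X with intervals := X.intervals.erase I }

/-- The instance after a list of updates, the earliest update first. -/
def Inst.after (X : Inst) (us : List Update) : Inst := us.foldl Inst.apply X

def Op.toUpdate? : Op → Option Update
  | .update u => some u
  | .query _ => none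

/-- The updates among the operations `ops 0, …, ops (i - 1)`, the earliest first. -/
def history (ops : ℕ → Op) (i : ℕ) : List Update :=
  (List.range i).filterMap fun j => (ops j).toUpdate?

/-! ## Dynamic data structures -/

/-- A dynamic data structure is a procedure table and one command for the construction and for
each kind of update and query. -/
structure DataStructure where
  procs : List Cmd
  build : Cmd
  insertPoint : Cmd
  deletePoint : Cmd
  insertInterval : Cmd
  deleteInterval : Cmd
  size : Cmd
  member : Cmd
  report : Cmd

def DataStructure.code (D : DataStructure) : Op → Cmd
  | .update (.insertPoint _) => D.insertPoint
  | .update (.deletePoint _) => D.deletePoint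
  | .update (.insertInterval _) => D.insertInterval
  | .update (.deleteInterval _) => D.deleteInterval
  | .query .size => D.size
  | .query (.member _) => D.member
  | .query .report => D.report

open Classical in
/-- The instance given by a list of points and a list of intervals. -/
def Inst.ofLists (ps : List ℝ) (Is : List (NonemptyInterval ℝ)) : Inst :=
  ⟨ps.toFinset, Is.toFinset⟩

/-- The state in which the construction starts: integer registers `0` and `1` hold the numbers of
points and of intervals, real register `0` holds `ε`, and the real memory holds, from address `0`
on, the points and then the left and right endpoints of the intervals. All the rest is zero. -/
def initialState (ε : ℝ) (ps : List ℝ) (Is : List (NonemptyInterval ℝ)) : State where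
  nreg := Function.update (Function.update (fun _ => 0) 0 ps.length) 1 Is.length
  rreg := Function.update (fun _ => 0) 0 ε
  nmem := fun _ => 0
  rmem := fun a => (ps ++ Is.flatMap fun I => [I.fst, I.snd]).getD a 0
  out := []

/-- Before an operation its arguments are put into the real registers `0` and `1`, and the output
tape is cleared; everything else is as the previous operation left it. -/
def State.load (s : State) : Op → State
  | .update (.insertPoint x) | .update (.deletePoint x) =>
      { s with rreg := Function.update s.rreg 0 x, out := [] }
  | .update (.insertInterval I) | .update (.deleteInterval I) | .query (.member I) =>
      { s with rreg := Function.update (Function.update s.rreg 0 I.fst) 1 I.snd, out := [] }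
  | .query .size | .query .report => { s with out := [] }

end DynCover

end

noncomputable section

namespace DynCover

/-! ## A first-order functional language

Programs are functions on binary trees of numbers; the cost of an evaluation is the number of
procedure calls. -/

/-! Points and interval endpoints are items in the leaves of a height-balanced search tree. Every
inner node stores a cover of the points below it by intervals that have an endpoint below it. The
greedy algorithm (from the leftmost uncovered point, take the furthest reaching interval that
contains it) finds an optimal such cover at logarithmic cost per step (`gcount_le_card`). At each
node it is run for at most `θ / ε` steps, where `θ = 2 * H` and `H` bounds the height of the tree.
If it finishes, the node stores its result. If not, the optimum `k` exceeds `2 * H / ε` and the node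
stores the union of covers for its two children. Cutting the points into two costs at most one
interval (`gcount_append`), so a factor `1 + ε m / H` at the children gives at most `(1 + ε m / H)
(k + 1) ≤ (1 + ε m / H) k + 2 < (1 + ε (m + 1) / H) k` intervals. The factor grows by `ε / H` per
level and is at most `1 + ε` at the root (`sol_solves`).

The stored cover of a child ignores intervals without an endpoint in the child. If such an interval
contains one point of the child, it contains all of them (`span_left`, `span_right`); then one
interval suffices, and otherwise nothing is lost (`childSol_solves`).

Covers are persistent balanced trees, so a union takes a deletion and a join, and sharing is free.
An insertion or deletion creates `O(log n)` new nodes, each with `O(log n / ε)` greedy steps of cost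
`O(log n)`, which gives `log³ n / ε`. Since `θ` depends on the height, everything is recomputed
after linearly many updates, in time `O(n log² n)`, because a greedy run never makes more steps than
there are items below the node. A potential pays for this (`Glob.Inv.potential_update`).

The program is written in a small functional language whose cost is the number of calls. The
compiler (`exec_compile`) and a recursion rule (`Meets.yields`) turn evaluations into executions on
the machine. The procedures are specified by `Spec` and verified in `meets`; the invariant between
operations is `Glob.Inv`, and its main consequences are `Glob.Inv.approx` and
`Glob.Inv.update_time`. -/

inductive Val where
  | nat (n : ℕ)
  | real (x : ℝ)
  | pair (a b : Val)

inductive Cmp where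
  | natEq
  | natLt
  | realEq
  | realLt

inductive Prog where
  | id
  | fst
  | snd
  | natc (k : ℕ)
  | realc (q : ℚ)
  | add
  | sub
  | radd
  | peek
  | cons (f g : Prog)
  | comp (f g : Prog)
  | ite (k : Cmp) (c f g : Prog)
  | call (i : ℕ)

def Cmp.sat : Cmp → Val → Option Prop
  | .natEq, .pair (.nat a) (.nat b) => some (a = b)
  | .natLt, .pair (.nat a) (.nat b) => some (a < b)
  | .realEq, .pair (.real a) (.real b) => some (a = b)
  | .realLt, .pair (.real a) (.real b) => some (a < b)
  | _, _ => none

/-- What the procedures are supposed to do: `S i x v t` says that procedure `i` maps `x` to `v`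
with at most `t` calls. -/
abbrev CallSpec := ℕ → Val → Val → ℕ → Prop

/-- The first `len` cells of the real memory, which hold the input. -/
structure Input where
  val : ℕ → ℝ
  len : ℕ

/-- Evaluation of a program, with the calls interpreted by `S`. -/
def Den (S : CallSpec) (inp : Input) : Prog → Val → Val → ℕ → Prop
  | .id, x, v, t => v = x ∧ t = 0
  | .fst, x, v, t => (∃ b, x = .pair v b) ∧ t = 0
  | .snd, x, v, t => (∃ a, x = .pair a v) ∧ t = 0
  | .natc k, _, v, t => v = .nat k ∧ t = 0
  | .realc q, _, v, t => v = .real q ∧ t = 0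
  | .add, x, v, t => (∃ a b, x = .pair (.nat a) (.nat b) ∧ v = .nat (a + b)) ∧ t = 0
  | .sub, x, v, t => (∃ a b, x = .pair (.nat a) (.nat b) ∧ v = .nat (a - b)) ∧ t = 0
  | .radd, x, v, t => (∃ a b, x = .pair (.real a) (.real b) ∧ v = .real (a + b)) ∧ t = 0
  | .peek, x, v, t => (∃ a, x = .nat a ∧ a < inp.len ∧ v = .real (inp.val a)) ∧ t = 0
  | .cons f g, x, v, t => ∃ a b t₁ t₂, Den S inp f x a t₁ ∧ Den S inp g x b t₂ ∧
      v = .pair a b ∧ t = t₁ + t₂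
  | .comp f g, x, v, t => ∃ y t₁ t₂, Den S inp f x y t₁ ∧ Den S inp g y v t₂ ∧ t = t₁ + t₂
  | .ite k c f g, x, v, t => ∃ y t₁ t₂ p, Den S inp c x y t₁ ∧ k.sat y = some p ∧
      (p → Den S inp f x v t₂) ∧ (¬ p → Den S inp g x v t₂) ∧ t = t₁ + t₂
  | .call i, x, v, t => S i x v t

/-- Evaluation in continuation-passing form. -/
def wp (S : CallSpec) (inp : Input) : Prog → Val → (Val → ℕ → Prop) → Prop
  | .id, x, Q => Q x 0
  | .fst, x, Q => match x with
    | .pair a _ => Q a 0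
    | _ => False
  | .snd, x, Q => match x with
    | .pair _ b => Q b 0
    | _ => False
  | .natc k, _, Q => Q (.nat k) 0
  | .realc q, _, Q => Q (.real q) 0
  | .add, x, Q => match x with
    | .pair (.nat a) (.nat b) => Q (.nat (a + b)) 0
    | _ => False
  | .sub, x, Q => match x with
    | .pair (.nat a) (.nat b) => Q (.nat (a - b)) 0
    | _ => False
  | .radd, x, Q => match x with
    | .pair (.real a) (.real b) => Q (.real (a + b)) 0
    | _ => False
  | .peek, x, Q => match x with
    | .nat a => a < inp.len ∧ Q (.real (inp.val a)) 0
    | _ => False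
  | .cons f g, x, Q => wp S inp f x fun a t => wp S inp g x fun b t' => Q (.pair a b) (t + t')
  | .comp f g, x, Q => wp S inp f x fun y t => wp S inp g y fun z t' => Q z (t + t')
  | .ite k c f g, x, Q => wp S inp c x fun y t => match k.sat y with
    | some p => (p → wp S inp f x fun z t' => Q z (t + t')) ∧
      (¬ p → wp S inp g x fun z t' => Q z (t + t'))
    | none => False
  | .call i, x, Q => ∃ v t, S i x v t ∧ Q v t

/-- `wp` is the form in which simplification can run a program symbolically; `Den` is the form on
which the correctness of the compiler is proved. -/
theorem Den.of_wp {S : CallSpec} {inp : Input} {e : Prog} {x : Val} {Q : Val → ℕ → Prop}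
    (h : wp S inp e x Q) : ∃ v t, Den S inp e x v t ∧ Q v t := by
  induction e generalizing x Q with
  | id => exact ⟨_, _, ⟨rfl, rfl⟩, h⟩
  | fst =>
    cases x with
    | pair a b => exact ⟨_, _, ⟨⟨_, rfl⟩, rfl⟩, h⟩
    | _ => exact h.elim
  | snd =>
    cases x with
    | pair a b => exact ⟨_, _, ⟨⟨_, rfl⟩, rfl⟩, h⟩
    | _ => exact h.elim
  | natc k => exact ⟨_, _, ⟨rfl, rfl⟩, h⟩
  | realc q => exact ⟨_, _, ⟨rfl, rfl⟩, h⟩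
  | add | sub | radd =>
    unfold wp at h
    split at h
    · exact ⟨_, _, ⟨⟨_, _, rfl, rfl⟩, rfl⟩, h⟩
    · exact h.elim
  | peek =>
    unfold wp at h
    split at h
    · exact ⟨_, _, ⟨⟨_, rfl, h.1, rfl⟩, rfl⟩, h.2⟩
    · exact h.elim
  | cons f g ihf ihg =>
    obtain ⟨a, t, hf, h⟩ := ihf h
    obtain ⟨b, t', hg, h⟩ := ihg h
    exact ⟨_, _, ⟨a, b, t, t', hf, hg, rfl, rfl⟩, h⟩
  | comp f g ihf ihg =>
    obtain ⟨a, t, hf, h⟩ := ihf h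
    obtain ⟨b, t', hg, h⟩ := ihg h
    exact ⟨_, _, ⟨a, t, t', hf, hg, rfl⟩, h⟩
  | ite k c f g ihc ihf ihg =>
    obtain ⟨a, t, hc, h⟩ := ihc h
    match hp : k.sat a with
    | none => rw [hp] at h; exact h.elim
    | some p =>
    rw [hp] at h
    obtain ⟨h1, h2⟩ := h
    by_cases hpp : p
    · obtain ⟨b, t', hg, h⟩ := ihf (h1 hpp)
      exact ⟨_, _, ⟨a, t, t', p, hc, hp, fun _ => hg, fun q => absurd hpp q, rfl⟩, h⟩
    · obtain ⟨b, t', hg, h⟩ := ihg (h2 hpp)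
      exact ⟨_, _, ⟨a, t, t', p, hc, hp, fun q => absurd q hpp, fun _ => hg, rfl⟩, h⟩
  | call i =>
    obtain ⟨v, t, hs, h⟩ := h
    exact ⟨v, t, hs, h⟩

/-! ## Compilation

Values live in an immutable heap: register `4` holds the first free address, register `2` the
address of the current value, register `3` a linked stack of saved addresses. Registers from `9`
on and the real registers from `4` on are not used. -/

/-- Nothing forces the components of a pair into disjoint cells: values may share parts. This is
sound because allocated cells are never overwritten (`Ext`), and it makes all trees persistent. -/
def Rep (s : State) : Val → ℕ → Prop
  | .nat n, a => a < s.nreg 4 ∧ s.nmem a = n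
  | .real x, a => a < s.nreg 4 ∧ s.rmem a = x
  | .pair u v, a => a + 1 < s.nreg 4 ∧ Rep s u (s.nmem a) ∧ Rep s v (s.nmem (a + 1))

/-- `s'` arises from `s` by allocation. -/
structure Ext (s s' : State) : Prop where
  le : s.nreg 4 ≤ s'.nreg 4
  nmem : ∀ a < s.nreg 4, s'.nmem a = s.nmem a
  rmem : ∀ a < s.nreg 4, s'.rmem a = s.rmem a
  stack : s'.nreg 3 = s.nreg 3
  regs : ∀ i, 9 ≤ i → s'.nreg i = s.nreg i
  out : s'.out = s.out

theorem Ext.refl (s : State) : Ext s s :=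
  ⟨le_rfl, fun _ _ => rfl, fun _ _ => rfl, rfl, fun _ _ => rfl, rfl⟩

theorem Rep.mono {s s' : State} (hle : s.nreg 4 ≤ s'.nreg 4)
    (hn : ∀ a < s.nreg 4, s'.nmem a = s.nmem a) (hr : ∀ a < s.nreg 4, s'.rmem a = s.rmem a)
    {v : Val} {a : ℕ} (h : Rep s v a) : Rep s' v a := by
  induction v generalizing a with
  | nat n => exact ⟨h.1.trans_le hle, (hn a h.1).trans h.2⟩
  | real x => exact ⟨h.1.trans_le hle, (hr a h.1).trans h.2⟩
  | pair u v ihu ihv =>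
    obtain ⟨h0, h1, h2⟩ := h
    refine ⟨by omega, ?_, ?_⟩
    · rw [hn a (by omega)]; exact ihu h1
    · rw [hn _ h0]; exact ihv h2

theorem Rep.ext {s s' : State} (h : Ext s s') {v : Val} {a : ℕ} (hv : Rep s v a) : Rep s' v a :=
  hv.mono h.le h.nmem h.rmem

def block : List Instr → Cmd
  | [] => .instr .nop
  | c :: cs => .seq (.instr c) (block cs)

theorem exec_block (procs : List Cmd) (l : List Instr) (s : State) :
    Exec procs (block l) s (l.length + 1) (l.foldl (fun s c => c.apply s) s) := by
  induction l generalizing s with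
  | nil => exact .instr _ _
  | cons c l ih =>
    have := Exec.seq (Exec.instr (procs := procs) c s) (ih (c.apply s))
    rwa [show 1 + (l.length + 1) = (c :: l).length + 1 by simp [add_comm]] at this

/-- Allocate a pair of the contents of registers `i` and `j`, address into `d`. -/
def allocPair (i j d : ℕ) : List Instr :=
  [.natConst 8 1, .natStore 4 i, .natAdd 8 4 8, .natStore 8 j, .natCopy d 4, .natConst 4 1,
    .natAdd 4 8 4]

def allocNat (i : ℕ) : List Instr :=
  [.natStore 4 i, .natCopy 2 4, .natConst 8 1, .natAdd 4 4 8]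

def allocReal (i : ℕ) : List Instr :=
  [.realStore 4 i, .natCopy 2 4, .natConst 8 1, .natAdd 4 4 8]

/-- Load the components of the pair at address `a` into registers `6` and `7`. -/
def unpair (a : ℕ) : List Instr :=
  [.natLoad 6 a, .natConst 8 1, .natAdd 8 a 8, .natLoad 7 8]

def Cmp.load : Cmp → List Instr
  | .natEq | .natLt => [.natLoad 6 6, .natLoad 7 7]
  | .realEq | .realLt => [.realLoad 2 6, .realLoad 3 7]

def Cmp.cond : Cmp → Test
  | .natEq => .natEq 6 7
  | .natLt => .natLt 6 7
  | .realEq => .realEq 2 3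
  | .realLt => .realLt 2 3

def push : List Instr := allocPair 2 3 3

def pop : List Instr := [.natLoad 2 3, .natConst 8 1, .natAdd 8 3 8, .natLoad 3 8]

/-- Exchange the current value with the top of the stack. -/
def swap : List Instr := unpair 3 ++ allocPair 2 7 3 ++ [.natCopy 2 6]

/-- Pop the stack and pair the popped value with the current one. -/
def popPair : List Instr := unpair 3 ++ [.natCopy 3 7] ++ allocPair 6 2 2

/-- Procedures have no local variables, so `cons` and `ite` save the argument on the linked stack
before a subprogram replaces the current value. -/
def compile : Prog → Cmd
  | .id => block []
  | .fst => block [.natLoad 2 2]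
  | .snd => block [.natConst 8 1, .natAdd 2 2 8, .natLoad 2 2]
  | .natc k => block (.natConst 6 k :: allocNat 6)
  | .realc q => block (.realConst 2 q :: allocReal 2)
  | .add => block (unpair 2 ++ [.natLoad 6 6, .natLoad 7 7, .natAdd 6 6 7] ++ allocNat 6)
  | .sub => block (unpair 2 ++ [.natLoad 6 6, .natLoad 7 7, .natSub 6 6 7] ++ allocNat 6)
  | .radd => block (unpair 2 ++ [.realLoad 2 6, .realLoad 3 7, .realAdd 2 2 3] ++ allocReal 2)
  | .peek => block ([.natLoad 6 2, .realLoad 2 6] ++ allocReal 2)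
  | .cons f g => .seq (block push) (.seq (compile f) (.seq (block swap) (.seq (compile g)
      (block popPair))))
  | .comp f g => .seq (compile f) (compile g)
  | .ite k c f g => .seq (block push) (.seq (compile c) (.seq (block (unpair 2 ++ k.load ++ pop))
      (.ite k.cond (compile f) (compile g))))
  | .call i => .call i

/-- The number of steps of the compiled program, calls apart. -/
def Prog.steps : Prog → ℕ
  | .cons f g => f.steps + g.steps + 50
  | .comp f g => f.steps + g.steps
  | .ite _ c f g => c.steps + f.steps + g.steps + 50
  | .call _ => 0
  | _ => 20

/-- The input is in its place. -/
def State.HasInput (s : State) (inp : Input) : Prop :=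
  inp.len ≤ s.nreg 4 ∧ ∀ n < inp.len, s.rmem n = inp.val n

theorem State.HasInput.ext {s s' : State} {inp : Input} (h : s.HasInput inp) (e : Ext s s') :
    s'.HasInput inp :=
  ⟨h.1.trans e.le, fun n hn => (e.rmem n (hn.trans_le h.1)).trans (h.2 n hn)⟩

/-- Running `c` from `s` yields `v` within `k` steps. -/
def Yields (procs : List Cmd) (c : Cmd) (s : State) (v : Val) (k : ℕ) : Prop :=
  ∃ t s', Exec procs c s t s' ∧ t ≤ k ∧ Ext s s' ∧ Rep s' v (s'.nreg 2)

theorem yields_block {procs : List Cmd} {l : List Instr} {s : State} {v : Val} {k : ℕ}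
    (hk : l.length + 1 ≤ k)
    (h : Ext s (l.foldl (fun s c => c.apply s) s) ∧
      Rep (l.foldl (fun s c => c.apply s) s) v ((l.foldl (fun s c => c.apply s) s).nreg 2)) :
    Yields procs (block l) s v k :=
  ⟨_, _, exec_block procs l s, hk, h⟩

theorem exec_push (s : State) : ∃ s', s' = push.foldl (fun s c => c.apply s) s ∧
    s'.nreg 4 = s.nreg 4 + 2 ∧ (∀ a < s.nreg 4, s'.nmem a = s.nmem a) ∧ s'.rmem = s.rmem ∧
    s'.nreg 3 = s.nreg 4 ∧ s'.nmem (s.nreg 4) = s.nreg 2 ∧ s'.nmem (s.nreg 4 + 1) = s.nreg 3 ∧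
    s'.nreg 2 = s.nreg 2 ∧ (∀ i, 9 ≤ i → s'.nreg i = s.nreg i) ∧ s'.out = s.out := by
  refine ⟨_, rfl, ?_⟩
  simp [push, allocPair, Instr.apply, Function.update_apply]
  refine ⟨fun a ha => ?_, fun i hi => ?_⟩
  · rw [if_neg (by omega), if_neg (by omega)]
  · simp [show i ≠ 4 by omega, show i ≠ 3 by omega, show i ≠ 8 by omega]

theorem exec_swap (s : State) :
    ∃ s', s' = swap.foldl (fun s c => c.apply s) s ∧
    s'.nreg 4 = s.nreg 4 + 2 ∧ (∀ a < s.nreg 4, s'.nmem a = s.nmem a) ∧ s'.rmem = s.rmem ∧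
    s'.nreg 3 = s.nreg 4 ∧ s'.nmem (s.nreg 4) = s.nreg 2 ∧
    s'.nmem (s.nreg 4 + 1) = s.nmem (s.nreg 3 + 1) ∧
    s'.nreg 2 = s.nmem (s.nreg 3) ∧ (∀ i, 9 ≤ i → s'.nreg i = s.nreg i) ∧ s'.out = s.out := by
  refine ⟨_, rfl, ?_⟩
  simp [swap, unpair, allocPair, Instr.apply, Function.update_apply]
  refine ⟨fun a ha => ?_, fun i hi => ?_⟩
  · rw [if_neg (by omega), if_neg (by omega)]
  · simp [show i ≠ 4 by omega, show i ≠ 3 by omega, show i ≠ 8 by omega, show i ≠ 2 by omega,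
      show i ≠ 6 by omega, show i ≠ 7 by omega]

theorem exec_popPair (s : State) :
    ∃ s', s' = popPair.foldl (fun s c => c.apply s) s ∧
    s'.nreg 4 = s.nreg 4 + 2 ∧ (∀ a < s.nreg 4, s'.nmem a = s.nmem a) ∧ s'.rmem = s.rmem ∧
    s'.nreg 3 = s.nmem (s.nreg 3 + 1) ∧ s'.nmem (s.nreg 4) = s.nmem (s.nreg 3) ∧
    s'.nmem (s.nreg 4 + 1) = s.nreg 2 ∧
    s'.nreg 2 = s.nreg 4 ∧ (∀ i, 9 ≤ i → s'.nreg i = s.nreg i) ∧ s'.out = s.out := by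
  refine ⟨_, rfl, ?_⟩
  simp [popPair, unpair, allocPair, Instr.apply, Function.update_apply]
  refine ⟨fun a ha => ?_, fun i hi => ?_⟩
  · rw [if_neg (by omega), if_neg (by omega)]
  · simp [show i ≠ 4 by omega, show i ≠ 3 by omega, show i ≠ 8 by omega, show i ≠ 2 by omega,
      show i ≠ 6 by omega, show i ≠ 7 by omega]

/-- The operands sit in registers that `pop` leaves alone, so the argument of the branches can be
restored before the test is made. -/
theorem exec_test (k : Cmp) (s : State) {y : Val} {p : Prop} (hy : Rep s y (s.nreg 2))
    (hp : k.sat y = some p) :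
    ∃ s', s' = (unpair 2 ++ k.load ++ pop).foldl (fun s c => c.apply s) s ∧
    s'.nreg 4 = s.nreg 4 ∧ s'.nmem = s.nmem ∧ s'.rmem = s.rmem ∧
    s'.nreg 3 = s.nmem (s.nreg 3 + 1) ∧
    s'.nreg 2 = s.nmem (s.nreg 3) ∧ (∀ i, 9 ≤ i → s'.nreg i = s.nreg i) ∧ s'.out = s.out ∧
    (k.cond.Holds s' ↔ p) := by
  refine ⟨_, rfl, ?_⟩
  rcases k with _ | _ | _ | _ <;> rcases y with _ | _ | ⟨_ | _ | _, _ | _ | _⟩ <;>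
    simp only [Cmp.sat, Option.some.injEq, reduceCtorEq] at hp <;> subst hp <;>
    obtain ⟨-, ⟨-, h1⟩, ⟨-, h2⟩⟩ := hy <;>
    simp [unpair, pop, Cmp.load, Cmp.cond, Test.Holds, Instr.apply, Function.update_apply, h1, h2] <;>
    intro i hi <;>
    simp [show i ≠ 3 by omega, show i ≠ 8 by omega, show i ≠ 2 by omega,
      show i ≠ 6 by omega, show i ≠ 7 by omega]

/-- Every unit of call cost pays for `M` machine steps, and the remaining code is free of loops,
whence the fixed summand `e.steps`. Calls are assumed correct only below the cost `T`, so that the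
lemma can serve as the inductive step for recursive procedures. -/
theorem exec_compile {S : CallSpec} {inp : Input} {procs : List Cmd} {M T : ℕ}
    (hcall : ∀ i x v t s, t < T → S i x v t → s.HasInput inp → Rep s x (s.nreg 2) →
      Yields procs (.call i) s v (M * t))
    (e : Prog) {x v : Val} {t : ℕ} (hd : Den S inp e x v t) (ht : t < T) {s : State}
    (hin : s.HasInput inp) (hx : Rep s x (s.nreg 2)) :
    Yields procs (compile e) s v (e.steps + M * t) := by
  induction e generalizing x v t s with
  | id =>
    obtain ⟨rfl, rfl⟩ := hd
    exact yields_block (by simp [Prog.steps]) ⟨Ext.refl _, hx⟩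
  | fst =>
    obtain ⟨⟨b, rfl⟩, rfl⟩ := hd
    refine yields_block (by simp [Prog.steps]) ?_
    have : Ext s ([Instr.natLoad 2 2].foldl (fun s c => c.apply s) s) := by
      constructor <;> simp +contextual [Instr.apply, Function.update_apply]
      intro i hi h; omega
    refine ⟨this, Rep.ext this ?_⟩
    simpa [Instr.apply] using hx.2.1
  | snd =>
    obtain ⟨⟨b, rfl⟩, rfl⟩ := hd
    refine yields_block (by simp [Prog.steps]) ?_
    have : Ext s ([Instr.natConst 8 1, .natAdd 2 2 8, .natLoad 2 2].foldl
        (fun s c => c.apply s) s) := by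
      constructor <;> simp +contextual [Instr.apply, Function.update_apply]
      intro i hi; rw [if_neg (by omega), if_neg (by omega)]
    refine ⟨this, Rep.ext this ?_⟩
    simpa [Instr.apply] using hx.2.2
  | natc k =>
    obtain ⟨rfl, rfl⟩ := hd
    refine yields_block (by simp [Prog.steps, allocNat]) ⟨?_, ?_⟩
    · constructor <;> simp +contextual [allocNat, Instr.apply, Function.update_apply]
      · intros; omega
      · intro i hi; simp [show i ≠ 4 by omega, show i ≠ 8 by omega, show i ≠ 2 by omega,
          show i ≠ 6 by omega]
    · simp [Rep, allocNat, Instr.apply]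
  | realc k =>
    obtain ⟨rfl, rfl⟩ := hd
    refine yields_block (by simp [Prog.steps, allocReal]) ⟨?_, ?_⟩
    · constructor <;> simp +contextual [allocReal, Instr.apply, Function.update_apply]
      · intros; omega
      · intro i hi; simp [show i ≠ 4 by omega, show i ≠ 8 by omega, show i ≠ 2 by omega]
    · simp [Rep, allocReal, Instr.apply]
  | add | sub =>
    obtain ⟨⟨a, b, rfl, rfl⟩, rfl⟩ := hd
    obtain ⟨-, ⟨-, h1⟩, ⟨-, h2⟩⟩ := hx
    refine yields_block (by simp [Prog.steps, allocNat, unpair]) ⟨?_, ?_⟩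
    · constructor <;> simp +contextual [allocNat, unpair, Instr.apply, Function.update_apply]
      · intros; omega
      · intro i hi; simp [show i ≠ 4 by omega, show i ≠ 8 by omega, show i ≠ 2 by omega,
          show i ≠ 6 by omega, show i ≠ 7 by omega]
    · simp [Rep, allocNat, unpair, Instr.apply, h1, h2]
  | radd =>
    obtain ⟨⟨a, b, rfl, rfl⟩, rfl⟩ := hd
    obtain ⟨-, ⟨-, h1⟩, ⟨-, h2⟩⟩ := hx
    refine yields_block (by simp [Prog.steps, allocReal, unpair]) ⟨?_, ?_⟩
    · constructor <;> simp +contextual [allocReal, unpair, Instr.apply, Function.update_apply]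
      · intros; omega
      · intro i hi; simp [show i ≠ 4 by omega, show i ≠ 8 by omega, show i ≠ 2 by omega,
          show i ≠ 6 by omega, show i ≠ 7 by omega]
    · simp [Rep, allocReal, unpair, Instr.apply, h1, h2]
  | peek =>
    obtain ⟨⟨a, rfl, ha, rfl⟩, rfl⟩ := hd
    obtain ⟨-, h1⟩ := hx
    refine yields_block (by simp [Prog.steps, allocReal]) ⟨?_, ?_⟩
    · constructor <;> simp +contextual [allocReal, Instr.apply, Function.update_apply]
      · intros; omega
      · intro i hi; simp [show i ≠ 4 by omega, show i ≠ 8 by omega, show i ≠ 2 by omega,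
          show i ≠ 6 by omega]
    · simp [Rep, allocReal, Instr.apply, h1, hin.2 a ha]
  | cons f g ihf ihg =>
    obtain ⟨a, b, t₁, t₂, hf, hg, rfl, rfl⟩ := hd
    obtain ⟨s₁, hs₁, p4, pn, pr, p3, pa, pb, p2, pi, po⟩ := exec_push s
    have e₁ : Exec procs (block push) s _ s₁ := hs₁ ▸ exec_block procs push s
    have hin₁ : s₁.HasInput inp :=
      ⟨hin.1.trans (by omega), fun n hn => by rw [pr]; exact hin.2 n hn⟩
    have hx₁ : Rep s₁ x (s.nreg 2) := hx.mono (by omega) pn (fun a _ => by rw [pr])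
    obtain ⟨k₂, s₂, e₂, hk₂, x₂, r₂⟩ := ihf hf (by omega) hin₁ (by rwa [p2])
    have hs3 : s₂.nreg 3 = s.nreg 4 := x₂.stack.trans p3
    have hle := x₂.le
    obtain ⟨s₃, hs₃, q4, qn, qr, q3, qa, qb, q2, qi, qo⟩ := exec_swap s₂
    have e₃ : Exec procs (block swap) s₂ _ s₃ := hs₃ ▸ exec_block procs swap s₂
    -- The stack cell written by `push` lies below the allocation pointer, so it survives the
    -- evaluation of `f`.
    rw [hs3] at q2 qb
    rw [x₂.nmem _ (by omega), pa] at q2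
    rw [x₂.nmem _ (by omega), pb] at qb
    have hin₂ := hin₁.ext x₂
    have hin₃ : s₃.HasInput inp :=
      ⟨hin₂.1.trans (by omega), fun n hn => by rw [qr]; exact hin₂.2 n hn⟩
    have hx₃ : Rep s₃ x (s₃.nreg 2) := by
      rw [q2]
      exact (hx₁.ext x₂).mono (by omega) qn (fun a _ => by rw [qr])
    have ha₃ : Rep s₃ a (s₂.nreg 2) := r₂.mono (by omega) qn (fun a _ => by rw [qr])
    obtain ⟨k₄, s₄, e₄, hk₄, x₄, r₄⟩ := ihg hg (by omega) hin₃ hx₃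
    have hs3' : s₄.nreg 3 = s₂.nreg 4 := x₄.stack.trans q3
    have hle' := x₄.le
    obtain ⟨s₅, hs₅, w4, wn, wr, w3, wa, wb, w2, wi, wo⟩ := exec_popPair s₄
    have e₅ : Exec procs (block popPair) s₄ _ s₅ :=
      hs₅ ▸ exec_block procs _ s₄
    rw [hs3'] at w3 wa
    rw [x₄.nmem _ (by omega), qa] at wa
    rw [x₄.nmem _ (by omega), qb] at w3
    refine ⟨_, s₅, e₁.seq (e₂.seq (e₃.seq (e₄.seq e₅))), ?_, ?_, ?_⟩
    · simp [Prog.steps, push, allocPair, swap, popPair, unpair, mul_add]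
      omega
    · refine ⟨by omega, fun a ha => ?_, fun a ha => ?_, by omega, fun i hi => ?_, ?_⟩
      · rw [wn a (by omega), x₄.nmem a (by omega), qn a (by omega), x₂.nmem a (by omega), pn a ha]
      · rw [wr, x₄.rmem a (by omega), qr, x₂.rmem a (by omega), pr]
      · rw [wi i hi, x₄.regs i hi, qi i hi, x₂.regs i hi, pi i hi]
      · rw [wo, x₄.out, qo, x₂.out, po]
    · rw [w2]
      refine ⟨by omega, ?_, ?_⟩
      · rw [wa]
        exact (ha₃.ext x₄).mono (by omega) wn (fun a _ => by rw [wr])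
      · rw [wb]
        exact r₄.mono (by omega) wn (fun a _ => by rw [wr])
  | comp f g ihf ihg =>
    obtain ⟨y, t₁, t₂, hf, hg, rfl⟩ := hd
    obtain ⟨k₁, s₁, e₁, hk₁, x₁, r₁⟩ := ihf hf (by omega) hin hx
    obtain ⟨k₂, s₂, e₂, hk₂, x₂, r₂⟩ := ihg hg (by omega) (hin.ext x₁) r₁
    have := x₁.le
    refine ⟨_, s₂, e₁.seq e₂, by simp [Prog.steps, mul_add]; omega,
      ⟨x₁.le.trans x₂.le, fun a ha => ?_, fun a ha => ?_, ?_, fun i hi => ?_, ?_⟩, r₂⟩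
    · rw [x₂.nmem a (by omega), x₁.nmem a ha]
    · rw [x₂.rmem a (by omega), x₁.rmem a ha]
    · rw [x₂.stack, x₁.stack]
    · rw [x₂.regs i hi, x₁.regs i hi]
    · rw [x₂.out, x₁.out]
  | ite k c f g ihc ihf ihg =>
    obtain ⟨y, t₁, t₂, p, hc, hp, hf, hg, rfl⟩ := hd
    obtain ⟨s₁, hs₁, p4, pn, pr, p3, pa, pb, p2, pi, po⟩ := exec_push s
    have e₁ : Exec procs (block push) s _ s₁ := hs₁ ▸ exec_block procs push s
    have hin₁ : s₁.HasInput inp :=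
      ⟨hin.1.trans (by omega), fun n hn => by rw [pr]; exact hin.2 n hn⟩
    have hx₁ : Rep s₁ x (s.nreg 2) := hx.mono (by omega) pn (fun a _ => by rw [pr])
    obtain ⟨k₂, s₂, e₂, hk₂, x₂, r₂⟩ := ihc hc (by omega) hin₁ (by rwa [p2])
    have hs3 : s₂.nreg 3 = s.nreg 4 := x₂.stack.trans p3
    have hle := x₂.le
    obtain ⟨s₃, hs₃, q4, qn, qr, q3, q2, qi, qo, qc⟩ := exec_test k s₂ r₂ hp
    have e₃ : Exec procs (block (unpair 2 ++ k.load ++ pop)) s₂ _ s₃ :=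
      hs₃ ▸ exec_block procs _ s₂
    rw [hs3] at q2 q3
    rw [x₂.nmem _ (by omega), pa] at q2
    rw [x₂.nmem _ (by omega), pb] at q3
    have x₃ : Ext s s₃ := by
      refine ⟨by omega, fun a ha => ?_, fun a ha => ?_, by omega, fun i hi => ?_, ?_⟩
      · rw [qn, x₂.nmem a (by omega), pn a ha]
      · rw [qr, x₂.rmem a (by omega), pr]
      · rw [qi i hi, x₂.regs i hi, pi i hi]
      · rw [qo, x₂.out, po]
    have hx₃ : Rep s₃ x (s₃.nreg 2) := by rw [q2]; exact hx.ext x₃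
    have key : ∃ k₄ s₄, Exec procs (.ite k.cond (compile f) (compile g)) s₃ (k₄ + 1) s₄ ∧
        k₄ ≤ f.steps + g.steps + M * t₂ ∧ Ext s₃ s₄ ∧ Rep s₄ v (s₄.nreg 2) := by
      by_cases hpp : p
      · obtain ⟨k₄, s₄, e₄, hk₄, x₄, r₄⟩ := ihf (hf hpp) (by omega) (hin.ext x₃) hx₃
        exact ⟨k₄, s₄, .iteTrue (qc.2 hpp) e₄, by omega, x₄, r₄⟩
      · obtain ⟨k₄, s₄, e₄, hk₄, x₄, r₄⟩ := ihg (hg hpp) (by omega) (hin.ext x₃) hx₃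
        exact ⟨k₄, s₄, .iteFalse (fun h => hpp (qc.1 h)) e₄, by omega, x₄, r₄⟩
    obtain ⟨k₄, s₄, e₄, hk₄, x₄, r₄⟩ := key
    have hle' := x₃.le
    refine ⟨_, s₄, e₁.seq (e₂.seq (e₃.seq e₄)), ?_,
      ⟨x₃.le.trans x₄.le, fun a ha => ?_, fun a ha => ?_, ?_, fun i hi => ?_, ?_⟩, r₄⟩
    · cases k <;> simp [Prog.steps, push, pop, allocPair, unpair, Cmp.load, mul_add] <;> omega
    · rw [x₄.nmem a (by omega), x₃.nmem a ha]
    · rw [x₄.rmem a (by omega), x₃.rmem a ha]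
    · rw [x₄.stack, x₃.stack]
    · rw [x₄.regs i hi, x₃.regs i hi]
    · rw [x₄.out, x₃.out]
  | call i =>
    obtain ⟨k, s', h1, h2, h3, h4⟩ := hcall i x v t s ht hd hin hx
    exact ⟨k, s', h1, by simpa [Prog.steps] using h2, h3, h4⟩

/-- The bodies `bs` meet the specification `S`: each call is justified by calls of smaller cost. -/
def Meets (bs : List Prog) (S : CallSpec) (inp : Input) : Prop :=
  ∀ i x v t, S i x v t → ∃ e, bs[i]? = some e ∧ wp S inp e x fun v' t' => v' = v ∧ t' < t

/-- The `+ 1` pays for the machine step of the call itself. -/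
def stepBound (bs : List Prog) : ℕ := (bs.map Prog.steps).sum + 1

/-- Induction on the cost, not on the program: a body runs within strictly smaller cost than its
call, so arbitrary mutual recursion terminates. The unit of cost lost at each call pays for the
straight-line part of the body. -/
theorem Meets.yields {bs : List Prog} {S : CallSpec} {inp : Input} (h : Meets bs S inp)
    {i : ℕ} {x v : Val} {t : ℕ} (hS : S i x v t) {s : State} (hin : s.HasInput inp)
    (hx : Rep s x (s.nreg 2)) :
    Yields (bs.map compile) (.call i) s v (stepBound bs * t) := by
  induction t using Nat.strong_induction_on generalizing i x v s with
  | _ t ih =>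
    obtain ⟨e, he, hw⟩ := h i x v t hS
    obtain ⟨v', t', hd, rfl, ht'⟩ := Den.of_wp hw
    obtain ⟨k, s', h1, h2, h3, h4⟩ := exec_compile (M := stepBound bs)
      (fun i x v t₁ s ht₁ hS hin hx => ih t₁ ht₁ hS hin hx) e hd ht' hin hx
    refine ⟨k + 1, s', .call (by simp [he]) h1, ?_, h3, h4⟩
    have hsum : e.steps + 1 ≤ stepBound bs := by
      have := List.single_le_sum (l := bs.map Prog.steps) (by simp) e.steps
        (List.mem_map_of_mem (List.mem_of_getElem? he))
      unfold stepBound; omega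
    calc k + 1 ≤ stepBound bs + stepBound bs * t' := by omega
      _ = stepBound bs * (t' + 1) := by ring
      _ ≤ _ := Nat.mul_le_mul_left _ ht'

theorem Meets.yields_wp {bs : List Prog} {S : CallSpec} {inp : Input} (h : Meets bs S inp)
    {e : Prog} {x v : Val} {t : ℕ} (hw : wp S inp e x fun v' t' => v' = v ∧ t' ≤ t)
    {s : State} (hin : s.HasInput inp) (hx : Rep s x (s.nreg 2)) :
    Yields (bs.map compile) (compile e) s v (e.steps + stepBound bs * t) := by
  obtain ⟨v', t', hd, rfl, ht'⟩ := Den.of_wp hw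
  obtain ⟨k, s', h1, h2, h3, h4⟩ := exec_compile (M := stepBound bs) (T := t' + 1)
    (fun i x v t₁ s _ hS hin hx => h.yields hS hin hx) e hd (by omega) hin hx
  exact ⟨k, s', h1, h2.trans (by gcongr), h3, h4⟩

end DynCover
end

noncomputable section

namespace DynCover

/-! ## Items -/

/-- The items that are stored: the points and the endpoints of the intervals, together with two
sentinels. Items are ordered lexicographically. -/
@[ext] structure Item where
  tag : ℕ
  crd : ℝ
  kind : ℕ
  oth : ℝ

namespace Item

/-- At equal coordinates left endpoints (kind `0`) precede points (kind `1`), which precede right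
endpoints (kind `2`); so membership in a closed interval becomes a strict order condition. The last
component distinguishes intervals with a common endpoint and makes the partner of an endpoint
computable. -/
def key (x : Item) : ℕ ×ₗ ℝ ×ₗ ℕ ×ₗ ℝ := toLex (x.tag, toLex (x.crd, toLex (x.kind, x.oth)))

theorem key_injective : Function.Injective key := by
  intro x y h
  simp only [key, EmbeddingLike.apply_eq_iff_eq, Prod.mk.injEq] at h
  exact Item.ext h.1 h.2.1 h.2.2.1 h.2.2.2

instance : LinearOrder Item := LinearOrder.lift' key key_injective

theorem lt_def (x y : Item) : x < y ↔ x.tag < y.tag ∨ x.tag = y.tag ∧ (x.crd < y.crd ∨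
    x.crd = y.crd ∧ (x.kind < y.kind ∨ x.kind = y.kind ∧ x.oth < y.oth)) := by
  change key x < key y ↔ _
  simp [key, Prod.Lex.toLex_lt_toLex]

def bot : Item := ⟨0, 0, 0, 0⟩
def top : Item := ⟨2, 0, 0, 0⟩
/-- The item of a point. -/
def pt (x : ℝ) : Item := ⟨1, x, 1, 0⟩
/-- The item of the left endpoint of an interval. -/
def lo (I : NonemptyInterval ℝ) : Item := ⟨1, I.fst, 0, I.snd⟩
/-- The item of the right endpoint of an interval. -/
def hi (I : NonemptyInterval ℝ) : Item := ⟨1, I.snd, 2, I.fst⟩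

/-- The right endpoint that belongs to a left endpoint. -/
def toHi (x : Item) : Item := if x.kind = 0 then ⟨1, x.oth, 2, x.crd⟩ else bot
/-- The left endpoint that belongs to a right endpoint. -/
def toLo (x : Item) : Item := if x.kind = 2 then ⟨1, x.oth, 0, x.crd⟩ else top
-- The default `bot` is neutral for the maximum in `dataOf`, so items of other kinds are invisible
-- to it; `toHi` and `toLo` use `bot` and `top` in the same way.
def toPt (x : Item) : Item := if x.kind = 1 then x else bot

theorem bot_lt {x : Item} (h : x.tag = 1) : bot < x := by simp [lt_def, bot, h]

theorem bot_le_toHi (x : Item) : bot ≤ x.toHi := by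
  unfold toHi
  split_ifs
  · exact (bot_lt rfl).le
  · exact le_rfl

end Item

open Item (bot top)

/-! ## Balanced trees -/

structure Data where
  h : ℕ
  size : ℕ
  first : Item
  last : Item
  maxHi : Item
  minLo : Item
  lastPt : Item

/-- Leaf-oriented search trees; every node carries a summary and a second tree. -/
inductive Tree where
  | nil
  | leaf (x : Item)
  | node (d : Data) (sol l r : Tree)

namespace Tree

def data : Tree → Data
  | nil => ⟨0, 0, bot, bot, bot, top, bot⟩
  | leaf x => ⟨0, 1, x, x, x.toHi, x.toLo, x.toPt⟩
  | node d _ _ _ => d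

def h (t : Tree) : ℕ := t.data.h
def size (t : Tree) : ℕ := t.data.size

/-- A leaf needs no solution: it is either a point, and then no interval has an endpoint there, or
an endpoint, and then there is no point to cover. -/
def sol : Tree → Tree
  | node _ s _ _ => s
  | _ => nil

def toList : Tree → List Item
  | nil => []
  | leaf x => [x]
  | node _ _ l r => l.toList ++ r.toList

def dataOf (l r : Tree) : Data where
  h := max l.h r.h + 1
  size := l.size + r.size
  first := l.data.first
  last := r.data.last
  maxHi := max l.data.maxHi r.data.maxHi
  minLo := min l.data.minLo r.data.minLo
  lastPt := max l.data.lastPt r.data.lastPt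

variable (f : Tree → Tree → Tree)

/-- The balancing is generic in the function `f` that computes the second tree of a node from its
children; it is used both for annotated and for plain trees. -/
def mk (l r : Tree) : Tree := node (dataOf l r) (f l r) l r

def balR (a : Tree) : Tree → Tree
  | node e s c d =>
    if e.h ≤ a.h + 1 then mk f a (node e s c d)
    else if c.h ≤ d.h then mk f (mk f a c) d
    else match c with
      | node _ _ c₁ c₂ => mk f (mk f a c₁) (mk f c₂ d)
      | c => mk f (mk f a c) d
  | t => mk f a t

def balL (a : Tree) : Tree → Tree
  | node e s c d =>
    if e.h ≤ a.h + 1 then mk f (node e s c d) a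
    else if d.h ≤ c.h then mk f c (mk f d a)
    else match d with
      | node _ _ d₁ d₂ => mk f (mk f c d₁) (mk f d₂ a)
      | d => mk f c (mk f d a)
  | t => mk f t a

/-- Attach `r` at the right end of a tree that is not much lower. -/
def joinR (r : Tree) : Tree → Tree
  | node e s a b =>
    if e.h ≤ r.h + 1 then mk f (node e s a b) r else balR f a (joinR r b)
  | t => mk f t r

/-- Attach `l` at the left end of a tree that is not much lower. -/
def joinL (l : Tree) : Tree → Tree
  | node e s a b =>
    if e.h ≤ l.h + 1 then mk f l (node e s a b) else balL f b (joinL l a)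
  | t => mk f l t

/-- Concatenation. -/
def join : Tree → Tree → Tree
  | nil, r => r
  | l, nil => l
  | l, r => if l.h < r.h then joinL f l r else joinR f r l

/-- Rebalancing is left to `join`, which creates boundedly many nodes when the two heights differ by
a constant. -/
def insert (x : Item) : Tree → Tree
  | nil => leaf x
  | leaf y => if x < y then mk f (leaf x) (leaf y) else
      if y < x then mk f (leaf y) (leaf x) else leaf y
  | node _ _ l r => if x < r.data.first then join f (insert x l) r else join f l (insert x r)

def delete (x : Item) : Tree → Tree
  | nil => nil
  | leaf y => if x < y then leaf y else if y < x then leaf y else nil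
  | node _ _ l r => if x < r.data.first then join f (delete x l) r else join f l (delete x r)

def Mem (x : Item) : Tree → Prop
  | nil => False
  | leaf y => ¬ x < y ∧ ¬ y < x
  | node _ _ l r => (x < r.data.first → Mem x l) ∧ (¬ x < r.data.first → Mem x r)

/-- Nonempty, balanced, and with correct annotations. -/
def Bal : Tree → Prop
  | nil => False
  | leaf _ => True
  | node d s l r => Bal l ∧ Bal r ∧ d = dataOf l r ∧ s = f l r ∧ l.h ≤ r.h + 1 ∧ r.h ≤ l.h + 1

def Ok (t : Tree) : Prop := t = nil ∨ Bal f t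

variable {f}

@[simp] theorem data_mk (l r : Tree) : (mk f l r).data = dataOf l r := rfl
@[simp] theorem h_mk (l r : Tree) : (mk f l r).h = max l.h r.h + 1 := rfl
@[simp] theorem h_leaf (x : Item) : (leaf x).h = 0 := rfl
@[simp] theorem h_nil : nil.h = 0 := rfl
@[simp] theorem toList_mk (l r : Tree) : (mk f l r).toList = l.toList ++ r.toList := rfl

theorem Bal.ne_nil {t : Tree} (ht : Bal f t) : t ≠ nil := by rintro rfl; exact ht
theorem Bal.ok {t : Tree} (ht : Bal f t) : Ok f t := .inr ht
theorem Ok.bal {t : Tree} (ht : Ok f t) (h : t ≠ nil) : Bal f t := ht.resolve_left h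

theorem Bal.mk {l r : Tree} (hl : Bal f l) (hr : Bal f r) (h₁ : l.h ≤ r.h + 1)
    (h₂ : r.h ≤ l.h + 1) : Bal f (mk f l r) := ⟨hl, hr, rfl, rfl, h₁, h₂⟩

theorem toList_balR (a t : Tree) : (balR f a t).toList = a.toList ++ t.toList := by
  unfold balR
  split
  · split_ifs
    · rfl
    · simp [toList]
    · split <;> simp [toList]
  · rfl

theorem toList_balL (a t : Tree) : (balL f a t).toList = t.toList ++ a.toList := by
  unfold balL
  split
  · split_ifs
    · rfl
    · simp [toList]
    · split <;> simp [toList]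
  · rfl

theorem toList_joinR (r t : Tree) : (joinR f r t).toList = t.toList ++ r.toList := by
  induction t with
  | node e s a b _ _ ihb =>
    unfold joinR
    split_ifs
    · rfl
    · rw [toList_balR, ihb]; simp [toList]
  | _ => rfl

theorem toList_joinL (l t : Tree) : (joinL f l t).toList = l.toList ++ t.toList := by
  induction t with
  | node e s a b _ iha _ =>
    unfold joinL
    split_ifs
    · rfl
    · rw [toList_balL, iha]; simp [toList]
  | _ => rfl

theorem toList_join (l r : Tree) : (join f l r).toList = l.toList ++ r.toList := by
  unfold join
  split
  · rfl
  · simp [toList]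
  · split_ifs
    · exact toList_joinL _ _
    · exact toList_joinR _ _

/-- The last clause gives the exact height when no rotation is needed. It supplies the lower bound
on the height in the induction of `bal_joinR`. -/
theorem bal_balR {a t : Tree} (ha : Bal f a) (ht : Bal f t) (h₁ : t.h ≤ a.h + 2)
    (h₂ : a.h ≤ t.h + 1) : Bal f (balR f a t) ∧ max a.h t.h ≤ (balR f a t).h ∧
      (balR f a t).h ≤ max a.h t.h + 1 ∧ (t.h ≤ a.h + 1 → (balR f a t).h = max a.h t.h + 1) := by
  unfold balR
  split
  · rename_i e s c d
    obtain ⟨hc, hd, rfl, rfl, h₃, h₄⟩ := ht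
    have he : (node (dataOf c d) (f c d) c d).h = max c.h d.h + 1 := rfl
    have he' : (dataOf c d).h = max c.h d.h + 1 := rfl
    split_ifs with h5 h6
    · refine ⟨ha.mk ⟨hc, hd, rfl, rfl, h₃, h₄⟩ ?_ ?_, ?_, ?_, fun _ => rfl⟩ <;>
        (try simp only [h_mk]) <;> omega
    · refine ⟨(ha.mk hc ?_ ?_).mk hd ?_ ?_, ?_, ?_, ?_⟩ <;> (try simp only [h_mk]) <;> omega
    · split
      · rename_i e' s' c₁ c₂
        obtain ⟨hc₁, hc₂, rfl, rfl, h₅, h₆⟩ := hc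
        have he2 : (node (dataOf c₁ c₂) (f c₁ c₂) c₁ c₂).h = max c₁.h c₂.h + 1 := rfl
        refine ⟨(ha.mk hc₁ ?_ ?_).mk (hc₂.mk hd ?_ ?_) ?_ ?_, ?_, ?_, ?_⟩ <;>
        (try simp only [h_mk]) <;> omega
      · exfalso
        cases c with
        | nil => exact hc
        | leaf => simp at h6
        | node e s c d => rename_i hne; exact hne e s c d rfl
  · refine ⟨ha.mk ht ?_ ?_, ?_, ?_, fun _ => rfl⟩ <;>
      (try simp only [h_mk])
    all_goals
      cases t with
      | nil => exact ht.elim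
      | leaf => simp only [h_leaf] at *; omega
      | node e s c d => rename_i hne; exact absurd rfl (hne e s c d)

theorem bal_balL {a t : Tree} (ha : Bal f a) (ht : Bal f t) (h₁ : t.h ≤ a.h + 2)
    (h₂ : a.h ≤ t.h + 1) : Bal f (balL f a t) ∧ max a.h t.h ≤ (balL f a t).h ∧
      (balL f a t).h ≤ max a.h t.h + 1 ∧ (t.h ≤ a.h + 1 → (balL f a t).h = max a.h t.h + 1) := by
  unfold balL
  split
  · rename_i e s c d
    obtain ⟨hc, hd, rfl, rfl, h₃, h₄⟩ := ht
    have he : (node (dataOf c d) (f c d) c d).h = max c.h d.h + 1 := rfl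
    have he' : (dataOf c d).h = max c.h d.h + 1 := rfl
    split_ifs with h5 h6
    · refine ⟨Bal.mk ⟨hc, hd, rfl, rfl, h₃, h₄⟩ ha ?_ ?_, ?_, ?_, fun _ => by rw [h_mk, max_comm]⟩ <;>
        (try simp only [h_mk]) <;> omega
    · refine ⟨hc.mk (hd.mk ha ?_ ?_) ?_ ?_, ?_, ?_, ?_⟩ <;> (try simp only [h_mk]) <;> omega
    · split
      · rename_i e' s' d₁ d₂
        obtain ⟨hd₁, hd₂, rfl, rfl, h₅, h₆⟩ := hd
        have he2 : (node (dataOf d₁ d₂) (f d₁ d₂) d₁ d₂).h = max d₁.h d₂.h + 1 := rfl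
        refine ⟨(hc.mk hd₁ ?_ ?_).mk (hd₂.mk ha ?_ ?_) ?_ ?_, ?_, ?_, ?_⟩ <;>
        (try simp only [h_mk]) <;> omega
      · exfalso
        cases d with
        | nil => exact hd
        | leaf => simp at h6
        | node e s c d => rename_i hne; exact hne e s c d rfl
  · refine ⟨ht.mk ha ?_ ?_, ?_, ?_, fun _ => by rw [h_mk, max_comm]⟩ <;>
      (try simp only [h_mk])
    all_goals
      cases t with
      | nil => exact ht.elim
      | leaf => simp only [h_leaf] at *; omega
      | node e s c d => rename_i hne; exact absurd rfl (hne e s c d)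

theorem bal_joinR {r t : Tree} (hr : Bal f r) (ht : Bal f t) (h₁ : r.h ≤ t.h + 1) :
    Bal f (joinR f r t) ∧ max t.h r.h ≤ (joinR f r t).h ∧ (joinR f r t).h ≤ max t.h r.h + 1 ∧
      (t.h ≤ r.h + 1 → (joinR f r t).h = max t.h r.h + 1) := by
  induction t with
  | nil => exact ht.elim
  | leaf x =>
    simp only [joinR, h_mk, h_leaf] at *
    exact ⟨ht.mk hr (by simp) h₁, by simp, by simp, by simp⟩
  | node e s a b _ _ ihb =>
    obtain ⟨ha, hb, rfl, rfl, h₃, h₄⟩ := ht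
    have he : (node (dataOf a b) (f a b) a b).h = max a.h b.h + 1 := rfl
    have he' : (dataOf a b).h = max a.h b.h + 1 := rfl
    unfold joinR
    split_ifs with h5
    · refine ⟨Bal.mk ⟨ha, hb, rfl, rfl, h₃, h₄⟩ hr ?_ ?_, ?_, ?_, fun _ => rfl⟩ <;>
        (try simp only [h_mk]) <;> omega
    · obtain ⟨i1, i2, i3, i4⟩ := ihb hb (by omega)
      obtain ⟨j1, j2, j3, j4⟩ := bal_balR ha i1 (by omega) (by omega)
      refine ⟨j1, ?_, ?_, ?_⟩ <;> omega

theorem bal_joinL {l t : Tree} (hl : Bal f l) (ht : Bal f t) (h₁ : l.h ≤ t.h + 1) :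
    Bal f (joinL f l t) ∧ max t.h l.h ≤ (joinL f l t).h ∧ (joinL f l t).h ≤ max t.h l.h + 1 ∧
      (t.h ≤ l.h + 1 → (joinL f l t).h = max t.h l.h + 1) := by
  induction t with
  | nil => exact ht.elim
  | leaf x =>
    simp only [joinL, h_mk, h_leaf] at *
    exact ⟨hl.mk ht h₁ (by simp), by omega, by omega, by omega⟩
  | node e s a b _ iha _ =>
    obtain ⟨ha, hb, rfl, rfl, h₃, h₄⟩ := ht
    have he : (node (dataOf a b) (f a b) a b).h = max a.h b.h + 1 := rfl
    have he' : (dataOf a b).h = max a.h b.h + 1 := rfl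
    unfold joinL
    split_ifs with h5
    · refine ⟨hl.mk ⟨ha, hb, rfl, rfl, h₃, h₄⟩ ?_ ?_, ?_, ?_, fun _ => by rw [h_mk, max_comm]⟩ <;> (try simp only [h_mk]) <;> omega
    · obtain ⟨i1, i2, i3, i4⟩ := iha ha (by omega)
      obtain ⟨j1, j2, j3, j4⟩ := bal_balL hb i1 (by omega) (by omega)
      refine ⟨j1, ?_, ?_, ?_⟩ <;> omega

theorem join_of_ne_nil {l r : Tree} (hl : l ≠ nil) (hr : r ≠ nil) :
    join f l r = if l.h < r.h then joinL f l r else joinR f r l := by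
  unfold join
  split
  · contradiction
  · contradiction
  · rfl

@[simp] theorem join_nil_left (r : Tree) : join f nil r = r := by unfold join; rfl
@[simp] theorem join_nil_right (l : Tree) : join f l nil = l := by
  cases l <;> rfl

theorem bal_join {l r : Tree} (hl : Bal f l) (hr : Bal f r) :
    Bal f (join f l r) ∧ max l.h r.h ≤ (join f l r).h ∧ (join f l r).h ≤ max l.h r.h + 1 ∧
      (l.h ≤ r.h + 1 → r.h ≤ l.h + 1 → (join f l r).h = max l.h r.h + 1) := by
  rw [join_of_ne_nil hl.ne_nil hr.ne_nil]
  split_ifs with h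
  · obtain ⟨i1, i2, i3, i4⟩ := bal_joinL hl hr (by omega)
    refine ⟨i1, ?_, ?_, ?_⟩ <;> omega
  · obtain ⟨i1, i2, i3, i4⟩ := bal_joinR hr hl (by omega)
    refine ⟨i1, ?_, ?_, ?_⟩ <;> omega

theorem ok_join {l r : Tree} (hl : Ok f l) (hr : Ok f r) : Ok f (join f l r) := by
  rcases hl with rfl | hl
  · simpa using hr
  rcases hr with rfl | hr
  · simpa using hl.ok
  exact (bal_join hl hr).1.ok

theorem bal_insert {x : Item} {t : Tree} (ht : Ok f t) :
    Bal f (insert f x t) ∧ t.h ≤ (insert f x t).h ∧ (insert f x t).h ≤ t.h + 1 := by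
  induction t with
  | nil => exact ⟨trivial, le_rfl, by simp [insert]⟩
  | leaf y =>
    unfold insert
    split_ifs
    · exact ⟨Bal.mk trivial trivial (by simp) (by simp), by simp, by simp⟩
    · exact ⟨Bal.mk trivial trivial (by simp) (by simp), by simp, by simp⟩
    · exact ⟨trivial, le_rfl, by simp⟩
  | node e s a b _ iha ihb =>
    obtain ⟨ha, hb, rfl, rfl, h₃, h₄⟩ := ht.bal (by simp)
    have he : (node (dataOf a b) (f a b) a b).h = max a.h b.h + 1 := rfl
    unfold insert
    split_ifs
    · obtain ⟨i1, i2, i3⟩ := iha ha.ok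
      obtain ⟨j1, j2, j3, j4⟩ := bal_join i1 hb
      refine ⟨j1, ?_, ?_⟩ <;> omega
    · obtain ⟨i1, i2, i3⟩ := ihb hb.ok
      obtain ⟨j1, j2, j3, j4⟩ := bal_join ha i1
      refine ⟨j1, ?_, ?_⟩ <;> omega

/-- The height falls by at most one, so `join` meets heights that differ by at most two. The last
clause treats a child that disappears: it had height `0`, hence its sibling has height at most `1`.
-/
theorem ok_delete {x : Item} {t : Tree} (ht : Ok f t) :
    Ok f (delete f x t) ∧ t.h ≤ (delete f x t).h + 1 ∧ (delete f x t).h ≤ t.h ∧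
      (delete f x t = nil → t.h = 0) := by
  induction t with
  | nil => exact ⟨.inl rfl, by simp, le_rfl, fun _ => rfl⟩
  | leaf y =>
    unfold delete
    split_ifs
    · exact ⟨ht, by simp, le_rfl, fun _ => rfl⟩
    · exact ⟨ht, by simp, le_rfl, fun _ => rfl⟩
    · exact ⟨.inl rfl, by simp, le_rfl, fun _ => rfl⟩
  | node e s a b _ iha ihb =>
    obtain ⟨ha, hb, rfl, rfl, h₃, h₄⟩ := ht.bal (by simp)
    have he : (node (dataOf a b) (f a b) a b).h = max a.h b.h + 1 := rfl
    unfold delete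
    split_ifs
    · obtain ⟨i1, i2, i3, i4⟩ := iha ha.ok
      by_cases hn : delete f x a = nil
      · have := i4 hn
        rw [hn, join_nil_left]
        exact ⟨hb.ok, by omega, by omega, fun h => absurd h hb.ne_nil⟩
      · obtain ⟨j1, j2, j3, j4⟩ := bal_join (i1.bal hn) hb
        refine ⟨j1.ok, ?_, ?_, fun h => absurd h j1.ne_nil⟩ <;> omega
    · obtain ⟨i1, i2, i3, i4⟩ := ihb hb.ok
      by_cases hn : delete f x b = nil
      · have := i4 hn
        rw [hn, join_nil_right]
        exact ⟨ha.ok, by omega, by omega, fun h => absurd h ha.ne_nil⟩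
      · obtain ⟨j1, j2, j3, j4⟩ := bal_join ha (i1.bal hn)
        refine ⟨j1.ok, ?_, ?_, fun h => absurd h j1.ne_nil⟩ <;> omega

/-! ### Annotations -/

theorem Bal.size_eq {t : Tree} (ht : Bal f t) : t.size = t.toList.length := by
  induction t with
  | nil => exact ht.elim
  | leaf x => rfl
  | node e s a b _ iha ihb =>
    obtain ⟨ha, hb, rfl, rfl, -, -⟩ := ht
    change a.size + b.size = _
    simp [toList, iha ha, ihb hb]

theorem Ok.size_eq {t : Tree} (ht : Ok f t) : t.size = t.toList.length := by
  rcases ht with rfl | ht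
  · rfl
  · exact ht.size_eq

theorem Bal.toList_ne_nil {t : Tree} (ht : Bal f t) : t.toList ≠ [] := by
  induction t with
  | nil => exact ht.elim
  | leaf x => simp [toList]
  | node e s a b _ iha ihb => simp [toList, iha ht.1]

theorem Bal.first_eq {t : Tree} (ht : Bal f t) : t.toList.head? = some t.data.first := by
  induction t with
  | nil => exact ht.elim
  | leaf x => rfl
  | node e s a b _ iha ihb =>
    obtain ⟨ha, hb, rfl, rfl, -, -⟩ := ht
    simp [toList, iha ha, data, dataOf]

theorem Bal.last_eq {t : Tree} (ht : Bal f t) : t.toList.getLast? = some t.data.last := by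
  induction t with
  | nil => exact ht.elim
  | leaf x => rfl
  | node e s a b _ iha ihb =>
    obtain ⟨ha, hb, rfl, rfl, -, -⟩ := ht
    simp [toList, ihb hb, data, dataOf]

theorem Bal.first_mem {t : Tree} (ht : Bal f t) : t.data.first ∈ t.toList :=
  List.mem_of_mem_head? (by simp [ht.first_eq])

theorem Bal.last_mem {t : Tree} (ht : Bal f t) : t.data.last ∈ t.toList :=
  List.mem_of_mem_getLast? (by simp [ht.last_eq])

abbrev Sorted (t : Tree) : Prop := t.toList.Pairwise (· < ·)

theorem Bal.first_le {t : Tree} (ht : Bal f t) (hs : t.Sorted) {x : Item} (hx : x ∈ t.toList) :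
    t.data.first ≤ x := by
  obtain ⟨y, l, hl⟩ := List.exists_cons_of_ne_nil ht.toList_ne_nil
  have h1 := ht.first_eq
  rw [hl] at h1 hx
  simp only [List.head?_cons, Option.some.injEq] at h1
  unfold Sorted at hs
  rw [hl] at hs
  rcases List.mem_cons.1 hx with rfl | hx
  · exact h1.ge
  · exact h1 ▸ (List.rel_of_pairwise_cons hs hx).le

theorem Bal.le_last {t : Tree} (ht : Bal f t) (hs : t.Sorted) {x : Item} (hx : x ∈ t.toList) :
    x ≤ t.data.last := by
  obtain ⟨l, y, hl⟩ := List.eq_nil_or_concat'  t.toList |>.resolve_left ht.toList_ne_nil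
  have h1 := ht.last_eq
  rw [hl] at h1 hx
  simp only [List.getLast?_append, List.getLast?_singleton, Option.some_or, Option.some.injEq]
    at h1
  unfold Sorted at hs
  rw [hl] at hs
  rcases List.mem_append.1 hx with hx | hx
  · exact h1 ▸ ((List.pairwise_append.1 hs).2.2 x hx y (by simp)).le
  · simp only [List.mem_singleton] at hx
    rw [hx, h1]

/-- Let `b` be the higher child and `a` the other one. By induction `2 ^ b.h` is at most `b.size ^
2` and at most `2 * a.size ^ 2`, hence at most `2 * a.size * b.size` by multiplication; adding the
first and the last bound gives `2 ^ (b.h + 1) ≤ (a.size + b.size) ^ 2`. This replaces the usual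
estimate by Fibonacci numbers. -/
theorem Bal.two_pow_le {t : Tree} (ht : Bal f t) : 2 ^ t.h ≤ t.size ^ 2 ∧ t.size ≤ 2 ^ t.h := by
  suffices H : 1 ≤ t.size ∧ 2 ^ t.h ≤ t.size ^ 2 ∧ t.size ≤ 2 ^ t.h from H.2
  induction t with
  | nil => exact ht.elim
  | leaf x => simp [h, size, data]
  | node e s a b _ iha ihb =>
    obtain ⟨ha, hb, rfl, rfl, h₁, h₂⟩ := ht
    obtain ⟨i0, i1, i2⟩ := iha ha
    obtain ⟨j0, j1, j2⟩ := ihb hb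
    change 1 ≤ a.size + b.size ∧ 2 ^ (max a.h b.h + 1) ≤ (a.size + b.size) ^ 2 ∧
      a.size + b.size ≤ 2 ^ (max a.h b.h + 1)
    refine ⟨by omega, ?_, ?_⟩
    · rcases le_total a.h b.h with hab | hab
      · rw [max_eq_right hab]
        have : 2 ^ b.h ≤ 2 * 2 ^ a.h := by
          rw [← pow_succ']; exact Nat.pow_le_pow_right (by simp) h₂
        rw [pow_succ]
        nlinarith
      · rw [max_eq_left hab]
        have : 2 ^ a.h ≤ 2 * 2 ^ b.h := by
          rw [← pow_succ']; exact Nat.pow_le_pow_right (by simp) h₁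
        rw [pow_succ]
        nlinarith
    · have h3 := Nat.pow_le_pow_right (n := 2) (by simp) (le_max_left a.h b.h)
      have h4 := Nat.pow_le_pow_right (n := 2) (by simp) (le_max_right a.h b.h)
      rw [pow_succ]; omega

end Tree
end DynCover
end

noncomputable section

namespace DynCover

open Item (bot top)

namespace Tree

variable {f : Tree → Tree → Tree}

/-! ### Insertion, deletion, search -/

@[simp] theorem data_node (d : Data) (s l r : Tree) : (node d s l r).data = d := rfl

theorem toList_node (d : Data) (s l r : Tree) :
    (node d s l r).toList = l.toList ++ r.toList := rfl

theorem Sorted.left {d : Data} {s l r : Tree} (h : (node d s l r).Sorted) : l.Sorted :=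
  (List.pairwise_append.1 h).1

theorem Sorted.right {d : Data} {s l r : Tree} (h : (node d s l r).Sorted) : r.Sorted :=
  (List.pairwise_append.1 h).2.1

theorem Sorted.lt {d : Data} {s l r : Tree} (h : (node d s l r).Sorted) {x y : Item}
    (hx : x ∈ l.toList) (hy : y ∈ r.toList) : x < y :=
  (List.pairwise_append.1 h).2.2 x hx y hy

theorem insert_spec (x : Item) {t : Tree} (ht : Ok f t) (hs : t.Sorted) :
    (insert f x t).Sorted ∧ ∀ y, y ∈ (insert f x t).toList ↔ y = x ∨ y ∈ t.toList := by
  induction t with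
  | nil => simp [insert, Sorted, toList]
  | leaf y =>
    unfold insert
    split_ifs with h₁ h₂
    · simpa [Sorted, toList] using h₁
    · refine ⟨by simpa [Sorted, toList] using h₂, fun z => ?_⟩
      simp [toList, or_comm]
    · obtain rfl := le_antisymm (not_lt.1 h₂) (not_lt.1 h₁)
      simp [Sorted, toList]
  | node d s l r _ ihl ihr =>
    obtain ⟨hl, hr, rfl, rfl, -, -⟩ := ht.bal (by simp)
    unfold insert
    split_ifs with h
    · obtain ⟨i1, i2⟩ := ihl hl.ok hs.left
      refine ⟨?_, fun y => ?_⟩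
      · rw [Sorted, toList_join]
        refine List.pairwise_append.2 ⟨i1, hs.right, fun a ha b hb => ?_⟩
        rcases (i2 a).1 ha with rfl | ha
        · exact h.trans_le (hr.first_le hs.right hb)
        · exact hs.lt ha hb
      · rw [toList_join, List.mem_append, i2, toList_node, List.mem_append, or_assoc]
    · obtain ⟨i1, i2⟩ := ihr hr.ok hs.right
      refine ⟨?_, fun y => ?_⟩
      · rw [Sorted, toList_join]
        refine List.pairwise_append.2 ⟨hs.left, i1, fun a ha b hb => ?_⟩
        rcases (i2 b).1 hb with rfl | hb
        · exact (hs.lt ha hr.first_mem).trans_le (not_lt.1 h)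
        · exact hs.lt ha hb
      · rw [toList_join, List.mem_append, i2, toList_node, List.mem_append]
        tauto

theorem length_insert_le (x : Item) (t : Tree) :
    (insert f x t).toList.length ≤ t.toList.length + 1 := by
  induction t with
  | nil => simp [insert, toList]
  | leaf y =>
    unfold insert
    split_ifs <;> simp [toList]
  | node d s l r _ ihl ihr =>
    unfold insert
    split_ifs <;> simp only [toList_join, toList_node, List.length_append] <;> omega

theorem delete_sublist (x : Item) (t : Tree) :
    (delete f x t).toList.Sublist t.toList := by
  induction t with
  | nil => exact List.Sublist.refl _
  | leaf y =>
    unfold delete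
    split_ifs
    · exact List.Sublist.refl _
    · exact List.Sublist.refl _
    · exact List.nil_sublist _
  | node d s l r _ ihl ihr =>
    unfold delete
    split_ifs <;> rw [toList_join, toList_node]
    · exact ihl.append (List.Sublist.refl _)
    · exact (List.Sublist.refl _).append ihr

theorem mem_delete (x : Item) {t : Tree} (ht : Ok f t) (hs : t.Sorted) {f' : Tree → Tree → Tree}
    (y : Item) : y ∈ (delete f' x t).toList ↔ y ≠ x ∧ y ∈ t.toList := by
  induction t with
  | nil => simp [delete, toList]
  | leaf z =>
    unfold delete
    split_ifs with h₁ h₂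
    · simp only [toList, List.mem_singleton, iff_and_self]
      rintro rfl; exact h₁.ne'
    · simp only [toList, List.mem_singleton, iff_and_self]
      rintro rfl; exact h₂.ne
    · obtain rfl := le_antisymm (not_lt.1 h₂) (not_lt.1 h₁)
      simp [toList]
  | node d s l r _ ihl ihr =>
    obtain ⟨hl, hr, rfl, rfl, -, -⟩ := ht.bal (by simp)
    unfold delete
    split_ifs with h <;> rw [toList_join, List.mem_append, toList_node, List.mem_append]
    · rw [ihl hl.ok hs.left]
      have : y ∈ r.toList → y ≠ x := fun hy =>
        (h.trans_le (hr.first_le hs.right hy)).ne'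
      rw [and_or_left, and_iff_right_of_imp this]
    · rw [ihr hr.ok hs.right]
      have : y ∈ l.toList → y ≠ x := fun hy =>
        ((hs.lt hy hr.first_mem).trans_le (not_lt.1 h)).ne
      rw [and_or_left, and_iff_right_of_imp this]

theorem mem_iff (x : Item) {t : Tree} (ht : Ok f t) (hs : t.Sorted) :
    Mem x t ↔ x ∈ t.toList := by
  induction t with
  | nil => simp [Mem, toList]
  | leaf z =>
    simp only [Mem, toList, List.mem_singleton, not_lt]
    exact ⟨fun h => le_antisymm h.2 h.1, fun h => ⟨h.ge, h.le⟩⟩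
  | node d s l r _ ihl ihr =>
    obtain ⟨hl, hr, rfl, rfl, -, -⟩ := ht.bal (by simp)
    rw [Mem, ihl hl.ok hs.left, ihr hr.ok hs.right, toList_node, List.mem_append]
    constructor
    · intro h
      by_cases hx : x < r.data.first
      · exact .inl (h.1 hx)
      · exact .inr (h.2 hx)
    · rintro (h | h)
      · exact ⟨fun _ => h, fun h' => absurd (hs.lt h hr.first_mem) h'⟩
      · exact ⟨fun h' => absurd (hr.first_le hs.right h) (not_le.2 h'), fun _ => h⟩

/-! ### Queries -/

/-- The largest right endpoint of an interval whose left endpoint lies in the tree before `p`. -/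
def maxHiBefore (p : Item) : Tree → Item
  | nil => bot
  | leaf x => if x < p then x.toHi else bot
  | node _ _ l r => if r.data.first < p then max l.data.maxHi (maxHiBefore p r)
      else maxHiBefore p l

/-- The largest right endpoint in the tree whose left endpoint lies before `s`. -/
def lastEntering (s : Item) : Tree → Item
  | nil => bot
  | leaf x => if x.toLo < s then x else bot
  | node _ _ l r => if r.data.minLo < s then lastEntering s r else lastEntering s l

/-- The first point after `k`. -/
def nextPt (k : Item) : Tree → Item
  | nil => bot
  | leaf x => if k < x.toPt then x else bot
  | node _ _ l r => if k < l.data.lastPt then nextPt k l else nextPt k r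

/-- The points. -/
def pts (t : Tree) : List Item := t.toList.filter fun x => x.kind = 1

/-- The furthest reaching interval that contains `p` and has an endpoint in the tree; if this is
not larger than `p`, there is no such interval. -/
def reach (t : Tree) (p : Item) : Item :=
  max (lastEntering t.data.first t) (maxHiBefore p t)

theorem pts_node (d : Data) (s l r : Tree) : (node d s l r).pts = l.pts ++ r.pts := by
  simp [pts, toList]

theorem mem_pts {t : Tree} {x : Item} : x ∈ t.pts ↔ x ∈ t.toList ∧ x.kind = 1 := by
  simp [pts]

theorem Sorted.pts {t : Tree} (h : t.Sorted) : t.pts.Pairwise (· < ·) := h.filter _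

theorem Bal.maxHi_spec {t : Tree} (ht : Bal f t) : (∀ x ∈ t.toList, x.toHi ≤ t.data.maxHi) ∧
    ∃ x ∈ t.toList, x.toHi = t.data.maxHi := by
  induction t with
  | nil => exact ht.elim
  | leaf x => simp [toList, data]
  | node e s a b _ iha ihb =>
    obtain ⟨ha, hb, rfl, rfl, -, -⟩ := ht
    obtain ⟨i1, x, hx, hx'⟩ := iha ha
    obtain ⟨j1, y, hy, hy'⟩ := ihb hb
    simp only [toList_node, List.mem_append, data_node, dataOf, le_max_iff]
    refine ⟨fun z hz => hz.imp (i1 z) (j1 z), ?_⟩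
    rcases le_total a.data.maxHi b.data.maxHi with h | h
    · exact ⟨y, .inr hy, by rw [hy', max_eq_right h]⟩
    · exact ⟨x, .inl hx, by rw [hx', max_eq_left h]⟩

theorem Bal.minLo_spec {t : Tree} (ht : Bal f t) : (∀ x ∈ t.toList, t.data.minLo ≤ x.toLo) ∧
    ∃ x ∈ t.toList, x.toLo = t.data.minLo := by
  induction t with
  | nil => exact ht.elim
  | leaf x => simp [toList, data]
  | node e s a b _ iha ihb =>
    obtain ⟨ha, hb, rfl, rfl, -, -⟩ := ht
    obtain ⟨i1, x, hx, hx'⟩ := iha ha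
    obtain ⟨j1, y, hy, hy'⟩ := ihb hb
    simp only [toList_node, List.mem_append, data_node, dataOf, min_le_iff]
    refine ⟨fun z hz => hz.imp (i1 z) (j1 z), ?_⟩
    rcases le_total a.data.minLo b.data.minLo with h | h
    · exact ⟨x, .inl hx, by rw [hx', min_eq_left h]⟩
    · exact ⟨y, .inr hy, by rw [hy', min_eq_right h]⟩

theorem Bal.lastPt_spec {t : Tree} (ht : Bal f t) (hv : ∀ x ∈ t.toList, x.tag = 1) :
    (∀ x ∈ t.pts, x ≤ t.data.lastPt) ∧
      (t.data.lastPt ∈ t.pts ∨ t.data.lastPt = bot ∧ t.pts = []) := by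
  induction t with
  | nil => exact ht.elim
  | leaf x =>
    by_cases h : x.kind = 1 <;> simp [pts, toList, data, Item.toPt, h]
  | node e s a b _ iha ihb =>
    obtain ⟨ha, hb, rfl, rfl, -, -⟩ := ht
    simp only [toList_node, List.mem_append] at hv
    obtain ⟨i1, i2⟩ := iha ha fun x hx => hv x (.inl hx)
    obtain ⟨j1, j2⟩ := ihb hb fun x hx => hv x (.inr hx)
    simp only [pts_node, List.mem_append, data_node, dataOf, le_max_iff]
    refine ⟨fun z hz => hz.imp (i1 z) (j1 z), ?_⟩
    rcases i2 with i2 | ⟨i2, i2'⟩ <;> rcases j2 with j2 | ⟨j2, j2'⟩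
    · rcases le_total a.data.lastPt b.data.lastPt with h | h
      · rw [max_eq_right h]; exact .inl (.inr j2)
      · rw [max_eq_left h]; exact .inl (.inl i2)
    · rw [j2, max_eq_left (Item.bot_lt (hv _ (.inl (mem_pts.1 i2).1))).le]
      exact .inl (.inl i2)
    · rw [i2, max_eq_right (Item.bot_lt (hv _ (.inr (mem_pts.1 j2).1))).le]
      exact .inl (.inr j2)
    · rw [i2, j2, i2', j2']
      exact .inr ⟨max_self _, rfl⟩

theorem maxHiBefore_spec {t : Tree} (ht : Bal f t) (hs : t.Sorted) (p : Item) :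
    (∀ x ∈ t.toList, x < p → x.toHi ≤ maxHiBefore p t) ∧
      (maxHiBefore p t = bot ∨ ∃ x ∈ t.toList, x < p ∧ x.toHi = maxHiBefore p t) := by
  induction t with
  | nil => exact ht.elim
  | leaf x =>
    by_cases h : x < p <;> simp [toList, maxHiBefore, h]
  | node e s a b _ iha ihb =>
    obtain ⟨ha, hb, rfl, rfl, -, -⟩ := ht
    obtain ⟨i1, i2⟩ := iha ha hs.left
    obtain ⟨j1, j2⟩ := ihb hb hs.right
    unfold maxHiBefore
    split_ifs with h
    · obtain ⟨k1, y, hy, hy'⟩ := ha.maxHi_spec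
      refine ⟨fun x hx hxp => ?_, ?_⟩
      · rcases List.mem_append.1 hx with hx | hx
        · exact le_max_of_le_left (k1 x hx)
        · exact le_max_of_le_right (j1 x hx hxp)
      · right
        rcases le_total a.data.maxHi (maxHiBefore p b) with h' | h'
        · rw [max_eq_right h']
          -- If the recursive call returns the default `bot`, the maximum is `bot` as well, and it
          -- is attained in the left subtree.
          rcases j2 with j2 | ⟨z, hz, hz'⟩
          · refine ⟨y, List.mem_append_left _ hy, (hs.lt hy hb.first_mem).trans h, ?_⟩
            refine le_antisymm (hy'.le.trans h') (j2 ▸ Item.bot_le_toHi _)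
          · exact ⟨z, List.mem_append_right _ hz, hz'⟩
        · rw [max_eq_left h']
          exact ⟨y, List.mem_append_left _ hy, (hs.lt hy hb.first_mem).trans h, hy'⟩
    · refine ⟨fun x hx hxp => ?_, i2.imp_right fun ⟨y, hy, hy'⟩ =>
        ⟨y, List.mem_append_left _ hy, hy'⟩⟩
      rcases List.mem_append.1 hx with hx | hx
      · exact i1 x hx hxp
      · exact absurd ((hb.first_le hs.right hx).trans_lt hxp) h

theorem lastEntering_spec {t : Tree} (ht : Bal f t) (hs : t.Sorted)
    (hv : ∀ x ∈ t.toList, x.tag = 1) (s : Item) :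
    (∀ x ∈ t.toList, x.toLo < s → x ≤ lastEntering s t) ∧
      (lastEntering s t = bot ∨
        lastEntering s t ∈ t.toList ∧ (lastEntering s t).toLo < s) := by
  induction t with
  | nil => exact ht.elim
  | leaf x =>
    by_cases h : x.toLo < s <;> simp [toList, lastEntering, h]
  | node e s' a b _ iha ihb =>
    obtain ⟨ha, hb, rfl, rfl, -, -⟩ := ht
    simp only [toList_node, List.mem_append] at hv
    obtain ⟨i1, i2⟩ := iha ha hs.left fun x hx => hv x (.inl hx)
    obtain ⟨j1, j2⟩ := ihb hb hs.right fun x hx => hv x (.inr hx)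
    obtain ⟨k1, y, hy, hy'⟩ := hb.minLo_spec
    unfold lastEntering
    split_ifs with h
    · refine ⟨fun x hx hxp => ?_, j2.imp_right fun hj => ⟨List.mem_append_right _ hj.1, hj.2⟩⟩
      rcases List.mem_append.1 hx with hx | hx
      · exact (hs.lt hx hy).le.trans (j1 y hy (hy' ▸ h))
      · exact j1 x hx hxp
    · refine ⟨fun x hx hxp => ?_, i2.imp_right fun hj => ⟨List.mem_append_left _ hj.1, hj.2⟩⟩
      rcases List.mem_append.1 hx with hx | hx
      · exact i1 x hx hxp
      · exact absurd ((k1 x hx).trans_lt hxp) h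

/-- The assumption on `k` is needed for subtrees without points: their `lastPt` is `bot`, which must
fail the test `k < lastPt`. -/
theorem nextPt_eq {t : Tree} (ht : Bal f t) (hs : t.Sorted) (hv : ∀ x ∈ t.toList, x.tag = 1)
    {k : Item} (hk : bot ≤ k) : nextPt k t = (t.pts.filter (k < ·)).headD bot := by
  induction t with
  | nil => exact ht.elim
  | leaf x =>
    by_cases h : x.kind = 1 <;> by_cases h' : k < x <;>
      simp [pts, toList, nextPt, Item.toPt, h, h', hk]
  | node e s' a b _ iha ihb =>
    obtain ⟨ha, hb, rfl, rfl, -, -⟩ := ht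
    simp only [toList_node, List.mem_append] at hv
    have hva : ∀ x ∈ a.toList, x.tag = 1 := fun x hx => hv x (.inl hx)
    obtain ⟨k1, k2⟩ := ha.lastPt_spec hva
    unfold nextPt
    rw [pts_node, List.filter_append]
    split_ifs with h
    · rw [iha ha hs.left hva]
      rcases k2 with k2 | ⟨k2, k3⟩
      · have : a.pts.filter (k < ·) ≠ [] :=
          List.ne_nil_of_mem (List.mem_filter.2 ⟨k2, by simpa using h⟩)
        obtain ⟨y, l, hl⟩ := List.exists_cons_of_ne_nil this
        rw [hl]; rfl
      · exact absurd (k2 ▸ h) (not_lt.2 hk)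
    · rw [ihb hb hs.right fun x hx => hv x (.inr hx)]
      have : a.pts.filter (k < ·) = [] := by
        rw [List.filter_eq_nil_iff]
        intro x hx hkx
        exact h ((of_decide_eq_true hkx).trans_le (k1 x hx))
      rw [this, List.nil_append]

end Tree
end DynCover
end

noncomputable section

namespace DynCover

open Item (bot top)

/-! ## Greedy covers -/

/-- The interval with right endpoint `e` contains the point `p`. -/
def Covers (e p : Item) : Prop := e.toLo < p ∧ p < e

/-- `g` maps each point of `U` to the furthest reaching interval of `E` that contains it, if there
is one, and to something that is not larger than the point otherwise. -/
structure Best (E : Set Item) (U : List Item) (g : Item → Item) : Prop where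
  mem : ∀ p ∈ U, p < g p → g p ∈ E
  covers : ∀ p ∈ U, p < g p → Covers (g p) p
  le : ∀ p ∈ U, ∀ e ∈ E, Covers e p → e ≤ g p

/-- The intervals chosen by the greedy algorithm. -/
def picks (g : Item → Item) : List Item → List Item
  | [] => []
  | p :: U => (if p < g p then [g p] else []) ++ picks g (U.filter (g p < ·))
termination_by U => U.length
decreasing_by
  rw [List.length_unattach]
  exact Nat.lt_succ_of_le ((List.length_filter_le _ _).trans_eq List.length_attach)

/-- The number of steps of the greedy algorithm. -/
def gcount (g : Item → Item) : List Item → ℕ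
  | [] => 0
  | p :: U => 1 + gcount g (U.filter (g p < ·))
termination_by U => U.length
decreasing_by
  rw [List.length_unattach]
  exact Nat.lt_succ_of_le ((List.length_filter_le _ _).trans_eq List.length_attach)

theorem filter_length_lt (g : Item → Prop) [DecidablePred g] (p : Item) (U : List Item) :
    (U.filter (g ·)).length < (p :: U).length :=
  Nat.lt_succ_of_le (List.length_filter_le _ _)

theorem filter_filter_lt {k k' : Item} (h : k ≤ k') (U : List Item) :
    (U.filter (k < ·)).filter (k' < ·) = U.filter (k' < ·) := by
  rw [List.filter_filter]
  refine List.filter_congr fun x _ => ?_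
  by_cases hx : k' < x
  · simp [hx, h.trans_lt hx]
  · simp [hx]

theorem filter_lt_eq_self {k : Item} {U : List Item} (h : ∀ x ∈ U, k < x) :
    U.filter (k < ·) = U := List.filter_eq_self.2 fun x hx => decide_eq_true (h x hx)

/-- The two numbers differ by the steps at points that no interval contains; these are counted but
pick nothing. -/
theorem picks_length_le (g : Item → Item) (U : List Item) : (picks g U).length ≤ gcount g U := by
  induction hn : U.length using Nat.strong_induction_on generalizing U with
  | _ n ih =>
    subst hn
    cases U with
    | nil => simp [picks, gcount]
    | cons p U =>
      have := ih _ (filter_length_lt (g p < ·) p U) _ rfl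
      rw [picks, gcount]
      split_ifs <;> simp <;> omega

theorem exists_of_mem_picks {g : Item → Item} {U : List Item} {x : Item} (hx : x ∈ picks g U) :
    ∃ p ∈ U, g p = x ∧ p < x := by
  induction hn : U.length using Nat.strong_induction_on generalizing U with
  | _ n ih =>
    subst hn
    cases U with
    | nil => simp [picks] at hx
    | cons p U =>
      rw [picks, List.mem_append] at hx
      rcases hx with hx | hx
      · split_ifs at hx with h
        · rw [List.mem_singleton] at hx
          exact ⟨p, by simp, hx.symm, hx ▸ h⟩
        · simp at hx
      · obtain ⟨q, hq, hq'⟩ := ih _ (filter_length_lt (g p < ·) p U) hx rfl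
        exact ⟨q, List.mem_cons_of_mem _ (List.mem_filter.1 hq).1, hq'⟩

theorem picks_pairwise (g : Item → Item) (U : List Item) : (picks g U).Pairwise (· < ·) := by
  induction hn : U.length using Nat.strong_induction_on generalizing U with
  | _ n ih =>
    subst hn
    cases U with
    | nil => simp [picks]
    | cons p U =>
      have := ih _ (filter_length_lt (g p < ·) p U) _ rfl
      rw [picks]
      split_ifs
      · refine List.pairwise_cons.2 ⟨fun x hx => ?_, this⟩
        obtain ⟨q, hq, -, hq'⟩ := exists_of_mem_picks hx
        exact (of_decide_eq_true (List.mem_filter.1 hq).2).trans hq'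
      · exact this

/-- A point dropped by the filter lies between `p` and `g p`, and the interval of `g p` starts
before `p`, so it contains that point. Equality with `g p` is excluded by `hE`. -/
theorem exists_covers_of_picks {g : Item → Item} {E : Set Item} {U : List Item}
    (hU : U.Pairwise (· < ·)) (hE : ∀ p ∈ U, ∀ e ∈ E, p ≠ e) (hg : Best E U g)
    (hF : ∀ p ∈ U, p < g p) : ∀ p ∈ U, ∃ x ∈ picks g U, Covers x p := by
  induction hn : U.length using Nat.strong_induction_on generalizing U with
  | _ n ih =>
    subst hn
    cases U with
    | nil => simp
    | cons p U =>
      intro q hq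
      have hp := hF p (by simp)
      have hsub : ∀ x ∈ U.filter (g p < ·), x ∈ p :: U := fun x hx =>
        List.mem_cons_of_mem _ (List.mem_filter.1 hx).1
      rw [picks, if_pos hp]
      rcases lt_trichotomy q (g p) with h | h | h
      · refine ⟨g p, by simp, ?_, h⟩
        have hpq : p ≤ q := by
          rcases List.mem_cons.1 hq with rfl | hq
          · exact le_rfl
          · exact ((List.pairwise_cons.1 hU).1 q hq).le
        exact (hg.covers p (by simp) hp).1.trans_le hpq
      · exact absurd h (hE q hq _ (hg.mem p (by simp) hp))
      · have hq' : q ∈ U := (List.mem_cons.1 hq).resolve_left fun h' => by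
          rw [h'] at h; exact h.asymm hp
        obtain ⟨x, hx, hx'⟩ := ih _ (filter_length_lt (g p < ·) p U)
          ((List.pairwise_cons.1 hU).2.filter _) (fun x hx => hE x (hsub x hx))
          ⟨fun x hx => hg.mem x (hsub x hx), fun x hx => hg.covers x (hsub x hx),
            fun x hx => hg.le x (hsub x hx)⟩ (fun x hx => hF x (hsub x hx)) rfl q
          (List.mem_filter.2 ⟨hq', decide_eq_true h⟩)
        exact ⟨x, List.mem_append_right _ hx, hx'⟩

/-- The greedy algorithm is optimal. -/
theorem gcount_le_card {g : Item → Item} {E : Set Item} {U : List Item} {B : Finset Item}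
    (hg : Best E U g) (hB : ∀ e ∈ B, e ∈ E) (hc : ∀ p ∈ U, ∃ e ∈ B, Covers e p) :
    gcount g U ≤ B.card := by
  induction hn : U.length using Nat.strong_induction_on generalizing U B with
  | _ n ih =>
    subst hn
    cases U with
    | nil => simp [gcount]
    | cons p U =>
      obtain ⟨e, he, hep⟩ := hc p (by simp)
      have hle := hg.le p (by simp) e (hB e he) hep
      have hsub : ∀ x ∈ U.filter (g p < ·), x ∈ p :: U := fun x hx =>
        List.mem_cons_of_mem _ (List.mem_filter.1 hx).1
      -- The interval of `B` that contains `p` reaches no further than `g p`, so it is not needed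
      -- for the remaining points and can be removed from `B`.
      have := ih _ (filter_length_lt (g p < ·) p U) (B := B.erase e)
        ⟨fun x hx => hg.mem x (hsub x hx), fun x hx => hg.covers x (hsub x hx),
            fun x hx => hg.le x (hsub x hx)⟩ (fun x hx => hB x (Finset.mem_of_mem_erase hx))
        (fun x hx => by
          obtain ⟨e', he', hx'⟩ := hc x (hsub x hx)
          refine ⟨e', Finset.mem_erase.2 ⟨?_, he'⟩, hx'⟩
          rintro rfl
          exact (hle.trans_lt (of_decide_eq_true (List.mem_filter.1 hx).2)).asymm hx'.2) rfl
      rw [gcount]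
      rw [Finset.card_erase_of_mem he] at this
      have := Finset.card_pos.2 ⟨e, he⟩
      omega

theorem gcount_congr {g g' : Item → Item} {U : List Item} (h : ∀ p ∈ U, g p = g' p) :
    gcount g U = gcount g' U := by
  induction hn : U.length using Nat.strong_induction_on generalizing U with
  | _ n ih =>
    subst hn
    cases U with
    | nil => simp [gcount]
    | cons p U =>
      rw [gcount, gcount, ← h p (by simp), ih _ (filter_length_lt (g p < ·) p U)
        (fun x hx => h x (List.mem_cons_of_mem _ (List.mem_filter.1 hx).1)) rfl]

/-- Greedy stays ahead: a run that starts further to the right remains at least as far to the right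
after every step, because `g` is monotone. -/
theorem gcount_filter_le {g : Item → Item} (hm : Monotone g) {U : List Item}
    (hU : U.Pairwise (· < ·)) (hF : ∀ p ∈ U, p < g p) (k : Item) :
    gcount g (U.filter (k < ·)) ≤ gcount g U := by
  induction hn : U.length using Nat.strong_induction_on generalizing U k with
  | _ n ih =>
    subst hn
    cases U with
    | nil => simp
    | cons p U =>
      have hp := (List.pairwise_cons.1 hU).1
      by_cases hk : k < p
      · rw [filter_lt_eq_self]
        intro x hx
        rcases List.mem_cons.1 hx with rfl | hx
        · exact hk
        · exact hk.trans (hp x hx)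
      · have ih' := fun k' => ih _ (filter_length_lt (g p < ·) p U)
          ((List.pairwise_cons.1 hU).2.filter _)
          (fun x hx => hF x (List.mem_cons_of_mem _ (List.mem_filter.1 hx).1)) k' rfl
        rw [List.filter_cons_of_neg (by simpa using hk), gcount]
        rcases le_or_gt (g p) k with hgk | hgk
        · have := ih' k
          rw [filter_filter_lt hgk] at this
          omega
        -- Here `p ≤ k < g p`. The first remaining point `q` satisfies `g p ≤ g q`, so after one
        -- step of each run the second is the first cut off at `g q`, and the induction hypothesis
        -- applies.
        · match hW : U.filter (k < ·) with
          | [] => simp [gcount]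
          | q :: W =>
            have hq : q ∈ U := (List.mem_filter.1 (hW ▸ List.mem_cons_self :
              q ∈ U.filter (k < ·))).1
            have hgq := hm (hp q hq).le
            have := ih' (g q)
            rw [filter_filter_lt hgq, ← filter_filter_lt (hgk.le.trans hgq) U, hW,
              List.filter_cons_of_neg (by simpa using (hF q (List.mem_cons_of_mem _ hq)).le)]
              at this
            rw [gcount]
            omega

/-- Cutting a sequence of points into two costs at most one interval. -/
theorem gcount_append {g : Item → Item} (hm : Monotone g) {l r : List Item}
    (hU : (l ++ r).Pairwise (· < ·)) (hF : ∀ p ∈ l ++ r, p < g p) :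
    gcount g l + gcount g r ≤ gcount g (l ++ r) + 1 := by
  induction hn : l.length using Nat.strong_induction_on generalizing l with
  | _ n ih =>
    subst hn
    cases l with
    | nil => simp [gcount]
    | cons p l =>
      obtain ⟨hl, hr, hlr⟩ := List.pairwise_append.1 hU
      rw [List.cons_append, gcount, gcount, List.filter_append]
      by_cases hl' : l.filter (g p < ·) = []
      -- One interval finishes `l`; this is where the extra interval is spent. After its own first
      -- step at `q`, the run on `r` is at least as far as the joint run is after `g p`.
      · rw [hl', List.nil_append, gcount]
        match r with
        | [] => simp [gcount]
        | q :: r =>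
          have hpq : p < q := hlr p (by simp) q (by simp)
          have hgq := hF q (by simp)
          have := gcount_filter_le hm (hr.filter (g p < ·))
            (fun x hx => hF x (List.mem_append_right _ (List.mem_filter.1 hx).1)) (g q)
          rw [filter_filter_lt (hm hpq.le), List.filter_cons_of_neg (by simpa using hgq.le)]
            at this
          rw [gcount]
          omega
      -- A point of `l` remains, so `g p` lies before all of `r`, and both runs continue in
      -- parallel.
      · obtain ⟨x, hx⟩ := List.exists_mem_of_ne_nil _ hl'
        have hr' : r.filter (g p < ·) = r := filter_lt_eq_self fun y hy =>
          (of_decide_eq_true (List.mem_filter.1 hx).2).trans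
            (hlr x (List.mem_cons_of_mem _ (List.mem_filter.1 hx).1) y hy)
        rw [hr']
        have hs : (l.filter (g p < ·) ++ r).Sublist (p :: l ++ r) :=
          (List.filter_sublist.trans (List.sublist_cons_self _ _)).append (List.Sublist.refl _)
        have := ih _ (filter_length_lt (g p < ·) p l) (hU.sublist hs)
          (fun y hy => hF y (hs.subset hy)) rfl
        omega

/-! ## The solutions stored in the tree -/

namespace Tree

/-- Trees without stored solutions. -/
abbrev plain : Tree → Tree → Tree := fun _ _ => nil

/-- The greedy algorithm on the points `U`, stopped when more than `θ / ε` steps are made. -/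
def greedy (ε θ : ℝ) (g : Item → Item) : List Item → ℝ → Tree → Option Tree
  | [], _, s => some s
  | p :: U, acc, s =>
    -- The machine cannot divide, so the steps are counted by summing up `ε` and comparing with `θ`.
    if θ < acc + ε then none
    else greedy ε θ g (U.filter (g p < ·)) (acc + ε)
      (if p < g p then join plain s (leaf (g p)) else s)
termination_by U => U.length
decreasing_by
  rw [List.length_unattach]
  exact Nat.lt_succ_of_le ((List.length_filter_le _ _).trans_eq List.length_attach)

/-- Union of two sets of which the first lies below the second, a common element excepted. -/
def unite (a b : Tree) : Tree := join plain a (delete plain a.data.last b)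

/-- The solution for a child: one interval, if one suffices. -/
def childSol (g : Item → Item) (t : Tree) : Tree :=
  if t.data.lastPt.tag = 0 then nil
  else if t.data.lastPt < g (nextPt bot t) then leaf (g (nextPt bot t))
  else t.sol

/-- The greedy algorithm from the point `p` on, on the points of the tree `v`. -/
def greedyRun (ε θ : ℝ) (v : Tree) (c : Item) : ℕ → Item → ℝ → Tree → Option Tree
  | 0, _, _, s => some s
  | n + 1, p, acc, s =>
    if p.tag = 0 then some s
    else if θ < acc + ε then none
    -- The maximum with `p` moves the search past `p` even if no interval contains `p`.
    else greedyRun ε θ v c n (nextPt (max p (max c (maxHiBefore p v))) v) (acc + ε)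
      (if p < max c (maxHiBefore p v) then join plain s (leaf (max c (maxHiBefore p v))) else s)

/-- The provisional node `mk plain l r` lets the searches run on the node before its solution is
known. -/
def summary (ε θ : ℝ) (l r : Tree) : Tree :=
  match greedyRun ε θ (mk plain l r) (lastEntering l.data.first (mk plain l r))
      (mk plain l r).size (nextPt bot (mk plain l r)) 0 nil with
  | some s => s
  | none => unite (childSol (reach (mk plain l r)) l) (childSol (reach (mk plain l r)) r)

/-- The stored solution, with bound `θ / ε` for the greedy algorithm; none if `θ` is negative. -/
def annot (ε θ : ℝ) (l r : Tree) : Tree := if θ < 0 then nil else summary ε θ l r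

theorem greedy_some {ε θ : ℝ} {g : Item → Item} {U : List Item} {acc : ℝ} {s s' : Tree}
    (h : greedy ε θ g U acc s = some s') : s'.toList = s.toList ++ picks g U := by
  induction hn : U.length using Nat.strong_induction_on generalizing U acc s with
  | _ n ih =>
    subst hn
    cases U with
    | nil =>
      rw [greedy, Option.some.injEq] at h
      subst h
      simp [picks]
    | cons p U =>
      rw [greedy] at h
      split_ifs at h with h₁ h₂
      · rw [ih _ (filter_length_lt (g p < ·) p U) h rfl, picks, if_pos h₂, toList_join]
        simp [toList]
      · rw [ih _ (filter_length_lt (g p < ·) p U) h rfl, picks, if_neg h₂]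
        simp

/-- An aborted run is a lower bound on the optimum; with it the additive loss of a cut can be
charged to a factor. -/
theorem greedy_none {ε θ : ℝ} (hε : 0 ≤ ε) {g : Item → Item} {U : List Item} {acc : ℝ} {s : Tree}
    (h : greedy ε θ g U acc s = none) : θ < acc + ε * gcount g U := by
  induction hn : U.length using Nat.strong_induction_on generalizing U acc s with
  | _ n ih =>
    subst hn
    cases U with
    | nil => simp [greedy] at h
    | cons p U =>
      rw [greedy] at h
      rw [gcount]
      push_cast
      split_ifs at h with h₁
      · have : 0 ≤ ε * (gcount g (U.filter (g p < ·)) : ℝ) := by positivity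
        linarith
      all_goals
        have := ih _ (filter_length_lt (g p < ·) p U) h rfl
        linarith

/-- The remaining points are always the part of `V` after some `k`, so a search in the tree finds
the first of them. Fuel equal to the number of points is enough, since every step passes at least
one. -/
theorem greedyRun_eq {ε θ : ℝ} {v : Tree} {c : Item} {V : List Item}
    (hV : V.Pairwise (· < ·)) (htag : ∀ x ∈ V, x.tag = 1)
    (hn : ∀ k, bot ≤ k → nextPt k v = (V.filter (k < ·)).headD bot) {n : ℕ} {U : List Item}
    {k : Item} (hU : U = V.filter (k < ·)) (hlen : U.length ≤ n) {acc : ℝ} {s : Tree} :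
    greedyRun ε θ v c n (U.headD bot) acc s =
      greedy ε θ (fun p => max c (maxHiBefore p v)) U acc s := by
  induction n generalizing U k acc s with
  | zero =>
    rw [List.length_eq_zero_iff.1 (Nat.le_zero.1 hlen), greedyRun, greedy]
  | succ n ih =>
    cases U with
    | nil => rw [greedyRun, greedy]; exact if_pos rfl
    | cons p U =>
      have hp : p ∈ V.filter (k < ·) := hU ▸ List.mem_cons_self
      have hpV := List.mem_filter.1 hp
      have hs : (p :: U).Pairwise (· < ·) := hU ▸ hV.filter _
      have hkp : k < p := of_decide_eq_true hpV.2
      rw [List.headD_cons, greedyRun, greedy, if_neg (by rw [htag p hpV.1]; simp)]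
      have hnext : U.filter (max c (maxHiBefore p v) < ·) =
          V.filter (max p (max c (maxHiBefore p v)) < ·) := by
        rw [← filter_filter_lt (hkp.le.trans (le_max_left p _)) V, ← hU,
          List.filter_cons_of_neg (by simp)]
        refine List.filter_congr fun x hx => ?_
        have := (List.pairwise_cons.1 hs).1 x hx
        simp [this]
      rw [hn _ ((Item.bot_lt (htag p hpV.1)).le.trans (le_max_left _ _)), ← hnext]
      split_ifs
      · rfl
      all_goals exact ih hnext (Nat.le_of_lt_succ ((filter_length_lt _ p U).trans_le hlen))

/-- No assumption on the items is made: the cost bounds must also cover trees that, in the middle of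
an update, hold only one endpoint of an interval. -/
theorem greedyRun_ok {ε θ : ℝ} {v : Tree} {c : Item} {n : ℕ} {p : Item} {acc : ℝ} {s s' : Tree}
    (h : greedyRun ε θ v c n p acc s = some s') (hs : Ok plain s) :
    Ok plain s' ∧ s'.toList.length ≤ s.toList.length + n := by
  induction n generalizing p acc s with
  | zero => rw [greedyRun, Option.some.injEq] at h; exact h ▸ ⟨hs, le_rfl⟩
  | succ n ih =>
    rw [greedyRun] at h
    split_ifs at h with h₁ h₂ h₃
    · rw [Option.some.injEq] at h; exact h ▸ ⟨hs, Nat.le_add_right _ _⟩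
    · obtain ⟨i1, i2⟩ := ih h (ok_join hs (.inr trivial))
      refine ⟨i1, i2.trans ?_⟩
      simp [toList_join, toList]; omega
    · obtain ⟨i1, i2⟩ := ih h hs
      exact ⟨i1, i2.trans (by omega)⟩

theorem ok_unite {a b : Tree} (ha : Ok plain a) (hb : Ok plain b) : Ok plain (unite a b) :=
  ok_join ha (ok_delete hb).1

theorem length_unite_le (a b : Tree) :
    (unite a b).toList.length ≤ a.toList.length + b.toList.length := by
  rw [unite, toList_join, List.length_append]
  exact Nat.add_le_add_left (delete_sublist _ _).length_le _

/-- By `hab` the two sets share at most one element, which must be the last of `a`. For empty `a`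
the deleted item is the default `bot`, which `hbot` excludes from `b`. -/
theorem unite_spec {a b : Tree} (ha : Ok plain a) (hb : Ok plain b) (hsa : a.Sorted)
    (hsb : b.Sorted) (hbot : ∀ x ∈ b.toList, x ≠ bot)
    (hab : ∀ x ∈ a.toList, ∀ y ∈ b.toList, x ≤ y) :
    (unite a b).Sorted ∧ ∀ x, x ∈ (unite a b).toList ↔ x ∈ a.toList ∨ x ∈ b.toList := by
  have hm := fun y => mem_delete a.data.last hb hsb (f' := plain) y
  refine ⟨?_, fun x => ?_⟩
  · rw [Sorted, unite, toList_join]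
    refine List.pairwise_append.2 ⟨hsa, hsb.sublist (delete_sublist _ _), fun x hx y hy => ?_⟩
    rw [hm] at hy
    have ha' : Bal plain a := ha.bal (by rintro rfl; simp [toList] at hx)
    refine lt_of_le_of_ne (hab x hx y hy.2) ?_
    rintro rfl
    exact hy.1 (le_antisymm (ha'.le_last hsa hx) (hab _ ha'.last_mem _ hy.2))
  · rw [unite, toList_join, List.mem_append, hm]
    by_cases hx : x = a.data.last
    · rcases ha with rfl | ha
      · simp only [toList, List.not_mem_nil, false_or, and_iff_right_iff_imp]
        exact fun h => hbot x h
      · have := hx ▸ ha.last_mem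
        simp [this]
    · simp [hx]

/-- The intervals with an endpoint among the items. -/
def ivs (V : List Item) : Set Item := {e | e.tag = 1 ∧ e.kind = 2 ∧ (e ∈ V ∨ e.toLo ∈ V)}

end Tree

/-! ### Segments of the item sequence and the approximation guarantee -/

namespace Item

structure Valid (x : Item) : Prop where
  tag : x.tag = 1
  lo : x.kind = 0 → x.crd ≤ x.oth
  hi : x.kind = 2 → x.oth ≤ x.crd

theorem toLo_toHi {x : Item} (h : x.tag = 1) (hk : x.kind = 0) : x.toHi.toLo = x := by
  ext <;> simp [toLo, toHi, h, hk]

theorem toHi_toLo {x : Item} (h : x.tag = 1) (hk : x.kind = 2) : x.toLo.toHi = x := by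
  ext <;> simp [toLo, toHi, h, hk]

theorem toLo_lt {x : Item} (h : x.tag = 1) (hk : x.kind = 2) (hx : x.oth ≤ x.crd) :
    x.toLo < x := by
  rw [lt_def]
  rcases hx.lt_or_eq with hx | hx <;> simp [toLo, h, hk, hx]

theorem kind_of_toLo_lt {x y : Item} (hy : y.tag = 1) (h : x.toLo < y) : x.kind = 2 := by
  by_contra hk
  rw [toLo, if_neg hk, lt_def] at h
  simp [top, hy] at h

end Item

namespace Tree

/-- The items are a segment of a sequence that contains with one endpoint of an interval the
other. -/
structure Segment (V : List Item) : Prop where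
  valid : ∀ x ∈ V, x.Valid
  hi : ∀ e : Item, e.tag = 1 → e.kind = 2 → e.toLo ∈ V → (∃ y ∈ V, e ≤ y) → e ∈ V
  lo : ∀ e : Item, e.tag = 1 → e.kind = 2 → e ∈ V → (∃ y ∈ V, y ≤ e.toLo) → e.toLo ∈ V

theorem Segment.toLo_lt {V : List Item} (hV : Segment V) {e : Item} (he : e ∈ ivs V) :
    e.toLo < e := by
  obtain ⟨h1, h2, h | h⟩ := he
  · exact Item.toLo_lt h1 h2 ((hV.valid e h).hi h2)
  · refine Item.toLo_lt h1 h2 ?_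
    simpa [Item.toLo, h2] using (hV.valid _ h).lo (by simp [Item.toLo, h2])

theorem Segment.left {l r : List Item} (h : Segment (l ++ r)) (hs : (l ++ r).Pairwise (· < ·)) :
    Segment l where
  valid x hx := h.valid x (List.mem_append_left _ hx)
  hi e h1 h2 he := fun ⟨y, hy, hey⟩ => by
    have := h.hi e h1 h2 (List.mem_append_left _ he) ⟨y, List.mem_append_left _ hy, hey⟩
    refine (List.mem_append.1 this).resolve_right fun her => ?_
    exact ((List.pairwise_append.1 hs).2.2 y hy e her).not_ge hey
  lo e h1 h2 he := fun ⟨y, hy, hey⟩ => by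
    have he' := List.mem_append_left r he
    have := h.lo e h1 h2 he' ⟨y, List.mem_append_left _ hy, hey⟩
    refine (List.mem_append.1 this).resolve_right fun her => ?_
    exact ((List.pairwise_append.1 hs).2.2 e he _ her).asymm (h.toLo_lt ⟨h1, h2, .inl he'⟩)

theorem Segment.right {l r : List Item} (h : Segment (l ++ r)) (hs : (l ++ r).Pairwise (· < ·)) :
    Segment r where
  valid x hx := h.valid x (List.mem_append_right _ hx)
  hi e h1 h2 he := fun ⟨y, hy, hey⟩ => by
    have he' := List.mem_append_right l he
    have := h.hi e h1 h2 he' ⟨y, List.mem_append_right _ hy, hey⟩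
    refine (List.mem_append.1 this).resolve_left fun her => ?_
    exact ((List.pairwise_append.1 hs).2.2 e her _ he).asymm (h.toLo_lt ⟨h1, h2, .inr he'⟩)
  lo e h1 h2 he := fun ⟨y, hy, hey⟩ => by
    have := h.lo e h1 h2 (List.mem_append_right _ he) ⟨y, List.mem_append_right _ hy, hey⟩
    refine (List.mem_append.1 this).resolve_left fun her => ?_
    exact ((List.pairwise_append.1 hs).2.2 _ her y hy).not_ge hey

variable {f : Tree → Tree → Tree}

theorem bot_le_lastEntering {s : Item} {t : Tree} (hv : ∀ x ∈ t.toList, x.tag = 1) :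
    bot ≤ lastEntering s t := by
  induction t with
  | nil => exact le_rfl
  | leaf x =>
    unfold lastEntering
    split_ifs
    · exact (Item.bot_lt (hv x (by simp [toList]))).le
    · exact le_rfl
  | node d s' a b _ iha ihb =>
    unfold lastEntering
    simp only [toList_node, List.mem_append] at hv
    split_ifs
    · exact ihb fun x hx => hv x (.inr hx)
    · exact iha fun x hx => hv x (.inl hx)

theorem bot_le_reach {t : Tree} (hv : ∀ x ∈ t.toList, x.tag = 1) (p : Item) :
    bot ≤ reach t p := le_max_of_le_left (bot_le_lastEntering hv)

/-- As `p` moves to the right, only more left endpoints come into play: `reach` keeps an interval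
even where it ends before `p`, and this makes it monotone also at uncovered points. -/
theorem reach_mono {t : Tree} (ht : Bal f t) (hs : t.Sorted) (hv : ∀ x ∈ t.toList, x.tag = 1) :
    Monotone (reach t) := by
  intro p q hpq
  refine max_le (le_max_left _ _) ?_
  rcases (maxHiBefore_spec ht hs p).2 with h | ⟨x, hx, hxp, h⟩
  · rw [h]; exact bot_le_reach hv q
  · rw [← h]
    exact le_max_of_le_right ((maxHiBefore_spec ht hs q).1 x hx (hxp.trans_le hpq))

/-- An interval through `p` with an endpoint in the tree either has its left endpoint there, before
`p`, and is seen by `maxHiBefore`; or it enters from before the first item and ends in the tree, and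
is seen by `lastEntering`. The segment property excludes a third case. -/
theorem best_reach {t : Tree} (ht : Bal f t) (hs : t.Sorted) (hV : Segment t.toList) :
    Best (ivs t.toList) t.pts (reach t) := by
  have hv : ∀ x ∈ t.toList, x.tag = 1 := fun x hx => (hV.valid x hx).tag
  have key : ∀ p ∈ t.pts, p < reach t p → reach t p ∈ ivs t.toList ∧ Covers (reach t p) p := by
    intro p hp hlt
    have hpt := (mem_pts.1 hp).1
    rcases max_choice (lastEntering t.data.first t) (maxHiBefore p t) with h | h
    · change reach t p = _ at h
      rw [h] at hlt ⊢
      rcases (lastEntering_spec ht hs hv t.data.first).2 with h' | ⟨h1, h2⟩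
      · rw [h'] at hlt
        exact absurd hlt (Item.bot_lt (hv p hpt)).asymm
      · exact ⟨⟨hv _ h1, Item.kind_of_toLo_lt (hv _ ht.first_mem) h2, .inl h1⟩,
          h2.trans_le (ht.first_le hs hpt), hlt⟩
    · change reach t p = _ at h
      rw [h] at hlt ⊢
      rcases (maxHiBefore_spec ht hs p).2 with h' | ⟨x, hx, hxp, h'⟩
      · rw [h'] at hlt
        exact absurd hlt (Item.bot_lt (hv p hpt)).asymm
      · rw [← h'] at hlt ⊢
        have hk : x.kind = 0 := by
          by_contra hk
          rw [Item.toHi, if_neg hk] at hlt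
          exact absurd hlt (Item.bot_lt (hv p hpt)).asymm
        have h3 := Item.toLo_toHi (hv x hx) hk
        refine ⟨⟨by simp [Item.toHi, hk], by simp [Item.toHi, hk], .inr (by rwa [h3])⟩, ?_, hlt⟩
        rwa [h3]
  refine ⟨fun p hp h => (key p hp h).1, fun p hp h => (key p hp h).2, ?_⟩
  rintro p hp e ⟨he1, he2, he⟩ ⟨hc1, hc2⟩
  by_cases hlo : e.toLo ∈ t.toList
  · refine le_max_of_le_right ?_
    have := (maxHiBefore_spec ht hs p).1 _ hlo hc1
    rwa [Item.toHi_toLo he1 he2] at this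
  · have he' := he.resolve_right hlo
    refine le_max_of_le_left ((lastEntering_spec ht hs hv _).1 e he' ?_)
    by_contra h
    exact hlo (hV.lo e he1 he2 he' ⟨_, ht.first_mem, not_lt.1 h⟩)

/-- `s` is a set of intervals chosen by `g` that covers `U`, if that is possible, and is larger
than a minimum cover by a factor of at most `a / H`. -/
structure Solves (a H : ℝ) (g : Item → Item) (U s : List Item) : Prop where
  sorted : s.Pairwise (· < ·)
  mem : ∀ x ∈ s, ∃ p ∈ U, g p = x ∧ p < x
  covers : (∀ p ∈ U, p < g p) → ∀ p ∈ U, ∃ x ∈ s, Covers x p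
  card : (∀ p ∈ U, p < g p) → s.length * H ≤ a * gcount g U

/-- If the best interval at the first point reaches past the last point, it is a cover of size one.
Otherwise no interval without an endpoint in the child contains any of its points, because by
`hspan` it would contain all of them. Then `g` and `reach t` agree wherever one of them finds an
interval, and the stored solution keeps its quality with respect to `g`. -/
theorem childSol_solves {E : Set Item} {g : Item → Item} {t : Tree} {a H : ℝ} (ht : Bal f t)
    (hs : t.Sorted) (hV : Segment t.toList) (hE : ivs t.toList ⊆ E) (hg : Best E t.pts g)
    (hspan : ∀ e ∈ E, e ∉ ivs t.toList → ∀ p ∈ t.pts, Covers e p → ∀ q ∈ t.pts, Covers e q)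
    (hsol : Solves a H (reach t) t.pts t.sol.toList) (ha : H ≤ a) (hH : 0 ≤ H) :
    Solves a H g t.pts (childSol g t).toList := by
  have hv : ∀ x ∈ t.toList, x.tag = 1 := fun x hx => (hV.valid x hx).tag
  obtain ⟨k1, k2⟩ := ht.lastPt_spec hv
  unfold childSol
  rcases k2 with k2 | ⟨k2, k3⟩
  · rw [if_neg (by rw [hv _ (mem_pts.1 k2).1]; simp)]
    have hnext := nextPt_eq ht hs hv le_rfl
    rw [filter_lt_eq_self fun x hx => Item.bot_lt (hv x (mem_pts.1 hx).1)] at hnext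
    obtain ⟨q, U, hU⟩ := List.exists_cons_of_ne_nil (List.ne_nil_of_mem k2)
    have hq : nextPt bot t = q := by rw [hnext, hU]; rfl
    have hqm : q ∈ t.pts := by rw [hU]; simp
    have hqle : ∀ p ∈ t.pts, q ≤ p := by
      intro p hp
      have := hs.pts
      rw [hU] at this hp
      rcases List.mem_cons.1 hp with rfl | hp
      · exact le_rfl
      · exact ((List.pairwise_cons.1 this).1 p hp).le
    rw [hq]
    split_ifs with h
    · have hqg : q < g q := (k1 q hqm).trans_lt h
      refine ⟨by simp [toList], fun x hx => ?_, fun _ p hp => ⟨g q, by simp [toList], ?_, ?_⟩, ?_⟩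
      · rw [toList, List.mem_singleton] at hx
        exact ⟨q, hqm, hx.symm, hx ▸ hqg⟩
      · exact (hg.covers q hqm hqg).1.trans_le (hqle p hp)
      · exact (k1 p hp).trans_lt h
      · intro _
        have : (1 : ℝ) ≤ gcount g t.pts := by
          rw [hU, gcount]; push_cast; linarith [Nat.cast_nonneg (α := ℝ)
            (gcount g (U.filter (g q < ·)))]
        simp only [toList, List.length_singleton, Nat.cast_one, one_mul]
        nlinarith
    · have hin : ∀ e ∈ E, ∀ p ∈ t.pts, Covers e p → e ∈ ivs t.toList := by
        intro e he p hp hc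
        by_contra hn
        have h1 := hspan e he hn p hp hc
        exact h ((h1 _ k2).2.trans_le (hg.le q hqm e he (h1 q hqm)))
      have hb := best_reach ht hs hV
      have heq : ∀ p ∈ t.pts, p < g p → reach t p = g p := by
        intro p hp hlt
        have h1 := hg.covers p hp hlt
        have h2 := hb.le p hp _ (hin _ (hg.mem p hp hlt) p hp h1) h1
        have h3 := hlt.trans_le h2
        exact le_antisymm (hg.le p hp _ (hE (hb.mem p hp h3)) (hb.covers p hp h3)) h2
      have heq' : ∀ p ∈ t.pts, p < reach t p → g p = reach t p := by
        intro p hp hlt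
        have h2 := hg.le p hp _ (hE (hb.mem p hp hlt)) (hb.covers p hp hlt)
        exact (heq p hp (hlt.trans_le h2)).symm
      refine ⟨hsol.sorted, fun x hx => ?_, fun hF => hsol.covers fun p hp => ?_, fun hF => ?_⟩
      · obtain ⟨p, hp, h1, h2⟩ := hsol.mem x hx
        exact ⟨p, hp, (heq' p hp (h1 ▸ h2)).trans h1, h2⟩
      · rw [heq p hp (hF p hp)]; exact hF p hp
      · rw [gcount_congr fun p hp => (heq p hp (hF p hp)).symm]
        exact hsol.card fun p hp => by rw [heq p hp (hF p hp)]; exact hF p hp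
  · rw [if_pos (by rw [k2]; rfl), k3]
    exact ⟨by simp [toList], by simp [toList], by simp, by simp [toList, gcount]⟩

/-- The right endpoint must lie in `r`, beyond all of `l`. The left endpoint is not in `l`, nor in
`r` because it precedes `p`; by the segment property it precedes everything. -/
theorem span_left {l r : List Item} (hs : (l ++ r).Pairwise (· < ·)) (hV : Segment (l ++ r))
    {e : Item} (he : e ∈ ivs (l ++ r)) (hn : e ∉ ivs l) {p q : Item} (hp : p ∈ l) (hq : q ∈ l)
    (hc : Covers e p) : Covers e q := by
  obtain ⟨h1, h2, h3⟩ := he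
  have hlr := (List.pairwise_append.1 hs).2.2
  have hnl : e ∉ l := fun h => hn ⟨h1, h2, .inl h⟩
  have hnl' : e.toLo ∉ l := fun h => hn ⟨h1, h2, .inr h⟩
  have her : e ∈ r := by
    rcases h3 with h3 | h3
    · exact (List.mem_append.1 h3).resolve_left hnl
    · have := (List.mem_append.1 h3).resolve_left hnl'
      exact absurd hc.1 (hlr p hp _ this).asymm
  refine ⟨?_, hlr q hq e her⟩
  by_contra h
  have := hV.lo e h1 h2 (List.mem_append_right _ her) ⟨q, List.mem_append_left _ hq, not_lt.1 h⟩
  exact absurd hc.1 (hlr p hp _ ((List.mem_append.1 this).resolve_left hnl')).asymm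

theorem span_right {l r : List Item} (hs : (l ++ r).Pairwise (· < ·)) (hV : Segment (l ++ r))
    {e : Item} (he : e ∈ ivs (l ++ r)) (hn : e ∉ ivs r) {p q : Item} (hp : p ∈ r) (hq : q ∈ r)
    (hc : Covers e p) : Covers e q := by
  obtain ⟨h1, h2, h3⟩ := he
  have hlr := (List.pairwise_append.1 hs).2.2
  have hnr : e ∉ r := fun h => hn ⟨h1, h2, .inl h⟩
  have hnr' : e.toLo ∉ r := fun h => hn ⟨h1, h2, .inr h⟩
  have hel : e.toLo ∈ l := by
    rcases h3 with h3 | h3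
    · have := (List.mem_append.1 h3).resolve_right hnr
      exact absurd hc.2 (hlr _ this p hp).asymm
    · exact (List.mem_append.1 h3).resolve_right hnr'
  refine ⟨hlr _ hel q hq, ?_⟩
  by_contra h
  have := hV.hi e h1 h2 (List.mem_append_left _ hel) ⟨q, List.mem_append_right _ hq, not_lt.1 h⟩
  exact absurd hc.2 (hlr _ ((List.mem_append.1 this).resolve_right hnr) p hp).asymm

theorem ok_childSol {g : Item → Item} {t : Tree} (h : Ok plain t.sol) :
    Ok plain (childSol g t) := by
  unfold childSol
  split_ifs
  · exact .inl rfl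
  · exact .inr trivial
  · exact h

theorem ok_annot {ε θ : ℝ} {l r : Tree} (hl : Ok plain l.sol) (hr : Ok plain r.sol) :
    Ok plain (annot ε θ l r) := by
  unfold annot summary
  split_ifs
  · exact .inl rfl
  · split
    · rename_i s hs
      exact (greedyRun_ok hs (.inl rfl)).1
    · exact ok_unite (ok_childSol hl) (ok_childSol hr)

theorem length_childSol_le {g : Item → Item} {t : Tree} (ht : Bal f t)
    (h : t.sol.toList.length ≤ t.size) : (childSol g t).toList.length ≤ t.size := by
  unfold childSol
  split_ifs
  · simp [toList]
  · rw [ht.size_eq]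
    exact List.length_pos_iff.2 ht.toList_ne_nil
  · exact h

/-- Solutions are no larger than the trees that carry them, so one bound `lam M` serves for the
heights of both. -/
theorem Bal.length_sol_le {ε θ : ℝ} {t : Tree} (ht : Bal (annot ε θ) t) :
    t.sol.toList.length ≤ t.size := by
  induction t with
  | nil => exact ht.elim
  | leaf x => simp [sol, toList]
  | node d s l r _ ihl ihr =>
    obtain ⟨hl, hr, rfl, rfl, -, -⟩ := ht
    change (annot ε θ l r).toList.length ≤ l.size + r.size
    unfold annot summary
    split_ifs
    · simp [toList]
    · split
      · rename_i s hs
        exact (greedyRun_ok hs (.inl rfl)).2.trans_eq (Nat.zero_add _)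
      · exact (length_unite_le _ _).trans
          (Nat.add_le_add (length_childSol_le hl (ihl hl)) (length_childSol_le hr (ihr hr)))

theorem Bal.ok_sol {ε θ : ℝ} {t : Tree} (ht : Bal (annot ε θ) t) : Ok plain t.sol := by
  induction t with
  | nil => exact ht.elim
  | leaf x => exact .inl rfl
  | node d s l r _ ihl ihr =>
    obtain ⟨hl, hr, rfl, rfl, -, -⟩ := ht
    exact ok_annot (ihl hl) (ihr hr)

/-- The solution stored at the root of a correctly annotated tree is a good one. -/
theorem sol_solves {ε H : ℝ} (hε : 0 < ε) (hε1 : ε ≤ 1) {t : Tree}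
    (ht : Bal (annot ε (2 * H)) t) (hs : t.Sorted) (hV : Segment t.toList) (hH : t.h ≤ H) :
    Solves (H + ε * t.h) H (reach t) t.pts t.sol.toList := by
  induction t with
  | nil => exact ht.elim
  | leaf x =>
    have htag : x.tag = 1 := (hV.valid x (by simp [toList])).tag
    by_cases hk : x.kind = 1
    · have hx : ¬ x < reach (leaf x) x := by
        have : ¬ x.toLo < x := fun h => by simp [Item.kind_of_toLo_lt htag h] at hk
        simp [reach, lastEntering, maxHiBefore, data, this, (Item.bot_lt htag).le]
      have hp : (leaf x).pts = [x] := by simp [pts, toList, hk]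
      rw [hp]
      exact ⟨by simp [sol, toList], by simp [sol, toList], fun h => absurd (h x (by simp)) hx,
        fun h => absurd (h x (by simp)) hx⟩
    · have hp : (leaf x).pts = [] := by simp [pts, toList, hk]
      rw [hp]
      exact ⟨by simp [sol, toList], by simp [sol, toList], by simp, by simp [sol, toList, gcount]⟩
  | node d s l r _ ihl ihr =>
    have hb := best_reach ht hs hV
    have hv : ∀ x ∈ (node d s l r).toList, x.tag = 1 := fun x hx => (hV.valid x hx).tag
    have hmono := reach_mono ht hs hv
    have hpts := pts_node d s l r
    have hspts := hs.pts
    have hbal := ht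
    obtain ⟨hl, hr, rfl, rfl, -, -⟩ := ht
    set v := node (dataOf l r) (annot ε (2 * H) l r) l r with hvdef
    have hh : v.h = max l.h r.h + 1 := rfl
    rw [hh] at hH ⊢
    push_cast at hH ⊢
    have hlh : (l.h : ℝ) ≤ max (l.h : ℝ) r.h := le_max_left _ _
    have hrh : (r.h : ℝ) ≤ max (l.h : ℝ) r.h := le_max_right _ _
    have hm0 : (0 : ℝ) ≤ max (l.h : ℝ) r.h := (Nat.cast_nonneg _).trans hlh
    set m : ℝ := max (l.h : ℝ) r.h
    have hl' := ihl hl hs.left (hV.left hs) (by linarith)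
    have hr' := ihr hr hs.right (hV.right hs) (by linarith)
    have hsol : v.sol = summary ε (2 * H) l r := by
      change annot ε (2 * H) l r = _
      rw [annot, if_neg (by linarith)]
    have hreach : reach (mk plain l r) = reach v := rfl
    have hrun : greedyRun ε (2 * H) (mk plain l r) (lastEntering l.data.first (mk plain l r))
        (mk plain l r).size (nextPt bot (mk plain l r)) 0 nil =
        greedy ε (2 * H) (reach v) v.pts 0 nil := by
      have hU : v.pts = v.pts.filter (bot < ·) :=
        (filter_lt_eq_self fun x hx => Item.bot_lt (hv x (mem_pts.1 hx).1)).symm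
      have hnext : ∀ k, bot ≤ k → nextPt k (mk plain l r) = (v.pts.filter (k < ·)).headD bot :=
        fun k hk => nextPt_eq hbal hs hv hk
      rw [hnext bot le_rfl, ← hU]
      -- The number of items, points or not, is sufficient fuel.
      refine greedyRun_eq hspts (fun x hx => hv x (mem_pts.1 hx).1) hnext hU ?_
      exact (List.length_filter_le _ _).trans hbal.size_eq.ge
    rw [hsol, summary, hreach, hrun]
    have hne : ∀ p ∈ v.pts, ∀ e ∈ ivs v.toList, p ≠ e := by
      rintro p hp e he rfl
      have := (mem_pts.1 hp).2
      rw [he.2.1] at this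
      omega
    split
    · rename_i s hgs
      have h1 := greedy_some hgs
      rw [toList, List.nil_append] at h1
      rw [h1]
      refine ⟨picks_pairwise _ _, fun x hx => exists_of_mem_picks hx,
        exists_covers_of_picks hspts hne hb, fun _ => ?_⟩
      have h2 : ((picks (reach v) v.pts).length : ℝ) ≤ gcount (reach v) v.pts := by
        exact_mod_cast picks_length_le _ _
      have h3 : (0 : ℝ) ≤ gcount (reach v) v.pts := Nat.cast_nonneg _
      have h4 : 0 ≤ ε * (m + 1) := by positivity
      nlinarith
    · rename_i hgn
      have hbig := greedy_none hε.le hgn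
      rw [zero_add] at hbig
      have hsubl : ∀ p ∈ l.pts, p ∈ v.pts := fun p hp => hpts ▸ List.mem_append_left _ hp
      have hsubr : ∀ p ∈ r.pts, p ∈ v.pts := fun p hp => hpts ▸ List.mem_append_right _ hp
      have hH0 : 0 ≤ H := by linarith
      have weaken : ∀ {k : ℝ} {g : Item → Item} {U s : List Item}, k ≤ m →
          Solves (H + ε * k) H g U s → Solves (H + ε * m) H g U s := by
        intro k g U s hk h
        exact ⟨h.sorted, h.mem, h.covers, fun hF => (h.card hF).trans (by gcongr)⟩
      have hcl : Solves (H + ε * m) H (reach v) l.pts (childSol (reach v) l).toList := by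
        refine childSol_solves (E := ivs v.toList) hl hs.left (hV.left hs) ?_
          ⟨fun p hp => hb.mem p (hsubl p hp), fun p hp => hb.covers p (hsubl p hp),
            fun p hp => hb.le p (hsubl p hp)⟩ ?_ (weaken hlh hl') ?_ hH0
        · rintro e ⟨h1, h2, h3⟩
          exact ⟨h1, h2, h3.imp (List.mem_append_left _) (List.mem_append_left _)⟩
        · exact fun e he hn p hp hc q hq =>
            span_left hs hV he hn (mem_pts.1 hp).1 (mem_pts.1 hq).1 hc
        · nlinarith
      have hcr : Solves (H + ε * m) H (reach v) r.pts (childSol (reach v) r).toList := by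
        refine childSol_solves (E := ivs v.toList) hr hs.right (hV.right hs) ?_
          ⟨fun p hp => hb.mem p (hsubr p hp), fun p hp => hb.covers p (hsubr p hp),
            fun p hp => hb.le p (hsubr p hp)⟩ ?_ (weaken hrh hr') ?_ hH0
        · rintro e ⟨h1, h2, h3⟩
          exact ⟨h1, h2, h3.imp (List.mem_append_right _) (List.mem_append_right _)⟩
        · exact fun e he hn p hp hc q hq =>
            span_right hs hV he hn (mem_pts.1 hp).1 (mem_pts.1 hq).1 hc
        · nlinarith
      obtain ⟨u1, u2⟩ := unite_spec (ok_childSol (g := reach v) hl.ok_sol)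
        (ok_childSol (g := reach v) hr.ok_sol) hcl.sorted hcr.sorted
        (fun x hx => by
          obtain ⟨p, hp, -, hpx⟩ := hcr.mem x hx
          exact ((Item.bot_lt (hv p (mem_pts.1 (hsubr p hp)).1)).trans hpx).ne')
        -- Every chosen interval is the value of `reach v` at a point, so the order of the points
        -- carries over by monotonicity.
        (fun x hx y hy => by
          obtain ⟨p, hp, rfl, -⟩ := hcl.mem x hx
          obtain ⟨q, hq, rfl, -⟩ := hcr.mem y hy
          exact hmono (hs.lt (mem_pts.1 hp).1 (mem_pts.1 hq).1).le)
      refine ⟨u1, fun x hx => ?_, fun hF p hp => ?_, fun hF => ?_⟩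
      · rcases (u2 x).1 hx with hx | hx
        · obtain ⟨p, hp, h⟩ := hcl.mem x hx
          exact ⟨p, hsubl p hp, h⟩
        · obtain ⟨p, hp, h⟩ := hcr.mem x hx
          exact ⟨p, hsubr p hp, h⟩
      · rw [hpts] at hp
        rcases List.mem_append.1 hp with hp | hp
        · obtain ⟨x, hx, h⟩ := hcl.covers (fun q hq => hF q (hsubl q hq)) p hp
          exact ⟨x, (u2 x).2 (.inl hx), h⟩
        · obtain ⟨x, hx, h⟩ := hcr.covers (fun q hq => hF q (hsubr q hq)) p hp
          exact ⟨x, (u2 x).2 (.inr hx), h⟩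
      -- With `k` the greedy count at `v`, the size times `H` is at most `(H + ε m) (k + 1)`. Since
      -- `ε m ≤ H` and the aborted run gives `2 H < ε k`, this is at most `(H + ε m) k + 2 H ≤ (H +
      -- ε (m + 1)) k`.
      · have h1 := hcl.card fun q hq => hF q (hsubl q hq)
        have h2 := hcr.card fun q hq => hF q (hsubr q hq)
        have h3 : ((unite (childSol (reach v) l) (childSol (reach v) r)).toList.length : ℝ) ≤
            (childSol (reach v) l).toList.length + (childSol (reach v) r).toList.length := by
          exact_mod_cast length_unite_le _ _
        rw [hpts] at hF hspts
        have h4 : (gcount (reach v) l.pts : ℝ) + gcount (reach v) r.pts ≤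
            gcount (reach v) v.pts + 1 := by
          rw [hpts]; exact_mod_cast gcount_append hmono hspts hF
        have h5 : 0 ≤ H + ε * m := by positivity
        have h6 : ε * m ≤ H := by nlinarith
        nlinarith

end Tree
end DynCover
end

noncomputable section

namespace DynCover

open Item (bot top)

/-! ## Encodings -/

def vl : List Val → Val
  | [] => .nat 0
  | a :: l => .pair a (vl l)

def encItem (x : Item) : Val :=
  .pair (.nat x.tag) (.pair (.real x.crd) (.pair (.nat x.kind) (.real x.oth)))

def encData (d : Data) : Val :=
  .pair (.nat d.h) (.pair (.nat d.size) (.pair (encItem d.first) (.pair (encItem d.last)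
    (.pair (encItem d.maxHi) (.pair (encItem d.minLo) (encItem d.lastPt))))))

/-- The empty tree carries summary data and a leaf carries an empty solution, so the data selectors
work on every tree and `solS` on every nonempty one. -/
def encNil : Val := .pair (.nat 0) (.pair (encData Tree.nil.data) (.nat 0))

def encTree : Tree → Val
  | .nil => encNil
  | .leaf x => .pair (.nat 1) (.pair (encData (Tree.leaf x).data) (.pair encNil (.nat 0)))
  | .node d s l r => .pair (.nat 2) (.pair (encData d) (.pair (encTree s)
      (.pair (encTree l) (encTree r))))

def Tree.ctor : Tree → ℕ
  | .nil => 0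
  | .leaf _ => 1
  | .node _ _ _ _ => 2

def encOption : Option Tree → Val
  | none => .pair (.nat 0) (.nat 0)
  | some t => .pair (.nat 1) (encTree t)

def encOut : List (ℝ × ℝ) → Val
  | [] => .pair (.nat 0) (.nat 0)
  | p :: l => .pair (.nat 1) (.pair (.pair (.real p.1) (.real p.2)) (encOut l))

/-! ## Derived program constructs -/

namespace Prog

def arg : ℕ → Prog
  | 0 => fst
  | n + 1 => comp snd (arg n)

/-- The new value becomes argument `0` in `f`, and all earlier arguments move up by one. -/
def letp (e f : Prog) : Prog := comp (cons e id) f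

def args : List Prog → Prog
  | [] => natc 0
  | e :: es => cons e (args es)

def callp (i : ℕ) (es : List Prog) : Prog := comp (args es) (call i)

/-- Branch on the order of two items. -/
def iteLt (a b p q : Prog) : Prog := ite .natEq (cons (callp 0 [a, b]) (natc 1)) p q

/-- Branch on the constructor of a tree. -/
def cases (t a b c : Prog) : Prog :=
  ite .natEq (cons (comp t fst) (natc 0)) a
    (ite .natEq (cons (comp t fst) (natc 1)) b c)

def iteNeg (e p q : Prog) : Prog := ite .realLt (cons e (realc 0)) p q

/-! Selectors on encoded trees. -/

def dataS : Prog := comp snd fst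
def hS : Prog := comp dataS fst
def sizeS : Prog := comp dataS (comp snd fst)
def firstS : Prog := comp dataS (comp snd (comp snd fst))
def lastS : Prog := comp dataS (comp snd (comp snd (comp snd fst)))
def maxHiS : Prog := comp dataS (comp snd (comp snd (comp snd (comp snd fst))))
def minLoS : Prog := comp dataS (comp snd (comp snd (comp snd (comp snd (comp snd fst)))))
def lastPtS : Prog := comp dataS (comp snd (comp snd (comp snd (comp snd (comp snd snd)))))
def solS : Prog := comp snd (comp snd fst)
def leftS : Prog := comp snd (comp snd (comp snd fst))
def rightS : Prog := comp snd (comp snd (comp snd snd))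

def dataP (t : Prog) : Prog := comp t dataS
def hP (t : Prog) : Prog := comp t hS
def sizeP (t : Prog) : Prog := comp t sizeS
def firstP (t : Prog) : Prog := comp t firstS
def lastP (t : Prog) : Prog := comp t lastS
def maxHiP (t : Prog) : Prog := comp t maxHiS
def minLoP (t : Prog) : Prog := comp t minLoS
def lastPtP (t : Prog) : Prog := comp t lastPtS
def solP (t : Prog) : Prog := comp t solS
def leftP (t : Prog) : Prog := comp t leftS
def rightP (t : Prog) : Prog := comp t rightS

def maxNat (a b : Prog) : Prog := comp (cons a (comp (cons b a) sub)) add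
def pred (a : Prog) : Prog := comp (cons a (natc 1)) sub
def succ (a : Prog) : Prog := comp (cons a (natc 1)) add

def itemP (tag : ℕ) (crd : Prog) (kind : ℕ) (oth : Prog) : Prog :=
  cons (natc tag) (cons crd (cons (natc kind) oth))

def constItem (tag : ℕ) : Prog := itemP tag (realc 0) 0 (realc 0)

/-- The largest node constructor: data fields, solution and subtrees. -/
def dataCons (h size first last maxHi minLo lastPt : Prog) : Prog :=
  cons h (cons size (cons first (cons last (cons maxHi (cons minLo lastPt)))))

def nilP : Prog := cons (natc 0) (cons (dataCons (natc 0) (natc 0) (constItem 0) (constItem 0)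
  (constItem 0) (constItem 2) (constItem 0)) (natc 0))

end Prog

open Classical in
/-- The condition that `A` or `B` holds, according to a test. -/
def branch (o : Option Prop) (A B : Prop) : Prop :=
  match o with
  | some p => if p then A else B
  | none => False

-- Simplification is confined to the test, so a branch is evaluated only after it has been chosen.
-- `wp_congr` plays the same role for arguments and continuations.
@[congr] theorem branch_congr {o o' : Option Prop} {A B : Prop} (h : o = o') :
    branch o A B = branch o' A B := by rw [h]

open Classical in
@[simp] theorem branch_some (p A B : Prop) : branch (some p) A B ↔ if p then A else B := Iff.rfl

@[simp] theorem ite_one_zero_eq_one (p : Prop) [Decidable p] :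
    (if p then 1 else 0) = 1 ↔ p := by
  by_cases h : p <;> simp [h]

/-! ### Symbolic evaluation of programs -/

section simp_lemmas

variable {S : CallSpec} {inp : Input} {Q : Val → ℕ → Prop}

open Prog

@[congr] theorem wp_congr {e : Prog} {x x' : Val} (h : x = x') :
    wp S inp e x Q = wp S inp e x' Q := by rw [h]
@[simp] theorem wp_id (x : Val) : wp S inp .id x Q ↔ Q x 0 := Iff.rfl
@[simp] theorem wp_fst (a b : Val) : wp S inp fst (.pair a b) Q ↔ Q a 0 := Iff.rfl
@[simp] theorem wp_snd (a b : Val) : wp S inp snd (.pair a b) Q ↔ Q b 0 := Iff.rfl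
@[simp] theorem wp_natc (k : ℕ) (x : Val) : wp S inp (natc k) x Q ↔ Q (.nat k) 0 := Iff.rfl
@[simp] theorem wp_realc (k : ℚ) (x : Val) : wp S inp (realc k) x Q ↔ Q (.real k) 0 := Iff.rfl
@[simp] theorem wp_add (a b : ℕ) :
    wp S inp .add (.pair (.nat a) (.nat b)) Q ↔ Q (.nat (a + b)) 0 := Iff.rfl
@[simp] theorem wp_sub (a b : ℕ) :
    wp S inp .sub (.pair (.nat a) (.nat b)) Q ↔ Q (.nat (a - b)) 0 := Iff.rfl
@[simp] theorem wp_radd (a b : ℝ) :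
    wp S inp radd (.pair (.real a) (.real b)) Q ↔ Q (.real (a + b)) 0 := Iff.rfl
@[simp] theorem wp_peek (a : ℕ) :
    wp S inp peek (.nat a) Q ↔ a < inp.len ∧ Q (.real (inp.val a)) 0 := Iff.rfl
@[simp] theorem wp_cons (f g : Prog) (x : Val) : wp S inp (cons f g) x Q ↔
    wp S inp f x fun a t => wp S inp g x fun b t' => Q (.pair a b) (t + t') := Iff.rfl
@[simp] theorem wp_comp (f g : Prog) (x : Val) : wp S inp (comp f g) x Q ↔
    wp S inp f x fun y t => wp S inp g y fun z t' => Q z (t + t') := Iff.rfl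
theorem wp_call_of {i : ℕ} {x v : Val} {t : ℕ} (h : S i x v t) (hQ : Q v t) :
    wp S inp (call i) x Q := ⟨v, t, h, hQ⟩
@[simp] theorem wp_ite (k : Cmp) (c f g : Prog) (x : Val) : wp S inp (.ite k c f g) x Q ↔
    wp S inp c x fun y t => branch (k.sat y) (wp S inp f x fun z t' => Q z (t + t'))
      (wp S inp g x fun z t' => Q z (t + t')) := by
  change (wp S inp c x fun y t => _) ↔ _
  congr! 3 with y t
  unfold branch
  cases k.sat y <;> simp [ite_prop_iff_and]
@[simp] theorem wp_arg_zero (a : Val) (l : List Val) :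
    wp S inp (arg 0) (vl (a :: l)) Q ↔ Q a 0 := Iff.rfl
@[simp] theorem wp_arg_succ (n : ℕ) (a : Val) (l : List Val) :
    wp S inp (arg (n + 1)) (vl (a :: l)) Q ↔ wp S inp (arg n) (vl l) Q := by
  simp [arg, vl]
@[simp] theorem wp_letp (e f : Prog) (l : List Val) : wp S inp (letp e f) (vl l) Q ↔
    wp S inp e (vl l) fun a t => wp S inp f (vl (a :: l)) fun z t' => Q z (t + t') := Iff.rfl
@[simp] theorem wp_args_nil (x : Val) : wp S inp (args []) x Q ↔ Q (vl []) 0 := Iff.rfl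
@[simp] theorem wp_args_cons (e : Prog) (es : List Prog) (x : Val) :
    wp S inp (args (e :: es)) x Q ↔ wp S inp e x fun a t => wp S inp (args es) x fun b t' =>
      Q (.pair a b) (t + t') := Iff.rfl
@[simp] theorem pair_vl (a : Val) (l : List Val) : Val.pair a (vl l) = vl (a :: l) := rfl
@[simp] theorem sat_natEq (a b : ℕ) :
    Cmp.natEq.sat (.pair (.nat a) (.nat b)) = some (a = b) := rfl
@[simp] theorem sat_natLt (a b : ℕ) :
    Cmp.natLt.sat (.pair (.nat a) (.nat b)) = some (a < b) := rfl
@[simp] theorem sat_realLt (a b : ℝ) :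
    Cmp.realLt.sat (.pair (.real a) (.real b)) = some (a < b) := rfl
@[simp] theorem sat_realEq (a b : ℝ) :
    Cmp.realEq.sat (.pair (.real a) (.real b)) = some (a = b) := rfl

@[simp] theorem wp_fst_encItem (x : Item) :
    wp S inp fst (encItem x) Q ↔ Q (.nat x.tag) 0 := Iff.rfl
@[simp] theorem wp_fst_encTree (t : Tree) :
    wp S inp fst (encTree t) Q ↔ Q (.nat t.ctor) 0 := by cases t <;> rfl
@[simp] theorem ctor_nil : Tree.nil.ctor = 0 := rfl
@[simp] theorem ctor_leaf (x : Item) : (Tree.leaf x).ctor = 1 := rfl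
@[simp] theorem ctor_node (d : Data) (s l r : Tree) : (Tree.node d s l r).ctor = 2 := rfl
@[simp] theorem wp_dataS (t : Tree) :
    wp S inp dataS (encTree t) Q ↔ Q (encData t.data) 0 := by cases t <;> rfl
@[simp] theorem wp_hS (t : Tree) :
    wp S inp hS (encTree t) Q ↔ Q (.nat t.h) 0 := by cases t <;> rfl
@[simp] theorem wp_sizeS (t : Tree) :
    wp S inp sizeS (encTree t) Q ↔ Q (.nat t.size) 0 := by cases t <;> rfl
@[simp] theorem wp_firstS (t : Tree) :
    wp S inp firstS (encTree t) Q ↔ Q (encItem t.data.first) 0 := by cases t <;> rfl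
@[simp] theorem wp_lastS (t : Tree) :
    wp S inp lastS (encTree t) Q ↔ Q (encItem t.data.last) 0 := by cases t <;> rfl
@[simp] theorem wp_maxHiS (t : Tree) :
    wp S inp maxHiS (encTree t) Q ↔ Q (encItem t.data.maxHi) 0 := by cases t <;> rfl
@[simp] theorem wp_minLoS (t : Tree) :
    wp S inp minLoS (encTree t) Q ↔ Q (encItem t.data.minLo) 0 := by cases t <;> rfl
@[simp] theorem wp_lastPtS (t : Tree) :
    wp S inp lastPtS (encTree t) Q ↔ Q (encItem t.data.lastPt) 0 := by cases t <;> rfl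
@[simp] theorem wp_solS_node (d : Data) (s l r : Tree) :
    wp S inp solS (encTree (.node d s l r)) Q ↔ Q (encTree s) 0 := Iff.rfl
@[simp] theorem wp_leftS_node (d : Data) (s l r : Tree) :
    wp S inp leftS (encTree (.node d s l r)) Q ↔ Q (encTree l) 0 := Iff.rfl
@[simp] theorem wp_rightS_node (d : Data) (s l r : Tree) :
    wp S inp rightS (encTree (.node d s l r)) Q ↔ Q (encTree r) 0 := Iff.rfl
@[simp] theorem wp_solS_leaf (x : Item) :
    wp S inp solS (encTree (.leaf x)) Q ↔ Q (encTree .nil) 0 := Iff.rfl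
@[simp] theorem wp_constItem_zero (x : Val) :
    wp S inp (constItem 0) x Q ↔ Q (encItem bot) 0 := by
  simp [constItem, itemP, encItem, bot]
@[simp] theorem wp_constItem_two (x : Val) :
    wp S inp (constItem 2) x Q ↔ Q (encItem top) 0 := by
  simp [constItem, itemP, encItem, top]
@[simp] theorem wp_nilP (x : Val) : wp S inp nilP x Q ↔ Q (encTree .nil) 0 := by
  simp [nilP, dataCons, encTree, encNil, encData, Tree.data]

attribute [simp] maxNat pred succ callp iteLt cases iteNeg dataP hP sizeP firstP lastP maxHiP minLoP lastPtP solP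
  leftP rightP

end simp_lemmas

/-! ## The procedures -/

namespace Proc

open Prog

def lt : Prog :=
  let x := arg 0
  let y := arg 1
  -- A cascade of three-way comparisons, one for each component of the lexicographic order.
  let bit (k : Cmp) (a b : Prog) (e : Prog) : Prog :=
    .ite k (cons a b) (natc 1) (.ite k (cons b a) (natc 0) e)
  bit .natLt (comp x fst) (comp y fst)
    (bit .realLt (comp x (comp snd fst)) (comp y (comp snd fst))
      (bit .natLt (comp x (comp snd (comp snd fst))) (comp y (comp snd (comp snd fst)))
        (bit .realLt (comp x (comp snd (comp snd snd))) (comp y (comp snd (comp snd snd)))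
          (natc 0))))

def max : Prog := iteLt (arg 0) (arg 1) (arg 1) (arg 0)
def min : Prog := iteLt (arg 0) (arg 1) (arg 0) (arg 1)

def leaf : Prog :=
  let x := arg 0
  let crd := comp x (comp snd fst)
  let kind := comp x (comp snd (comp snd fst))
  let oth := comp x (comp snd (comp snd snd))
  cons (natc 1) (cons (dataCons (natc 0) (natc 1) x x
    (.ite .natEq (cons kind (natc 0)) (itemP 1 oth 2 crd) (constItem 0))
    (.ite .natEq (cons kind (natc 2)) (itemP 1 oth 0 crd) (constItem 2))
    (.ite .natEq (cons kind (natc 1)) x (constItem 0))) (cons nilP (natc 0)))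

def mkPlain : Prog :=
  let l := arg 0
  let r := arg 1
  cons (natc 2) (cons (dataCons (succ (maxNat (hP l) (hP r)))
    (comp (cons (sizeP l) (sizeP r)) .add) (firstP l) (lastP r)
    (callp 1 [maxHiP l, maxHiP r]) (callp 2 [minLoP l, minLoP r])
    (callp 1 [lastPtP l, lastPtP r])) (cons nilP (cons l r)))

def maxHiBefore : Prog :=
  let p := arg 0
  let t := arg 1
  cases t (constItem 0)
    (iteLt (firstP t) p (maxHiP t) (constItem 0))
    (iteLt (firstP (rightP t)) p
      (callp 1 [maxHiP (leftP t), callp 5 [p, rightP t]])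
      (callp 5 [p, leftP t]))

def lastEntering : Prog :=
  let s := arg 0
  let t := arg 1
  cases t (constItem 0)
    (iteLt (minLoP t) s (firstP t) (constItem 0))
    (iteLt (minLoP (rightP t)) s (callp 6 [s, rightP t]) (callp 6 [s, leftP t]))

def nextPt : Prog :=
  let k := arg 0
  let t := arg 1
  cases t (constItem 0)
    (iteLt k (lastPtP t) (firstP t) (constItem 0))
    (iteLt k (lastPtP (leftP t)) (callp 7 [k, leftP t]) (callp 7 [k, rightP t]))

/-- Arguments `ε, θ, v, c, n, p, acc, s`. -/
def greedyRun : Prog :=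
  .ite .natEq (cons (arg 4) (natc 0)) (cons (natc 1) (arg 7))
    (.ite .natEq (cons (comp (arg 5) fst) (natc 0)) (cons (natc 1) (arg 7))
      (letp (comp (cons (arg 6) (arg 0)) radd)
        (.ite .realLt (cons (arg 2) (arg 0)) (cons (natc 0) (natc 0))
          (letp (callp 1 [arg 4, callp 5 [arg 6, arg 3]])
            (callp 8 [arg 2, arg 3, arg 4, arg 5, pred (arg 6),
              callp 7 [callp 1 [arg 7, arg 0], arg 4], arg 1,
              -- The bound `θ = -1` switches the stored solutions off, so that procedure `16` acts
              -- as `join plain`.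
              iteLt (arg 7) (arg 0) (callp 16 [realc 0, realc (-1), arg 9, callp 3 [arg 0]])
                (arg 9)])))))

/-- Arguments `v, c, t`. -/
def childSol : Prog :=
  .ite .natEq (cons (comp (lastPtP (arg 2)) fst) (natc 0)) nilP
    (letp (callp 1 [arg 1, callp 5 [callp 7 [constItem 0, arg 2], arg 0]])
      (iteLt (lastPtP (arg 3)) (arg 0) (callp 3 [arg 0]) (solP (arg 3))))

def unite : Prog :=
  callp 16 [realc 0, realc (-1), arg 0, callp 18 [realc 0, realc (-1), lastP (arg 0), arg 1]]

/-- Arguments `ε, θ, l, r`. -/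
def mk : Prog :=
  iteNeg (arg 1) (callp 4 [arg 2, arg 3])
    (letp (callp 4 [arg 2, arg 3])
      (letp (callp 6 [firstP (arg 3), arg 0])
        (letp (callp 8 [arg 2, arg 3, arg 1, arg 0, sizeP (arg 1),
            callp 7 [constItem 0, arg 1], realc 0, nilP])
          (letp (.ite .natEq (cons (comp (arg 0) fst) (natc 1)) (comp (arg 0) snd)
              (callp 10 [callp 9 [arg 2, arg 1, arg 5], callp 9 [arg 2, arg 1, arg 6]]))
            (cons (natc 2) (cons (dataP (arg 3)) (cons (arg 0) (cons (arg 6) (arg 7)))))))))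

def mkP (l r : Prog) : Prog := callp 11 [arg 0, arg 1, l, r]

/-- Arguments `ε, θ, a, t`. -/
def balR : Prog :=
  cases (arg 3) (mkP (arg 2) (arg 3)) (mkP (arg 2) (arg 3))
    (.ite .natLt (cons (succ (hP (arg 2))) (hP (arg 3)))
      (.ite .natLt (cons (hP (rightP (arg 3))) (hP (leftP (arg 3))))
        (mkP (mkP (arg 2) (leftP (leftP (arg 3)))) (mkP (rightP (leftP (arg 3))) (rightP (arg 3))))
        (mkP (mkP (arg 2) (leftP (arg 3))) (rightP (arg 3))))
      (mkP (arg 2) (arg 3)))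

/-- Arguments `ε, θ, a, t`. -/
def balL : Prog :=
  cases (arg 3) (mkP (arg 3) (arg 2)) (mkP (arg 3) (arg 2))
    (.ite .natLt (cons (succ (hP (arg 2))) (hP (arg 3)))
      (.ite .natLt (cons (hP (leftP (arg 3))) (hP (rightP (arg 3))))
        (mkP (mkP (leftP (arg 3)) (leftP (rightP (arg 3)))) (mkP (rightP (rightP (arg 3))) (arg 2)))
        (mkP (leftP (arg 3)) (mkP (rightP (arg 3)) (arg 2))))
      (mkP (arg 3) (arg 2)))

attribute [simp] mkP

/-- Arguments `ε, θ, r, t`. -/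
def joinR : Prog :=
  let mkP := callp 11 [arg 0, arg 1, arg 3, arg 2]
  cases (arg 3) mkP mkP
    (.ite .natLt (cons (succ (hP (arg 2))) (hP (arg 3)))
      (callp 12 [arg 0, arg 1, leftP (arg 3),
        callp 14 [arg 0, arg 1, arg 2, rightP (arg 3)]]) mkP)

/-- Arguments `ε, θ, l, t`. -/
def joinL : Prog :=
  let mkP := callp 11 [arg 0, arg 1, arg 2, arg 3]
  cases (arg 3) mkP mkP
    (.ite .natLt (cons (succ (hP (arg 2))) (hP (arg 3)))
      (callp 13 [arg 0, arg 1, rightP (arg 3),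
        callp 15 [arg 0, arg 1, arg 2, leftP (arg 3)]]) mkP)

/-- Arguments `ε, θ, l, r`. -/
def join : Prog :=
  let rest := .ite .natLt (cons (hP (arg 2)) (hP (arg 3)))
    (callp 15 [arg 0, arg 1, arg 2, arg 3]) (callp 14 [arg 0, arg 1, arg 3, arg 2])
  cases (arg 2) (arg 3) (cases (arg 3) (arg 2) rest rest) (cases (arg 3) (arg 2) rest rest)

/-- Arguments `ε, θ, x, t`. -/
def insert : Prog :=
  let x := arg 2
  let t := arg 3
  let recp (u : Prog) := callp 17 [arg 0, arg 1, x, u]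
  cases t (callp 3 [x])
    (iteLt x (firstP t) (callp 11 [arg 0, arg 1, callp 3 [x], t])
      (iteLt (firstP t) x (callp 11 [arg 0, arg 1, t, callp 3 [x]]) t))
    (iteLt x (firstP (rightP t)) (callp 16 [arg 0, arg 1, recp (leftP t), rightP t])
      (callp 16 [arg 0, arg 1, leftP t, recp (rightP t)]))

/-- Arguments `ε, θ, x, t`. -/
def delete : Prog :=
  let x := arg 2
  let t := arg 3
  let recp (u : Prog) := callp 18 [arg 0, arg 1, x, u]
  cases t t (iteLt x (firstP t) t (iteLt (firstP t) x t nilP))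
    (iteLt x (firstP (rightP t)) (callp 16 [arg 0, arg 1, recp (leftP t), rightP t])
      (callp 16 [arg 0, arg 1, leftP t, recp (rightP t)]))

/-- Arguments `x, t`. -/
def mem : Prog :=
  let x := arg 0
  let t := arg 1
  cases t (natc 0) (iteLt x (firstP t) (natc 0) (iteLt (firstP t) x (natc 0) (natc 1)))
    (iteLt x (firstP (rightP t)) (callp 19 [x, leftP t]) (callp 19 [x, rightP t]))

/-- Arguments `ε, θ, t`. -/
def rebuild : Prog :=
  cases (arg 2) (arg 2) (arg 2) (callp 11 [arg 0, arg 1,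
    callp 20 [arg 0, arg 1, leftP (arg 2)], callp 20 [arg 0, arg 1, rightP (arg 2)]])

/-- Arguments `t, acc`. -/
def flat : Prog :=
  cases (arg 0) (arg 1)
    (cons (natc 1) (cons (cons (comp (firstP (arg 0)) (comp snd (comp snd snd)))
      (comp (firstP (arg 0)) (comp snd fst))) (arg 1)))
    (callp 21 [leftP (arg 0), callp 21 [rightP (arg 0), arg 1]])

/-- The machine neither multiplies nor converts integers to reals, so `4 * n + 12` is built by
repeated addition. -/
def theta : Prog :=
  .ite .natEq (cons (arg 0) (natc 0)) (realc 12)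
    (comp (cons (callp 22 [pred (arg 0)]) (realc 4)) radd)

def insertPlain (x t : Prog) : Prog := callp 17 [realc 0, realc (-1), x, t]

/-- Arguments `n, i, t`. -/
def loadPoints : Prog :=
  .ite .natEq (cons (arg 0) (natc 0)) (arg 2)
    (callp 23 [pred (arg 0), succ (arg 1),
      insertPlain (itemP 1 (comp (arg 1) peek) 1 (realc 0)) (arg 2)])

/-- Arguments `n, i, t`. -/
def loadIntervals : Prog :=
  .ite .natEq (cons (arg 0) (natc 0)) (arg 2)
    (callp 24 [pred (arg 0), succ (succ (arg 1)),
      insertPlain (itemP 1 (comp (arg 1) peek) 0 (comp (succ (arg 1)) peek))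
        (insertPlain (itemP 1 (comp (succ (arg 1)) peek) 2 (comp (arg 1) peek)) (arg 2))])

end Proc

/-- The position in this list is the number of the procedure in calls and in `Spec`. -/
def bodies : List Prog :=
  [Proc.lt, Proc.max, Proc.min, Proc.leaf, Proc.mkPlain, Proc.maxHiBefore, Proc.lastEntering,
    Proc.nextPt, Proc.greedyRun, Proc.childSol, Proc.unite, Proc.mk, Proc.balR, Proc.balL,
    Proc.joinR, Proc.joinL, Proc.join, Proc.insert, Proc.delete, Proc.mem, Proc.rebuild,
    Proc.flat, Proc.theta, Proc.loadPoints, Proc.loadIntervals]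

/-! ## The specification -/

/-- The recorded heights strictly increase towards the root. -/
def Hgt : Tree → Prop
  | .node d _ l r => Hgt l ∧ Hgt r ∧ l.h < d.h ∧ r.h < d.h
  | _ => True

open DynCover.Tree

/-- `Hgt` suffices for the running time of the searches, and unlike `Bal` it also holds for the
provisional node `mk plain l r` over annotated children. -/
theorem Tree.Bal.hgt {f : Tree → Tree → Tree} {t : Tree} (ht : Bal f t) : Hgt t := by
  induction t with
  | nil => trivial
  | leaf x => trivial
  | node d s l r _ ihl ihr =>
    obtain ⟨hl, hr, rfl, -, -, -⟩ := ht
    exact ⟨ihl hl, ihr hr, Nat.lt_succ_of_le (le_max_left _ _), Nat.lt_succ_of_le (le_max_right _ _)⟩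

namespace Tree

/-- Recompute all annotations. -/
def rebuild (f : Tree → Tree → Tree) : Tree → Tree
  | nil => nil
  | leaf x => leaf x
  | node _ _ l r => mk f (rebuild f l) (rebuild f r)

end Tree

/-- Insert the points whose coordinates are in the cells `i, …, i + n - 1`. -/
def loadPoints (inp : Input) : ℕ → ℕ → Tree → Tree
  | 0, _, t => t
  | n + 1, i, t => loadPoints inp n (i + 1) (insert plain ⟨1, inp.val i, 1, 0⟩ t)

/-- Insert the intervals whose endpoints are in the cells `i, …, i + 2 * n - 1`. -/
def loadIntervals (inp : Input) : ℕ → ℕ → Tree → Tree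
  | 0, _, t => t
  | n + 1, i, t => loadIntervals inp n (i + 1 + 1)
      (insert plain ⟨1, inp.val i, 0, inp.val (i + 1)⟩
        (insert plain ⟨1, inp.val (i + 1), 2, inp.val i⟩ t))

/-- A bound for the heights of trees of size `M`. -/
def lam (M : ℕ) : ℕ := 2 * Nat.log 2 M + 3

/-- In trees of size at most `M` the greedy algorithm makes at most `B` steps. -/
def Fit (ε θ : ℝ) (B M : ℕ) : Prop := θ < 0 ∨ M ≤ B ∨ θ < ε * (B + 1)

open Classical in
/-- The cost of a call of `mk`. -/
def mkCost (θ : ℝ) (B M : ℕ) : ℕ := if θ < 0 then 20 else 2000 * lam M * (B + 2)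

-- Preconditions are arguments of the constructors, so each recursive call has to re-establish them.
-- `M` and `B` enter only the preconditions and the costs and are chosen by the caller: in updates
-- `B` is `⌊θ / ε⌋₊`, in rebuilding it is the size of the subtree.
open Classical in
inductive Spec (inp : Input) : CallSpec
  | lt (x y : Item) :
    Spec inp 0 (vl [encItem x, encItem y]) (.nat (if x < y then 1 else 0)) 1
  | max (x y : Item) : Spec inp 1 (vl [encItem x, encItem y]) (encItem (max x y)) 2
  | min (x y : Item) : Spec inp 2 (vl [encItem x, encItem y]) (encItem (min x y)) 2
  | leaf (x : Item) : Spec inp 3 (vl [encItem x]) (encTree (leaf x)) 1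
  | mkPlain (l r : Tree) : Spec inp 4 (vl [encTree l, encTree r]) (encTree (mk plain l r)) 10
  | maxHiBefore (p : Item) (t : Tree) (ht : Hgt t) :
    Spec inp 5 (vl [encItem p, encTree t]) (encItem (maxHiBefore p t)) (5 * (t.h + 1))
  | lastEntering (s : Item) (t : Tree) (ht : Hgt t) :
    Spec inp 6 (vl [encItem s, encTree t]) (encItem (lastEntering s t)) (5 * (t.h + 1))
  | nextPt (k : Item) (t : Tree) (ht : Hgt t) :
    Spec inp 7 (vl [encItem k, encTree t]) (encItem (nextPt k t)) (5 * (t.h + 1))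
  | greedyRun (ε θ : ℝ) (v : Tree) (c : Item) (n : ℕ) (p : Item) (acc : ℝ) (s : Tree) (M B : ℕ)
      (hv : Hgt v) (hM : v.h + 1 ≤ lam M) (hs : Ok plain s) (hn : s.size + n ≤ M)
      (hB : n ≤ B ∨ θ < acc + ε * (B + 1)) :
    Spec inp 8 (vl [.real ε, .real θ, encTree v, encItem c, .nat n, encItem p, .real acc,
      encTree s]) (encOption (greedyRun ε θ v c n p acc s)) (200 * lam M * (B + 1))
  | childSol (v : Tree) (c : Item) (t : Tree) (M : ℕ) (hv : Hgt v) (hM : v.h + 1 ≤ lam M)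
      (ht : Hgt t) (htM : t.h + 1 ≤ lam M) (hn : t ≠ nil) :
    Spec inp 9 (vl [encTree v, encItem c, encTree t])
      (encTree (childSol (fun p => Max.max c (maxHiBefore p v)) t)) (20 * lam M)
  | unite (a b : Tree) (M : ℕ) (ha : Ok plain a) (hb : Ok plain b) (hM : a.size + b.size ≤ M) :
    Spec inp 10 (vl [encTree a, encTree b]) (encTree (unite a b)) (400 * lam M)
  | mk (ε θ : ℝ) (l r : Tree) (M B : ℕ) (hl : Bal (annot ε θ) l) (hr : Bal (annot ε θ) r)
      (hM : l.size + r.size ≤ M) (hB : Fit ε θ B M) :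
    Spec inp 11 (vl [.real ε, .real θ, encTree l, encTree r]) (encTree (mk (annot ε θ) l r))
      (mkCost θ B M)
  | balR (ε θ : ℝ) (a t : Tree) (M B : ℕ) (ha : Bal (annot ε θ) a) (ht : Bal (annot ε θ) t)
      (h₁ : t.h ≤ a.h + 2) (h₂ : a.h ≤ t.h + 1) (hM : a.size + t.size ≤ M) (hB : Fit ε θ B M) :
    Spec inp 12 (vl [.real ε, .real θ, encTree a, encTree t]) (encTree (balR (annot ε θ) a t))
      (3 * mkCost θ B M + 2)
  | balL (ε θ : ℝ) (a t : Tree) (M B : ℕ) (ha : Bal (annot ε θ) a) (ht : Bal (annot ε θ) t)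
      (h₁ : t.h ≤ a.h + 2) (h₂ : a.h ≤ t.h + 1) (hM : a.size + t.size ≤ M) (hB : Fit ε θ B M) :
    Spec inp 13 (vl [.real ε, .real θ, encTree a, encTree t]) (encTree (balL (annot ε θ) a t))
      (3 * mkCost θ B M + 2)
  | joinR (ε θ : ℝ) (r t : Tree) (M B : ℕ) (hr : Bal (annot ε θ) r) (ht : Bal (annot ε θ) t)
      (h₁ : r.h ≤ t.h + 1) (hM : r.size + t.size ≤ M) (hB : Fit ε θ B M) :
    Spec inp 14 (vl [.real ε, .real θ, encTree r, encTree t]) (encTree (joinR (annot ε θ) r t))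
      ((t.h - r.h + 1) * (3 * mkCost θ B M + 5))
  | joinL (ε θ : ℝ) (l t : Tree) (M B : ℕ) (hl : Bal (annot ε θ) l) (ht : Bal (annot ε θ) t)
      (h₁ : l.h ≤ t.h + 1) (hM : l.size + t.size ≤ M) (hB : Fit ε θ B M) :
    Spec inp 15 (vl [.real ε, .real θ, encTree l, encTree t]) (encTree (joinL (annot ε θ) l t))
      ((t.h - l.h + 1) * (3 * mkCost θ B M + 5))
  | join (ε θ : ℝ) (l r : Tree) (M B : ℕ) (hl : Ok (annot ε θ) l) (hr : Ok (annot ε θ) r)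
      (hM : l.size + r.size ≤ M) (hB : Fit ε θ B M) :
    Spec inp 16 (vl [.real ε, .real θ, encTree l, encTree r]) (encTree (join (annot ε θ) l r))
      ((l.h - r.h + (r.h - l.h) + 1) * (3 * mkCost θ B M + 5) + 2)
  | insert (ε θ : ℝ) (x : Item) (t : Tree) (M B : ℕ) (ht : Ok (annot ε θ) t)
      (hM : t.size + 1 ≤ M) (hB : Fit ε θ B M) :
    Spec inp 17 (vl [.real ε, .real θ, encItem x, encTree t]) (encTree (insert (annot ε θ) x t))
      ((t.h + 1) * (9 * mkCost θ B M + 30))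
  | delete (ε θ : ℝ) (x : Item) (t : Tree) (M B : ℕ) (ht : Ok (annot ε θ) t)
      (hM : t.size ≤ M) (hB : Fit ε θ B M) :
    Spec inp 18 (vl [.real ε, .real θ, encItem x, encTree t]) (encTree (delete (annot ε θ) x t))
      ((t.h + 1) * (9 * mkCost θ B M + 30))
  | mem (x : Item) (t : Tree) (ht : Hgt t) :
    Spec inp 19 (vl [encItem x, encTree t]) (.nat (if Mem x t then 1 else 0)) (3 * (t.h + 1))
  | rebuild (ε θ : ℝ) (t : Tree) (M : ℕ) (f : Tree → Tree → Tree) (ht : Ok f t)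
      (hθ : 0 ≤ θ) (hM : t.size ≤ M) :
    Spec inp 20 (vl [.real ε, .real θ, encTree t]) (encTree (rebuild (annot ε θ) t))
      ((t.h + 1) * (7000 * lam M * t.size) + 1)
  | flat (f : Tree → Tree → Tree) (t : Tree) (l : List (ℝ × ℝ)) (ht : Bal f t) :
    Spec inp 21 (vl [encTree t, encOut l])
      (encOut (t.toList.map (fun x => (x.oth, x.crd)) ++ l)) (2 * t.size - 1)
  | theta (n : ℕ) : Spec inp 22 (vl [.nat n]) (.real (4 * n + 12)) (n + 1)
  | loadPoints (n i : ℕ) (t : Tree) (M : ℕ) (ht : Ok plain t) (hi : i + n ≤ inp.len)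
      (hM : t.size + n ≤ M) :
    Spec inp 23 (vl [.nat n, .nat i, encTree t]) (encTree (loadPoints inp n i t))
      (n * (220 * lam M) + 1)
  | loadIntervals (n i : ℕ) (t : Tree) (M : ℕ) (ht : Ok plain t) (hi : i + 2 * n ≤ inp.len)
      (hM : t.size + 2 * n ≤ M) :
    Spec inp 24 (vl [.nat n, .nat i, encTree t]) (encTree (loadIntervals inp n i t))
      (n * (440 * lam M) + 1)

theorem encItem_injective : Function.Injective encItem := by
  intro x y h
  simp only [encItem, Val.pair.injEq, Val.nat.injEq, Val.real.injEq] at h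
  exact Item.ext h.1 h.2.1 h.2.2.1 h.2.2.2

variable {inp : Input} {Q : Val → ℕ → Prop}

abbrev Runs (inp : Input) (e : Prog) (x v : Val) (t : ℕ) : Prop :=
  wp (Spec inp) inp e x fun v' t' => v' = v ∧ t' < t

-- Since encodings are injective, a call without preconditions has exactly one outcome in `Spec`,
-- and simplification can step over it. The same holds for the next three procedures.
@[simp] theorem wp_call_lt (x y : Item) :
    wp (Spec inp) inp (.call 0) (vl [encItem x, encItem y]) Q ↔
      Q (.nat (if x < y then 1 else 0)) 1 := by
  refine ⟨?_, wp_call_of (.lt x y)⟩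
  rintro ⟨v, t, h, hq⟩
  generalize hX : vl [encItem x, encItem y] = X at h
  cases h with
  | lt x' y' =>
    simp only [vl, Val.pair.injEq, and_true] at hX
    rwa [encItem_injective hX.1, encItem_injective hX.2]

@[simp] theorem wp_call_max (x y : Item) :
    wp (Spec inp) inp (.call 1) (vl [encItem x, encItem y]) Q ↔ Q (encItem (max x y)) 2 := by
  refine ⟨?_, wp_call_of (.max x y)⟩
  rintro ⟨v, t, h, hq⟩
  generalize hX : vl [encItem x, encItem y] = X at h
  cases h with
  | max x' y' =>
    simp only [vl, Val.pair.injEq, and_true] at hX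
    rwa [encItem_injective hX.1, encItem_injective hX.2]

@[simp] theorem wp_call_min (x y : Item) :
    wp (Spec inp) inp (.call 2) (vl [encItem x, encItem y]) Q ↔ Q (encItem (min x y)) 2 := by
  refine ⟨?_, wp_call_of (.min x y)⟩
  rintro ⟨v, t, h, hq⟩
  generalize hX : vl [encItem x, encItem y] = X at h
  cases h with
  | min x' y' =>
    simp only [vl, Val.pair.injEq, and_true] at hX
    rwa [encItem_injective hX.1, encItem_injective hX.2]

@[simp] theorem wp_call_leaf (x : Item) :
    wp (Spec inp) inp (.call 3) (vl [encItem x]) Q ↔ Q (encTree (leaf x)) 1 := by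
  refine ⟨?_, wp_call_of (.leaf x)⟩
  rintro ⟨v, t, h, hq⟩
  generalize hX : vl [encItem x] = X at h
  cases h with
  | leaf x' =>
    simp only [vl, Val.pair.injEq, and_true] at hX
    rwa [encItem_injective hX]

theorem runs_lt (x y : Item) :
    Runs inp Proc.lt (vl [encItem x, encItem y]) (.nat (if x < y then 1 else 0)) 1 := by
  simp only [Runs, Proc.lt, encItem, wp_ite, wp_cons, wp_comp, wp_arg_zero, wp_arg_succ, wp_fst,
    wp_snd, wp_natc, sat_natLt, sat_realLt, branch_some]
  have hlt := Item.lt_def x y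
  split_ifs <;> simp <;> grind

theorem runs_max (x y : Item) :
    Runs inp Proc.max (vl [encItem x, encItem y]) (encItem (max x y)) 2 := by
  by_cases h : x < y
  · simp [Proc.max, h, h.le]
  · simp [Proc.max, h, not_lt.1 h]

theorem runs_min (x y : Item) :
    Runs inp Proc.min (vl [encItem x, encItem y]) (encItem (min x y)) 2 := by
  by_cases h : x < y
  · simp [Proc.min, h, h.le]
  · simp [Proc.min, h, not_lt.1 h]

theorem runs_leaf (x : Item) : Runs inp Proc.leaf (vl [encItem x]) (encTree (leaf x)) 1 := by
  simp only [Runs, Proc.leaf, Prog.dataCons, Prog.itemP, encItem, wp_ite, branch_some,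
     wp_cons, wp_comp,
    wp_arg_zero, wp_fst, wp_snd, wp_natc, sat_natEq, wp_constItem_zero,
    wp_constItem_two, wp_nilP]
  rcases Nat.lt_or_ge x.kind 3 with h | h
  · interval_cases hk : x.kind <;>
      simp [encTree, encData, data, Item.toHi, Item.toLo, Item.toPt, hk, encItem]
  · simp [show x.kind ≠ 0 by omega, show x.kind ≠ 1 by omega, show x.kind ≠ 2 by omega,
      encTree, encData, data, Item.toHi, Item.toLo, Item.toPt, encItem]

theorem runs_mkPlain (l r : Tree) :
    Runs inp Proc.mkPlain (vl [encTree l, encTree r]) (encTree (mk plain l r)) 10 := by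
  simp [Proc.mkPlain, Prog.dataCons, encTree, mk, encData, dataOf, h, size]
  omega

theorem runs_maxHiBefore (p : Item) (t : Tree) (ht : Hgt t) :
    Runs inp Proc.maxHiBefore (vl [encItem p, encTree t]) (encItem (maxHiBefore p t))
      (5 * (t.h + 1)) := by
  cases t with
  | nil => simp [Proc.maxHiBefore, maxHiBefore]
  | leaf x => by_cases hx : x < p <;> simp [Proc.maxHiBefore, maxHiBefore, data, hx]
  | node d s l r =>
    obtain ⟨hl, hr, hlh, hrh⟩ := ht
    have he : (node d s l r).h = d.h := rfl
    by_cases hx : r.data.first < p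
    · simp [Proc.maxHiBefore, maxHiBefore, hx]
      refine wp_call_of (.maxHiBefore p r hr) ?_
      simp
      omega
    · simp [Proc.maxHiBefore, maxHiBefore, hx]
      refine wp_call_of (.maxHiBefore p l hl) ?_
      simp
      omega

theorem runs_lastEntering (p : Item) (t : Tree) (ht : Hgt t) :
    Runs inp Proc.lastEntering (vl [encItem p, encTree t]) (encItem (lastEntering p t))
      (5 * (t.h + 1)) := by
  cases t with
  | nil => simp [Proc.lastEntering, lastEntering]
  | leaf x => by_cases hx : x.toLo < p <;> simp [Proc.lastEntering, lastEntering, data, hx]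
  | node d s l r =>
    obtain ⟨hl, hr, hlh, hrh⟩ := ht
    have he : (node d s l r).h = d.h := rfl
    by_cases hx : r.data.minLo < p
    · simp [Proc.lastEntering, lastEntering, hx]
      refine wp_call_of (.lastEntering p r hr) ?_
      simp
      omega
    · simp [Proc.lastEntering, lastEntering, hx]
      refine wp_call_of (.lastEntering p l hl) ?_
      simp
      omega

theorem runs_nextPt (p : Item) (t : Tree) (ht : Hgt t) :
    Runs inp Proc.nextPt (vl [encItem p, encTree t]) (encItem (nextPt p t))
      (5 * (t.h + 1)) := by
  cases t with
  | nil => simp [Proc.nextPt, nextPt]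
  | leaf x => by_cases hx : p < x.toPt <;> simp [Proc.nextPt, nextPt, data, hx]
  | node d s l r =>
    obtain ⟨hl, hr, hlh, hrh⟩ := ht
    have he : (node d s l r).h = d.h := rfl
    by_cases hx : p < l.data.lastPt
    · simp [Proc.nextPt, nextPt, hx]
      refine wp_call_of (.nextPt p l hl) ?_
      simp
      omega
    · simp [Proc.nextPt, nextPt, hx]
      refine wp_call_of (.nextPt p r hr) ?_
      simp
      omega

end DynCover
end

noncomputable section

namespace DynCover

open Item (bot top)
open DynCover.Tree

/-! ## The procedures meet the specification -/

variable {inp : Input} {Q : Val → ℕ → Prop}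

theorem lam_mono {m n : ℕ} (h : m ≤ n) : lam m ≤ lam n := by
  have := Nat.log_mono_right (b := 2) h
  unfold lam; omega

theorem three_le_lam (M : ℕ) : 3 ≤ lam M := by unfold lam; omega

/-- The reserve of two leaves room for a new node above the tree, whose height must still fit under
`lam M`. -/
theorem Tree.Bal.h_lt {f : Tree → Tree → Tree} {t : Tree} (ht : Bal f t) {M : ℕ}
    (hM : t.size ≤ M) : t.h + 2 ≤ lam M := by
  obtain ⟨h1, h2⟩ := ht.two_pow_le
  have h0 : t.size ≠ 0 := by rintro h; simp [h] at h1
  have h3 : t.size < 2 ^ (Nat.log 2 M + 1) := hM.trans_lt (Nat.lt_pow_succ_log_self (by simp) M)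
  have h4 : 2 ^ t.h < 2 ^ (2 * (Nat.log 2 M + 1)) := by
    rw [pow_mul']
    exact h1.trans_lt (Nat.pow_lt_pow_left h3 (by simp))
  have := (Nat.pow_lt_pow_iff_right (by simp : 1 < 2)).1 h4
  unfold lam; omega

theorem Tree.Ok.h_lt {f : Tree → Tree → Tree} {t : Tree} (ht : Ok f t) {M : ℕ}
    (hM : t.size ≤ M) : t.h + 2 ≤ lam M := by
  rcases ht with rfl | ht
  · have := three_le_lam M
    rw [h_nil]; omega
  · exact ht.h_lt hM

theorem Tree.Ok.hgt {f : Tree → Tree → Tree} {t : Tree} (ht : Ok f t) : Hgt t := by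
  rcases ht with rfl | ht
  · trivial
  · exact ht.hgt

theorem mkCost_neg {θ : ℝ} (h : θ < 0) (B M : ℕ) : mkCost θ B M = 20 := if_pos h

/-- This lets one set of procedures handle annotated trees and the plain trees in which solutions
are stored. -/
theorem annot_neg (ε : ℝ) {θ : ℝ} (h : θ < 0) : annot ε θ = plain := by
  ext l r
  exact if_pos h

theorem wp_call_join_plain {a b : Tree} (ha : Ok plain a) (hb : Ok plain b)
    (h : Q (encTree (join plain a b)) ((a.h - b.h + (b.h - a.h) + 1) * 65 + 2)) :
    wp (Spec inp) inp (.call 16) (vl [.real 0, .real (-1), encTree a, encTree b]) Q := by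
  have hp := annot_neg 0 (by norm_num : (-1 : ℝ) < 0)
  refine wp_call_of (.join 0 (-1) a b (a.size + b.size) 0 (by rwa [hp]) (by rwa [hp]) le_rfl
    (.inl (by norm_num))) ?_
  rwa [hp, mkCost_neg (by norm_num)]

theorem wp_call_insert_plain {x : Item} {t : Tree} (ht : Ok plain t)
    (h : Q (encTree (insert plain x t)) ((t.h + 1) * 210)) :
    wp (Spec inp) inp (.call 17) (vl [.real 0, .real (-1), encItem x, encTree t]) Q := by
  have hp := annot_neg 0 (by norm_num : (-1 : ℝ) < 0)
  refine wp_call_of (.insert 0 (-1) x t (t.size + 1) 0 (by rwa [hp]) le_rfl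
    (.inl (by norm_num))) ?_
  rwa [hp, mkCost_neg (by norm_num)]

theorem wp_call_delete_plain {x : Item} {t : Tree} (ht : Ok plain t)
    (h : Q (encTree (delete plain x t)) ((t.h + 1) * 210)) :
    wp (Spec inp) inp (.call 18) (vl [.real 0, .real (-1), encItem x, encTree t]) Q := by
  have hp := annot_neg 0 (by norm_num : (-1 : ℝ) < 0)
  refine wp_call_of (.delete 0 (-1) x t t.size 0 (by rwa [hp]) le_rfl (.inl (by norm_num))) ?_
  rwa [hp, mkCost_neg (by norm_num)]

theorem runs_greedyRun (ε θ : ℝ) (v : Tree) (c : Item) (n : ℕ) (p : Item) (acc : ℝ) (s : Tree)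
    (M B : ℕ) (hv : Hgt v) (hM : v.h + 1 ≤ lam M) (hs : Ok plain s) (hn : s.size + n ≤ M)
    (hB : n ≤ B ∨ θ < acc + ε * (B + 1)) :
    Runs inp Proc.greedyRun (vl [.real ε, .real θ, encTree v, encItem c, .nat n, encItem p,
      .real acc, encTree s]) (encOption (greedyRun ε θ v c n p acc s)) (200 * lam M * (B + 1)) := by
  have hpos : 0 < 200 * lam M * (B + 1) := by have := three_le_lam M; positivity
  cases n with
  | zero => simpa [Proc.greedyRun, greedyRun, encOption] using hpos
  | succ n =>
    by_cases h₁ : p.tag = 0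
    · simpa [Proc.greedyRun, greedyRun, encOption, h₁] using hpos
    by_cases h₂ : θ < acc + ε
    · simpa [Proc.greedyRun, greedyRun, encOption, h₁, h₂] using hpos
    -- The run goes on, so the budget cannot be exhausted: for `B = 0` both alternatives of `hB`
    -- fail.
    obtain ⟨B, rfl⟩ : ∃ B', B = B' + 1 := by
      refine Nat.exists_eq_succ_of_ne_zero ?_
      rintro rfl
      simp [h₂] at hB
    simp [-lt_sup_iff, -ite_eq_left_iff, Proc.greedyRun, greedyRun, h₁, h₂]
    refine wp_call_of (.maxHiBefore p v hv) ?_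
    simp [-lt_sup_iff, -ite_eq_left_iff]
    refine wp_call_of (.nextPt _ v hv) ?_
    have hB' : n ≤ B ∨ θ < acc + ε + ε * (B + 1) := by
      rcases hB with hB | hB
      · left; omega
      · right; push_cast at hB; linarith
    have hsz := hs.size_eq
    -- The summand `200 * lam M` pays for this step, that is for two searches, at most one join and
    -- some comparisons.
    have e : 200 * lam M * (B + 1 + 1) = 200 * lam M * (B + 1) + 200 * lam M := by ring
    by_cases h₃ : p < max c (maxHiBefore p v)
    · rw [if_pos h₃, if_pos h₃]
      set m := max c (maxHiBefore p v)
      have hs' : Ok plain (join plain s (leaf m)) := ok_join hs (.inr trivial)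
      have hsz' : (join plain s (leaf m)).size = s.size + 1 := by
        rw [hs'.size_eq, toList_join, hsz]; simp [toList]
      refine wp_call_join_plain hs (.inr trivial) ?_
      refine wp_call_of (.greedyRun ε θ v c n _ (acc + ε) _ M B hv hM hs' (by omega) hB') ?_
      refine ⟨rfl, ?_⟩
      have := hs.h_lt (M := M) (by omega)
      rw [h_leaf, e]; omega
    · rw [if_neg h₃, if_neg h₃]
      refine wp_call_of (.greedyRun ε θ v c n _ (acc + ε) s M B hv hM hs (by omega) hB') ?_
      refine ⟨rfl, ?_⟩
      rw [e]; omega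

theorem runs_childSol (v : Tree) (c : Item) (t : Tree) (M : ℕ) (hv : Hgt v)
    (hM : v.h + 1 ≤ lam M) (ht : Hgt t) (htM : t.h + 1 ≤ lam M) (hn : t ≠ nil) :
    Runs inp Proc.childSol (vl [encTree v, encItem c, encTree t])
      (encTree (childSol (fun p => Max.max c (maxHiBefore p v)) t)) (20 * lam M) := by
  have := three_le_lam M
  by_cases h₁ : t.data.lastPt.tag = 0
  · simp [Proc.childSol, childSol, h₁]; omega
  · simp [-lt_sup_iff, -ite_eq_left_iff, Proc.childSol, childSol, h₁]
    refine wp_call_of (.nextPt _ t ht) ?_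
    refine wp_call_of (.maxHiBefore _ v hv) ?_
    simp [-lt_sup_iff, -ite_eq_left_iff]
    by_cases h₂ : t.data.lastPt < max c (maxHiBefore (nextPt bot t) v)
    · rw [if_pos h₂, if_pos h₂]; simp; omega
    · rw [if_neg h₂, if_neg h₂]
      cases t with
      | nil => exact absurd rfl hn
      | leaf x => simp [sol]; simp at htM ⊢; omega
      | node d s l r => simp [sol]; omega

theorem runs_unite (a b : Tree) (M : ℕ) (ha : Ok plain a) (hb : Ok plain b)
    (hM : a.size + b.size ≤ M) :
    Runs inp Proc.unite (vl [encTree a, encTree b]) (encTree (unite a b)) (400 * lam M) := by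
  simp [Proc.unite, unite]
  refine wp_call_delete_plain hb ?_
  obtain ⟨h1, h2, h3, -⟩ := ok_delete (x := a.data.last) hb
  refine wp_call_join_plain ha h1 ⟨rfl, ?_⟩
  have := ha.h_lt (M := M) (by omega)
  have := hb.h_lt (M := M) (by omega)
  omega

theorem runs_mk (ε θ : ℝ) (l r : Tree) (M B : ℕ) (hl : Bal (annot ε θ) l)
    (hr : Bal (annot ε θ) r) (hM : l.size + r.size ≤ M) (hB : Fit ε θ B M) :
    Runs inp Proc.mk (vl [.real ε, .real θ, encTree l, encTree r])
      (encTree (mk (annot ε θ) l r)) (mkCost θ B M) := by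
  by_cases hθ : θ < 0
  · rw [annot_neg ε hθ, mkCost_neg hθ]
    simp [Proc.mk, hθ]
    exact wp_call_of (.mkPlain l r) (by simp)
  rw [mkCost, if_neg hθ]
  have hlh := hl.h_lt (M := M) (by omega)
  have hrh := hr.h_lt (M := M) (by omega)
  have hv : Hgt (mk plain l r) :=
    ⟨hl.hgt, hr.hgt, Nat.lt_succ_of_le (le_max_left _ _), Nat.lt_succ_of_le (le_max_right _ _)⟩
  have hvM : (mk plain l r).h + 1 ≤ lam M := by rw [h_mk]; omega
  have hB' : (mk plain l r).size ≤ B ∨ θ < 0 + ε * (B + 1) := by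
    rcases hB with hB | hB | hB
    · exact absurd hB hθ
    · exact .inl (hM.trans hB)
    · right; linarith
  -- The greedy run needs only one of the ten copies of its bound; `2000 * lam M` pays for the
  -- searches, the solutions of the children and their union.
  have e : 2000 * lam M * (B + 2) = 10 * (200 * lam M * (B + 1)) + 2000 * lam M := by ring
  have hval : mk (annot ε θ) l r = node (dataOf l r) (summary ε θ l r) l r := by
    rw [mk, annot, if_neg hθ]
  rw [hval, e]
  generalize hX : 200 * lam M * (B + 1) = X
  simp [Proc.mk, hθ]
  refine wp_call_of (.mkPlain l r) ?_
  simp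
  refine wp_call_of (.lastEntering _ _ hv) ?_
  simp
  refine wp_call_of (.nextPt _ _ hv) ?_
  simp
  have hg := Spec.greedyRun (inp := inp) ε θ (mk plain l r) (lastEntering l.data.first (mk plain l r))
    (mk plain l r).size (nextPt bot (mk plain l r)) 0 nil M B hv hvM (.inl rfl)
    (by rw [show (nil : Tree).size = 0 from rfl, zero_add]; exact hM) hB'
  rw [hX] at hg
  refine wp_call_of hg ?_
  unfold summary
  cases hs : greedyRun ε θ (mk plain l r) (lastEntering l.data.first (mk plain l r))
    (mk plain l r).size (nextPt bot (mk plain l r)) 0 nil with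
  | some s =>
    simp [encOption, encTree]
    rw [h_mk] at hvM
    omega
  | none =>
    simp [encOption]
    refine wp_call_of (.childSol _ _ l M hv hvM hl.hgt (by omega) hl.ne_nil) ?_
    refine wp_call_of (.childSol _ _ r M hv hvM hr.hgt (by omega) hr.ne_nil) ?_
    have hls := ok_childSol (g := fun p => max (lastEntering l.data.first (mk plain l r))
      (maxHiBefore p (mk plain l r))) hl.ok_sol
    have hrs := ok_childSol (g := fun p => max (lastEntering l.data.first (mk plain l r))
      (maxHiBefore p (mk plain l r))) hr.ok_sol
    refine wp_call_of (.unite _ _ M hls hrs ?_) ?_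
    · rw [hls.size_eq, hrs.size_eq]
      exact (Nat.add_le_add (length_childSol_le hl hl.length_sol_le)
        (length_childSol_le hr hr.length_sol_le)).trans hM
    · simp [encTree]
      refine ⟨rfl, ?_⟩
      rw [h_mk] at hvM
      omega

end DynCover
end

noncomputable section

namespace DynCover

open Item (bot top)
open DynCover.Tree

variable {inp : Input} {Q : Val → ℕ → Prop}

@[simp] theorem Tree.h_node (d : Data) (s l r : Tree) : (node d s l r).h = d.h := rfl

/-! ### Verification of rotations and joins -/

theorem runs_balR (ε θ : ℝ) (a t : Tree) (M B : ℕ) (ha : Bal (annot ε θ) a)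
    (ht : Bal (annot ε θ) t) (h₁ : t.h ≤ a.h + 2) (h₂ : a.h ≤ t.h + 1) (hM : a.size + t.size ≤ M)
    (hB : Fit ε θ B M) :
    Runs inp Proc.balR (vl [.real ε, .real θ, encTree a, encTree t])
      (encTree (balR (annot ε θ) a t)) (3 * mkCost θ B M + 2) := by
  generalize hT : 3 * mkCost θ B M + 2 = T
  cases t with
  | nil => exact ht.elim
  | leaf x =>
    simp [Proc.balR, balR]
    exact wp_call_of (.mk ε θ a _ M B ha ht hM hB) ⟨rfl, by omega⟩
  | node e s c d =>
    by_cases h5 : e.h ≤ a.h + 1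
    · rw [show balR (annot ε θ) a (node e s c d) = mk (annot ε θ) a (node e s c d) by
        simp [balR, h5]]
      simp [Proc.balR, not_lt.2 h5]
      exact wp_call_of (.mk ε θ a _ M B ha ht hM hB) ⟨rfl, by omega⟩
    obtain ⟨hc, hd, he, hs, h₃, h₄⟩ := ht
    have heh : e.h = max c.h d.h + 1 := by rw [he]; rfl
    have hsz : (node e s c d).size = c.size + d.size := by rw [he]; rfl
    rw [h_node] at h₁ h₂
    by_cases h6 : c.h ≤ d.h
    · rw [show balR (annot ε θ) a (node e s c d) = mk (annot ε θ) (mk (annot ε θ) a c) d by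
        simp [balR, h5, h6]]
      simp [Proc.balR, not_le.1 h5, not_lt.2 h6]
      refine wp_call_of (.mk ε θ a c M B ha hc (by omega) hB) ?_
      refine wp_call_of (.mk ε θ _ d M B (ha.mk hc (by omega) (by omega)) hd ?_ hB)
        ⟨rfl, by omega⟩
      change a.size + c.size + d.size ≤ M
      omega
    · cases c with
      | nil => exact hc.elim
      | leaf => simp at h6
      | node e' s' c₁ c₂ =>
        rw [h_node] at *
        rw [show balR (annot ε θ) a (node e s (node e' s' c₁ c₂) d) =
          mk (annot ε θ) (mk (annot ε θ) a c₁) (mk (annot ε θ) c₂ d) by simp [balR, h5, h6]]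
        simp [Proc.balR, not_le.1 h5, not_le.1 h6]
        obtain ⟨hc₁, hc₂, he', hs', h₅, h₆⟩ := hc
        have heh' : e'.h = max c₁.h c₂.h + 1 := by rw [he']; rfl
        have hsz' : (node e' s' c₁ c₂).size = c₁.size + c₂.size := by rw [he']; rfl
        refine wp_call_of (.mk ε θ a c₁ M B ha hc₁ (by omega) hB) ?_
        refine wp_call_of (.mk ε θ c₂ d M B hc₂ hd (by omega) hB) ?_
        refine wp_call_of (.mk ε θ _ _ M B (ha.mk hc₁ (by omega) (by omega))
          (hc₂.mk hd (by omega) (by omega)) ?_ hB) ⟨rfl, by omega⟩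
        change a.size + c₁.size + (c₂.size + d.size) ≤ M
        omega

theorem runs_balL (ε θ : ℝ) (a t : Tree) (M B : ℕ) (ha : Bal (annot ε θ) a)
    (ht : Bal (annot ε θ) t) (h₁ : t.h ≤ a.h + 2) (h₂ : a.h ≤ t.h + 1) (hM : a.size + t.size ≤ M)
    (hB : Fit ε θ B M) :
    Runs inp Proc.balL (vl [.real ε, .real θ, encTree a, encTree t])
      (encTree (balL (annot ε θ) a t)) (3 * mkCost θ B M + 2) := by
  generalize hT : 3 * mkCost θ B M + 2 = T
  cases t with
  | nil => exact ht.elim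
  | leaf x =>
    simp [Proc.balL, balL]
    exact wp_call_of (.mk ε θ _ a M B ht ha (by omega) hB) ⟨rfl, by omega⟩
  | node e s c d =>
    by_cases h5 : e.h ≤ a.h + 1
    · rw [show balL (annot ε θ) a (node e s c d) = mk (annot ε θ) (node e s c d) a by
        simp [balL, h5]]
      simp [Proc.balL, not_lt.2 h5]
      exact wp_call_of (.mk ε θ _ a M B ht ha (by omega) hB) ⟨rfl, by omega⟩
    obtain ⟨hc, hd, he, hs, h₃, h₄⟩ := ht
    have heh : e.h = max c.h d.h + 1 := by rw [he]; rfl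
    have hsz : (node e s c d).size = c.size + d.size := by rw [he]; rfl
    rw [h_node] at h₁ h₂
    by_cases h6 : d.h ≤ c.h
    · rw [show balL (annot ε θ) a (node e s c d) = mk (annot ε θ) c (mk (annot ε θ) d a) by
        simp [balL, h5, h6]]
      simp [Proc.balL, not_le.1 h5, not_lt.2 h6]
      refine wp_call_of (.mk ε θ d a M B hd ha (by omega) hB) ?_
      refine wp_call_of (.mk ε θ c _ M B hc (hd.mk ha (by omega) (by omega)) ?_ hB)
        ⟨rfl, by omega⟩
      change c.size + (d.size + a.size) ≤ M
      omega
    · cases d with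
      | nil => exact hd.elim
      | leaf => simp at h6
      | node e' s' d₁ d₂ =>
        rw [h_node] at *
        rw [show balL (annot ε θ) a (node e s c (node e' s' d₁ d₂)) =
          mk (annot ε θ) (mk (annot ε θ) c d₁) (mk (annot ε θ) d₂ a) by simp [balL, h5, h6]]
        simp [Proc.balL, not_le.1 h5, not_le.1 h6]
        obtain ⟨hd₁, hd₂, he', hs', h₅, h₆⟩ := hd
        have heh' : e'.h = max d₁.h d₂.h + 1 := by rw [he']; rfl
        have hsz' : (node e' s' d₁ d₂).size = d₁.size + d₂.size := by rw [he']; rfl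
        refine wp_call_of (.mk ε θ c d₁ M B hc hd₁ (by omega) hB) ?_
        refine wp_call_of (.mk ε θ d₂ a M B hd₂ ha (by omega) hB) ?_
        refine wp_call_of (.mk ε θ _ _ M B (hc.mk hd₁ (by omega) (by omega))
          (hd₂.mk ha (by omega) (by omega)) ?_ hB) ⟨rfl, by omega⟩
        change c.size + d₁.size + (d₂.size + a.size) ≤ M
        omega

theorem size_joinR {f : Tree → Tree → Tree} {r t : Tree} (hr : Bal f r) (ht : Bal f t)
    (h : r.h ≤ t.h + 1) : (joinR f r t).size = t.size + r.size := by
  rw [(bal_joinR hr ht h).1.size_eq, toList_joinR, hr.size_eq, ht.size_eq, List.length_append]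

theorem size_joinL {f : Tree → Tree → Tree} {l t : Tree} (hl : Bal f l) (ht : Bal f t)
    (h : l.h ≤ t.h + 1) : (joinL f l t).size = l.size + t.size := by
  rw [(bal_joinL hl ht h).1.size_eq, toList_joinL, hl.size_eq, ht.size_eq, List.length_append]

/-- The descent ends at a subtree that is at most one higher than `r`, and each level on the way
needs one rotation; so the cost is governed by the difference of the heights. -/
theorem runs_joinR (ε θ : ℝ) (r t : Tree) (M B : ℕ) (hr : Bal (annot ε θ) r)
    (ht : Bal (annot ε θ) t) (h₁ : r.h ≤ t.h + 1) (hM : r.size + t.size ≤ M)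
    (hB : Fit ε θ B M) :
    Runs inp Proc.joinR (vl [.real ε, .real θ, encTree r, encTree t])
      (encTree (joinR (annot ε θ) r t)) ((t.h - r.h + 1) * (3 * mkCost θ B M + 5)) := by
  have hX : 3 * mkCost θ B M + 5 ≤ (t.h - r.h + 1) * (3 * mkCost θ B M + 5) :=
    Nat.le_mul_of_pos_left _ (by omega)
  cases t with
  | nil => exact ht.elim
  | leaf x =>
    simp only [Proc.joinR, joinR]
    simp
    refine wp_call_of (.mk ε θ _ r M B ht hr (by omega) hB) ⟨rfl, ?_⟩
    simp at hX ⊢; omega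
  | node e s c d =>
    rw [h_node] at h₁ hX ⊢
    generalize hT : (e.h - r.h + 1) * (3 * mkCost θ B M + 5) = T at hX ⊢
    by_cases h5 : e.h ≤ r.h + 1
    · simp [Proc.joinR, joinR, h5, not_lt.2 h5]
      exact wp_call_of (.mk ε θ _ r M B ht hr (by omega) hB) ⟨rfl, by omega⟩
    obtain ⟨hc, hd, he, hs, h₃, h₄⟩ := ht
    have heh : e.h = max c.h d.h + 1 := by rw [he]; rfl
    have hsz : (node e s c d).size = c.size + d.size := by rw [he]; rfl
    simp [Proc.joinR, joinR, h5, not_le.1 h5]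
    obtain ⟨i1, i2, i3, -⟩ := bal_joinR hr hd (by omega)
    refine wp_call_of (.joinR ε θ r d M B hr hd (by omega) (by omega) hB) ?_
    refine wp_call_of (.balR ε θ c _ M B hc i1 (by omega) (by omega) ?_ hB) ⟨rfl, ?_⟩
    · rw [size_joinR hr hd (by omega)]; omega
    · obtain ⟨k, hk⟩ : ∃ k, e.h - r.h + 1 = k + 1 ∧
        d.h - r.h + 1 ≤ k := ⟨_, rfl, by omega⟩
      have := Nat.mul_le_mul_right (3 * mkCost θ B M + 5) hk.2
      rw [hk.1, add_mul k] at hT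
      omega

theorem runs_joinL (ε θ : ℝ) (l t : Tree) (M B : ℕ) (hl : Bal (annot ε θ) l)
    (ht : Bal (annot ε θ) t) (h₁ : l.h ≤ t.h + 1) (hM : l.size + t.size ≤ M)
    (hB : Fit ε θ B M) :
    Runs inp Proc.joinL (vl [.real ε, .real θ, encTree l, encTree t])
      (encTree (joinL (annot ε θ) l t)) ((t.h - l.h + 1) * (3 * mkCost θ B M + 5)) := by
  have hX : 3 * mkCost θ B M + 5 ≤ (t.h - l.h + 1) * (3 * mkCost θ B M + 5) :=
    Nat.le_mul_of_pos_left _ (by omega)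
  cases t with
  | nil => exact ht.elim
  | leaf x =>
    simp only [Proc.joinL, joinL]
    simp
    refine wp_call_of (.mk ε θ l _ M B hl ht (by omega) hB) ⟨rfl, ?_⟩
    simp at hX ⊢; omega
  | node e s c d =>
    rw [h_node] at h₁ hX ⊢
    generalize hT : (e.h - l.h + 1) * (3 * mkCost θ B M + 5) = T at hX ⊢
    by_cases h5 : e.h ≤ l.h + 1
    · simp [Proc.joinL, joinL, h5, not_lt.2 h5]
      exact wp_call_of (.mk ε θ l _ M B hl ht (by omega) hB) ⟨rfl, by omega⟩
    obtain ⟨hc, hd, he, hs, h₃, h₄⟩ := ht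
    have heh : e.h = max c.h d.h + 1 := by rw [he]; rfl
    have hsz : (node e s c d).size = c.size + d.size := by rw [he]; rfl
    simp [Proc.joinL, joinL, h5, not_le.1 h5]
    obtain ⟨i1, i2, i3, -⟩ := bal_joinL hl hc (by omega)
    refine wp_call_of (.joinL ε θ l c M B hl hc (by omega) (by omega) hB) ?_
    refine wp_call_of (.balL ε θ d _ M B hd i1 (by omega) (by omega) ?_ hB) ⟨rfl, ?_⟩
    · rw [size_joinL hl hc (by omega)]; omega
    · obtain ⟨k, hk⟩ : ∃ k, e.h - l.h + 1 = k + 1 ∧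
        c.h - l.h + 1 ≤ k := ⟨_, rfl, by omega⟩
      have := Nat.mul_le_mul_right (3 * mkCost θ B M + 5) hk.2
      rw [hk.1, add_mul k] at hT
      omega

theorem join_eq {f : Tree → Tree → Tree} {l r : Tree} (hl : l ≠ nil) (hr : r ≠ nil) :
    join f l r = if l.h < r.h then joinL f l r else joinR f r l := by
  unfold join
  split
  · exact absurd rfl hl
  · exact absurd rfl hr
  · rfl

theorem ctor_ne_zero {t : Tree} (h : t ≠ nil) : t.ctor ≠ 0 := by
  cases t <;> simp_all

theorem runs_join (ε θ : ℝ) (l r : Tree) (M B : ℕ) (hl : Ok (annot ε θ) l)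
    (hr : Ok (annot ε θ) r) (hM : l.size + r.size ≤ M) (hB : Fit ε θ B M) :
    Runs inp Proc.join (vl [.real ε, .real θ, encTree l, encTree r])
      (encTree (join (annot ε θ) l r))
      ((l.h - r.h + (r.h - l.h) + 1) * (3 * mkCost θ B M + 5) + 2) := by
  by_cases hln : l = nil
  · subst hln; simp [Proc.join, join_nil_left]
  by_cases hrn : r = nil
  · subst hrn; simp [Proc.join, join_nil_right, ctor_ne_zero hln]
  have hl := hl.bal hln
  have hr := hr.bal hrn
  rw [join_eq hln hrn]
  generalize hT : (l.h - r.h + (r.h - l.h) + 1) * (3 * mkCost θ B M + 5) + 2 = T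
  by_cases h : l.h < r.h
  · simp [Proc.join, h, ctor_ne_zero hln, ctor_ne_zero hrn]
    refine wp_call_of (.joinL ε θ l r M B hl hr (by omega) (by omega) hB) ⟨rfl, ?_⟩
    rw [show l.h - r.h + (r.h - l.h) + 1 = r.h - l.h + 1 by omega] at hT
    omega
  · simp [Proc.join, h, ctor_ne_zero hln, ctor_ne_zero hrn]
    refine wp_call_of (.joinR ε θ r l M B hr hl (by omega) (by omega) hB) ⟨rfl, ?_⟩
    rw [show l.h - r.h + (r.h - l.h) + 1 = l.h - r.h + 1 by omega] at hT
    omega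

theorem size_insert_le {f : Tree → Tree → Tree} (x : Item) {t : Tree} (ht : Ok f t) :
    (insert f x t).size ≤ t.size + 1 := by
  rw [(bal_insert (x := x) ht).1.size_eq, ht.size_eq]
  exact length_insert_le x t

theorem size_delete_le {f : Tree → Tree → Tree} (x : Item) {t : Tree} (ht : Ok f t) :
    (delete f x t).size ≤ t.size := by
  rw [(ok_delete (x := x) ht).1.size_eq, ht.size_eq]
  exact (delete_sublist x t).length_le

end DynCover
end

noncomputable section

namespace DynCover

open Item (bot top)
open DynCover.Tree

variable {inp : Input} {Q : Val → ℕ → Prop}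

/-! ### Verification of edits, rebuilding, output and loading -/

theorem Tree.Ok.node {f : Tree → Tree → Tree} {d : Data} {s l r : Tree}
    (h : Ok f (node d s l r)) : Bal f l ∧ Bal f r ∧ d.h = max l.h r.h + 1 ∧
      (node d s l r).size = l.size + r.size ∧ l.h ≤ r.h + 1 ∧ r.h ≤ l.h + 1 := by
  obtain ⟨hl, hr, he, hs, h₁, h₂⟩ := h.bal (by simp)
  exact ⟨hl, hr, by rw [he]; rfl, by rw [he]; rfl, h₁, h₂⟩

/-- After an edit in one subtree the heights of the siblings differ by at most two, so `m ≤ 2`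
levels of joining suffice. Here `X` is the cost of a new node. -/
theorem join_cost_le {m k X : ℕ} (h : m ≤ 2) (hk : k ≤ 12) :
    (m + 1) * (3 * X + 5) + 2 + k < 9 * X + 30 := by
  have := Nat.mul_le_mul_right (3 * X + 5) (show m + 1 ≤ 3 by omega)
  omega

theorem runs_insert (ε θ : ℝ) (x : Item) (t : Tree) (M B : ℕ) (ht : Ok (annot ε θ) t)
    (hM : t.size + 1 ≤ M) (hB : Fit ε θ B M) :
    Runs inp Proc.insert (vl [.real ε, .real θ, encItem x, encTree t])
      (encTree (insert (annot ε θ) x t)) ((t.h + 1) * (9 * mkCost θ B M + 30)) := by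
  cases t with
  | nil => simp [Proc.insert, Tree.insert]
  | leaf y =>
    generalize hT : ((leaf y).h + 1) * (9 * mkCost θ B M + 30) = T
    rw [h_leaf] at hT
    by_cases h₁ : x < y
    · simp [Proc.insert, Tree.insert, h₁, data]
      exact wp_call_of (.mk ε θ (leaf x) (leaf y) M B trivial trivial hM hB) ⟨rfl, by omega⟩
    by_cases h₂ : y < x
    · simp [Proc.insert, Tree.insert, h₁, h₂, data]
      exact wp_call_of (.mk ε θ (leaf y) (leaf x) M B trivial trivial hM hB) ⟨rfl, by omega⟩
    · simp [Proc.insert, Tree.insert, h₁, h₂, data]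
      omega
  | node d s l r =>
    obtain ⟨hl, hr, hd, hsz, h₁, h₂⟩ := ht.node
    rw [h_node]
    have e : (d.h + 1) * (9 * mkCost θ B M + 30) = d.h * (9 * mkCost θ B M + 30) +
      (9 * mkCost θ B M + 30) := by ring
    generalize hT : (d.h + 1) * (9 * mkCost θ B M + 30) = T at e ⊢
    by_cases hx : x < r.data.first
    · simp [Proc.insert, Tree.insert, hx]
      refine wp_call_of (.insert ε θ x l M B hl.ok (by omega) hB) ?_
      obtain ⟨i1, i2, i3⟩ := bal_insert (x := x) hl.ok
      refine wp_call_of (.join ε θ _ r M B i1.ok hr.ok ?_ hB) ⟨rfl, ?_⟩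
      · have := size_insert_le (f := annot ε θ) x hl.ok
        omega
      · have := Nat.mul_le_mul_right (9 * mkCost θ B M + 30) (show l.h + 1 ≤ d.h by omega)
        have := join_cost_le (X := mkCost θ B M) (k := 1)
          (show (insert (annot ε θ) x l).h - r.h + (r.h - (insert (annot ε θ) x l).h) ≤ 2 by omega)
          (by omega)
        omega
    · simp [Proc.insert, Tree.insert, hx]
      refine wp_call_of (.insert ε θ x r M B hr.ok (by omega) hB) ?_
      obtain ⟨i1, i2, i3⟩ := bal_insert (x := x) hr.ok
      refine wp_call_of (.join ε θ l _ M B hl.ok i1.ok ?_ hB) ⟨rfl, ?_⟩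
      · have := size_insert_le (f := annot ε θ) x hr.ok
        omega
      · have := Nat.mul_le_mul_right (9 * mkCost θ B M + 30) (show r.h + 1 ≤ d.h by omega)
        have := join_cost_le (X := mkCost θ B M) (k := 1)
          (show l.h - (insert (annot ε θ) x r).h + ((insert (annot ε θ) x r).h - l.h) ≤ 2 by omega)
          (by omega)
        omega

theorem runs_delete (ε θ : ℝ) (x : Item) (t : Tree) (M B : ℕ) (ht : Ok (annot ε θ) t)
    (hM : t.size ≤ M) (hB : Fit ε θ B M) :
    Runs inp Proc.delete (vl [.real ε, .real θ, encItem x, encTree t])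
      (encTree (delete (annot ε θ) x t)) ((t.h + 1) * (9 * mkCost θ B M + 30)) := by
  cases t with
  | nil => simp [Proc.delete, delete]
  | leaf y =>
    generalize hT : ((leaf y).h + 1) * (9 * mkCost θ B M + 30) = T
    rw [h_leaf] at hT
    by_cases h₁ : x < y
    · simp [Proc.delete, delete, h₁, data]
      omega
    by_cases h₂ : y < x
    · simp [Proc.delete, delete, h₁, h₂, data]
      omega
    · simp [Proc.delete, delete, h₁, h₂, data]
      omega
  | node d s l r =>
    obtain ⟨hl, hr, hd, hsz, h₁, h₂⟩ := ht.node
    rw [h_node]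
    have e : (d.h + 1) * (9 * mkCost θ B M + 30) = d.h * (9 * mkCost θ B M + 30) +
      (9 * mkCost θ B M + 30) := by ring
    generalize hT : (d.h + 1) * (9 * mkCost θ B M + 30) = T at e ⊢
    by_cases hx : x < r.data.first
    · simp [Proc.delete, delete, hx]
      refine wp_call_of (.delete ε θ x l M B hl.ok (by omega) hB) ?_
      obtain ⟨i1, i2, i3, -⟩ := ok_delete (x := x) hl.ok
      refine wp_call_of (.join ε θ _ r M B i1 hr.ok ?_ hB) ⟨rfl, ?_⟩
      · have := size_delete_le (f := annot ε θ) x hl.ok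
        omega
      · have := Nat.mul_le_mul_right (9 * mkCost θ B M + 30) (show l.h + 1 ≤ d.h by omega)
        have := join_cost_le (X := mkCost θ B M) (k := 1)
          (show (delete (annot ε θ) x l).h - r.h + (r.h - (delete (annot ε θ) x l).h) ≤ 2 by omega)
          (by omega)
        omega
    · simp [Proc.delete, delete, hx]
      refine wp_call_of (.delete ε θ x r M B hr.ok (by omega) hB) ?_
      obtain ⟨i1, i2, i3, -⟩ := ok_delete (x := x) hr.ok
      refine wp_call_of (.join ε θ l _ M B hl.ok i1 ?_ hB) ⟨rfl, ?_⟩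
      · have := size_delete_le (f := annot ε θ) x hr.ok
        omega
      · have := Nat.mul_le_mul_right (9 * mkCost θ B M + 30) (show r.h + 1 ≤ d.h by omega)
        have := join_cost_le (X := mkCost θ B M) (k := 1)
          (show l.h - (delete (annot ε θ) x r).h + ((delete (annot ε θ) x r).h - l.h) ≤ 2 by omega)
          (by omega)
        omega

open Classical in
theorem runs_mem (x : Item) (t : Tree) (ht : Hgt t) :
    Runs inp Proc.mem (vl [encItem x, encTree t]) (.nat (if Mem x t then 1 else 0))
      (3 * (t.h + 1)) := by
  cases t with
  | nil => simp [Proc.mem, Mem]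
  | leaf y =>
    by_cases h₁ : x < y
    · simp [Proc.mem, Mem, h₁, data]
    by_cases h₂ : y < x <;> simp [Proc.mem, Mem, h₁, h₂, data]
  | node d s l r =>
    obtain ⟨hl, hr, hlh, hrh⟩ := ht
    rw [h_node]
    generalize hT : 3 * (d.h + 1) = T
    by_cases hx : x < r.data.first
    · simp [Proc.mem, Mem, hx]
      exact wp_call_of (.mem x l hl) ⟨rfl, by omega⟩
    · simp [Proc.mem, Mem, hx]
      exact wp_call_of (.mem x r hr) ⟨rfl, by omega⟩

theorem rebuild_spec {f f' : Tree → Tree → Tree} {t : Tree} (ht : Bal f t) :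
    Bal f' (rebuild f' t) ∧ (rebuild f' t).h = t.h ∧ (rebuild f' t).toList = t.toList := by
  induction t with
  | nil => exact ht.elim
  | leaf x => exact ⟨trivial, rfl, rfl⟩
  | node d s l r _ ihl ihr =>
    obtain ⟨hl, hr, rfl, -, h₁, h₂⟩ := ht
    obtain ⟨i1, i2, i3⟩ := ihl hl
    obtain ⟨j1, j2, j3⟩ := ihr hr
    refine ⟨i1.mk j1 (by omega) (by omega), ?_, ?_⟩
    · rw [rebuild, h_mk, i2, j2]; rfl
    · rw [rebuild, toList_mk, i3, j3]; rfl

theorem Tree.Bal.size_rebuild {f f' : Tree → Tree → Tree} {t : Tree} (ht : Bal f t) :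
    (rebuild f' t).size = t.size := by
  obtain ⟨h1, -, h3⟩ := rebuild_spec (f' := f') ht
  rw [h1.size_eq, h3, ht.size_eq]

theorem Tree.Bal.size_pos {f : Tree → Tree → Tree} {t : Tree} (ht : Bal f t) : 0 < t.size := by
  rw [ht.size_eq]
  exact List.length_pos_iff.2 ht.toList_ne_nil

/-- A node over `a + b` items makes at most that many greedy steps, so `B` and `M` are taken to be
this size and `ε` disappears from the bound. On each level the sizes add up to at most `t.size`,
which leaves one factor `t.h + 1`. -/
theorem runs_rebuild (ε θ : ℝ) (t : Tree) (M : ℕ) (f : Tree → Tree → Tree) (ht : Ok f t)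
    (hθ : 0 ≤ θ) (hM : t.size ≤ M) :
    Runs inp Proc.rebuild (vl [.real ε, .real θ, encTree t]) (encTree (rebuild (annot ε θ) t))
      ((t.h + 1) * (7000 * lam M * t.size) + 1) := by
  cases t with
  | nil => simp [Proc.rebuild, rebuild]
  | leaf y => simp [Proc.rebuild, rebuild]
  | node d s l r =>
    obtain ⟨hl, hr, hd, hsz, h₁, h₂⟩ := ht.node
    generalize hT : ((node d s l r).h + 1) * (7000 * lam M * (node d s l r).size) + 1 = T
    rw [hsz] at hT hM
    simp [Proc.rebuild, rebuild]
    refine wp_call_of (.rebuild ε θ l M f hl.ok hθ (by omega)) ?_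
    refine wp_call_of (.rebuild ε θ r M f hr.ok hθ (by omega)) ?_
    refine wp_call_of (.mk ε θ _ _ (l.size + r.size) (l.size + r.size) (rebuild_spec hl).1
      (rebuild_spec hr).1 (by rw [hl.size_rebuild, hr.size_rebuild]) (.inr (.inl le_rfl)))
      ⟨rfl, ?_⟩
    rw [mkCost, if_neg (not_lt.2 hθ), ← hT, h_node]
    have p1 := hl.size_pos
    have p2 := hr.size_pos
    have hlam := lam_mono hM
    have hlam3 := three_le_lam M
    generalize l.size = a at *
    generalize r.size = b at *
    generalize lam M = L at *
    have e1 : (l.h + 1) * (7000 * L * a) ≤ d.h * (7000 * L * a) :=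
      Nat.mul_le_mul_right _ (by omega)
    have e2 : (r.h + 1) * (7000 * L * b) ≤ d.h * (7000 * L * b) :=
      Nat.mul_le_mul_right _ (by omega)
    have e3 : 2000 * lam (a + b) * (a + b + 2) ≤ 4000 * L * (a + b) :=
      calc _ ≤ 2000 * L * (2 * (a + b)) := by gcongr; omega
        _ = _ := by ring
    have e4 : (d.h + 1) * (7000 * L * (a + b)) = d.h * (7000 * L * a) + d.h * (7000 * L * b) +
      4000 * L * (a + b) + 3000 * (L * (a + b)) := by ring
    have e5 : 3 * 1 ≤ L * (a + b) := Nat.mul_le_mul hlam3 (by omega)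
    omega

/-- A binary tree with `t.size` leaves has `2 * t.size - 1` nodes, and each is visited once; the
accumulator avoids concatenations. -/
theorem runs_flat (f : Tree → Tree → Tree) (t : Tree) (l : List (ℝ × ℝ)) (ht : Bal f t) :
    Runs inp Proc.flat (vl [encTree t, encOut l])
      (encOut (t.toList.map (fun x => (x.oth, x.crd)) ++ l)) (2 * t.size - 1) := by
  cases t with
  | nil => exact ht.elim
  | leaf x => simp [Proc.flat, toList, encOut, encItem, data, size]
  | node d s a b =>
    obtain ⟨hl, hr, hd, hsz, h₁, h₂⟩ := ht.ok.node
    have p1 := hl.size_pos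
    have p2 := hr.size_pos
    rw [hsz]
    simp [Proc.flat]
    refine wp_call_of (.flat f b l hr) ?_
    refine wp_call_of (.flat f a _ hl) ⟨?_, by omega⟩
    simp [toList]

theorem runs_theta (n : ℕ) : Runs inp Proc.theta (vl [.nat n]) (.real (4 * n + 12)) (n + 1) := by
  cases n with
  | zero => simp [Proc.theta]
  | succ n =>
    simp [Proc.theta]
    refine wp_call_of (.theta n) ?_
    simp
    ring

theorem runs_loadPoints (n i : ℕ) (t : Tree) (M : ℕ) (ht : Ok plain t) (hi : i + n ≤ inp.len)
    (hM : t.size + n ≤ M) :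
    Runs inp Proc.loadPoints (vl [.nat n, .nat i, encTree t]) (encTree (loadPoints inp n i t))
      (n * (220 * lam M) + 1) := by
  cases n with
  | zero => simp [Proc.loadPoints, loadPoints]
  | succ n =>
    generalize hT : (n + 1) * (220 * lam M) + 1 = T
    simp [Proc.loadPoints, loadPoints, Proc.insertPlain, Prog.itemP]
    refine ⟨by omega, ?_⟩
    refine wp_call_insert_plain (x := ⟨1, inp.val i, 1, 0⟩) ht ?_
    obtain ⟨i1, i2, i3⟩ := bal_insert (x := ⟨1, inp.val i, 1, 0⟩) ht
    have := size_insert_le (f := plain) ⟨1, inp.val i, 1, 0⟩ ht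
    refine wp_call_of (.loadPoints n (i + 1) _ M i1.ok (by omega) (by omega)) ⟨rfl, ?_⟩
    have := ht.h_lt (M := M) (by omega)
    rw [add_mul n] at hT
    omega

theorem runs_loadIntervals (n i : ℕ) (t : Tree) (M : ℕ) (ht : Ok plain t)
    (hi : i + 2 * n ≤ inp.len) (hM : t.size + 2 * n ≤ M) :
    Runs inp Proc.loadIntervals (vl [.nat n, .nat i, encTree t])
      (encTree (loadIntervals inp n i t)) (n * (440 * lam M) + 1) := by
  cases n with
  | zero => simp [Proc.loadIntervals, loadIntervals]
  | succ n =>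
    generalize hT : (n + 1) * (440 * lam M) + 1 = T
    simp [Proc.loadIntervals, loadIntervals, Proc.insertPlain, Prog.itemP]
    refine ⟨by omega, by omega, by omega, ?_⟩
    refine wp_call_insert_plain (x := ⟨1, inp.val (i + 1), 2, inp.val i⟩) ht ?_
    obtain ⟨i1, i2, i3⟩ := bal_insert (x := ⟨1, inp.val (i + 1), 2, inp.val i⟩) ht
    have h1 := size_insert_le (f := plain) ⟨1, inp.val (i + 1), 2, inp.val i⟩ ht
    refine wp_call_insert_plain (x := ⟨1, inp.val i, 0, inp.val (i + 1)⟩) i1.ok ?_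
    obtain ⟨j1, j2, j3⟩ := bal_insert (x := ⟨1, inp.val i, 0, inp.val (i + 1)⟩) i1.ok
    have h2 := size_insert_le (f := plain) ⟨1, inp.val i, 0, inp.val (i + 1)⟩ i1.ok
    refine wp_call_of (.loadIntervals n (i + 1 + 1) _ M j1.ok (by omega) (by omega)) ⟨rfl, ?_⟩
    have := ht.h_lt (M := M) (by omega)
    have := i1.h_lt (M := M) (by omega)
    rw [add_mul n] at hT
    omega

theorem meets (inp : Input) : Meets bodies (Spec inp) inp := by
  intro i x v t h
  cases h with
  | lt x y => exact ⟨_, rfl, runs_lt x y⟩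
  | max x y => exact ⟨_, rfl, runs_max x y⟩
  | min x y => exact ⟨_, rfl, runs_min x y⟩
  | leaf x => exact ⟨_, rfl, runs_leaf x⟩
  | mkPlain l r => exact ⟨_, rfl, runs_mkPlain l r⟩
  | maxHiBefore p t ht => exact ⟨_, rfl, runs_maxHiBefore p t ht⟩
  | lastEntering s t ht => exact ⟨_, rfl, runs_lastEntering s t ht⟩
  | nextPt k t ht => exact ⟨_, rfl, runs_nextPt k t ht⟩
  | greedyRun ε θ v c n p acc s M B hv hM hs hn hB =>
    exact ⟨_, rfl, runs_greedyRun ε θ v c n p acc s M B hv hM hs hn hB⟩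
  | childSol v c t M hv hM ht htM hn => exact ⟨_, rfl, runs_childSol v c t M hv hM ht htM hn⟩
  | unite a b M ha hb hM => exact ⟨_, rfl, runs_unite a b M ha hb hM⟩
  | mk ε θ l r M B hl hr hM hB => exact ⟨_, rfl, runs_mk ε θ l r M B hl hr hM hB⟩
  | balR ε θ a t M B ha ht h₁ h₂ hM hB =>
    exact ⟨_, rfl, runs_balR ε θ a t M B ha ht h₁ h₂ hM hB⟩
  | balL ε θ a t M B ha ht h₁ h₂ hM hB =>
    exact ⟨_, rfl, runs_balL ε θ a t M B ha ht h₁ h₂ hM hB⟩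
  | joinR ε θ r t M B hr ht h₁ hM hB => exact ⟨_, rfl, runs_joinR ε θ r t M B hr ht h₁ hM hB⟩
  | joinL ε θ l t M B hl ht h₁ hM hB => exact ⟨_, rfl, runs_joinL ε θ l t M B hl ht h₁ hM hB⟩
  | join ε θ l r M B hl hr hM hB => exact ⟨_, rfl, runs_join ε θ l r M B hl hr hM hB⟩
  | insert ε θ x t M B ht hM hB => exact ⟨_, rfl, runs_insert ε θ x t M B ht hM hB⟩
  | delete ε θ x t M B ht hM hB => exact ⟨_, rfl, runs_delete ε θ x t M B ht hM hB⟩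
  | mem x t ht => exact ⟨_, rfl, runs_mem x t ht⟩
  | rebuild ε θ t M f ht hθ hM => exact ⟨_, rfl, runs_rebuild ε θ t M f ht hθ hM⟩
  | flat f t l ht => exact ⟨_, rfl, runs_flat f t l ht⟩
  | theta n => exact ⟨_, rfl, runs_theta n⟩
  | loadPoints n i t M ht hi hM => exact ⟨_, rfl, runs_loadPoints n i t M ht hi hM⟩
  | loadIntervals n i t M ht hi hM => exact ⟨_, rfl, runs_loadIntervals n i t M ht hi hM⟩

end DynCover
end

noncomputable section

namespace DynCover

open Item (bot top)
open DynCover.Tree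

/-! ## The maintained state -/

/-- `base` is the size at the last rebuilding. `cnt` is a countdown that starts at `base` and loses
`4` per update; an update changes the size by at most `2`, so the size stays within constant factors
of `base`. -/
structure Glob where
  t : Tree
  ε : ℝ
  θ : ℝ
  cnt : ℕ
  base : ℕ

namespace Glob

abbrev f (g : Glob) : Tree → Tree → Tree := annot g.ε g.θ

/-- Recompute everything, with a bound on the greedy algorithm that suits the height. -/
def renew (ε : ℝ) (t : Tree) : Glob :=
  ⟨rebuild (annot ε (4 * t.h + 12)) t, ε, 4 * t.h + 12, t.size, t.size⟩

/-- Replace the tree, and recompute everything if there have been many updates. -/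
def finish (g : Glob) (t : Tree) : Glob :=
  if 4 < g.cnt then { g with t := t, cnt := g.cnt - 4 } else renew g.ε t

/-- The tree after the insertion or deletion of items. -/
def edit (g : Glob) : Update → Tree
  | .insertPoint x => insert g.f (Item.pt x) g.t
  | .deletePoint x => delete g.f (Item.pt x) g.t
  | .insertInterval I => insert g.f (Item.lo I) (insert g.f (Item.hi I) g.t)
  | .deleteInterval I => delete g.f (Item.lo I) (delete g.f (Item.hi I) g.t)

def update (g : Glob) (u : Update) : Glob := g.finish (g.edit u)

end Glob

/-- The items of an instance. -/
def Inst.items (X : Inst) : Set Item :=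
  {x | (∃ p ∈ X.points, x = Item.pt p) ∨ ∃ I ∈ X.intervals, x = Item.lo I ∨ x = Item.hi I}

/-- The tree `t` is a correctly annotated search tree for the set `V`. -/
structure Stores (f : Tree → Tree → Tree) (V : Set Item) (t : Tree) : Prop where
  ok : Ok f t
  sorted : t.Sorted
  mem : ∀ x, x ∈ t.toList ↔ x ∈ V

/-! ### Instances and their items -/

namespace Item

theorem pt_injective : Function.Injective pt := fun _ _ h => congrArg Item.crd h

theorem lo_injective : Function.Injective lo := fun _ _ h =>
  NonemptyInterval.ext (Prod.ext (congrArg Item.crd h) (congrArg Item.oth h))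

theorem hi_injective : Function.Injective hi := fun _ _ h =>
  NonemptyInterval.ext (Prod.ext (congrArg Item.oth h) (congrArg Item.crd h))

theorem toLo_hi (I : NonemptyInterval ℝ) : (hi I).toLo = lo I := rfl

theorem lo_ne_pt (I : NonemptyInterval ℝ) (p : ℝ) : lo I ≠ pt p := fun h =>
  absurd (congrArg Item.kind h) (by simp [lo, pt])

theorem hi_ne_pt (I : NonemptyInterval ℝ) (p : ℝ) : hi I ≠ pt p := fun h =>
  absurd (congrArg Item.kind h) (by simp [hi, pt])

theorem lo_ne_hi (I J : NonemptyInterval ℝ) : lo I ≠ hi J := fun h =>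
  absurd (congrArg Item.kind h) (by simp [hi, lo])

/-- The weak inequalities of closed intervals become strict because of the order of the kinds at
equal coordinates. -/
theorem covers_iff (I : NonemptyInterval ℝ) (p : ℝ) :
    Covers (hi I) (pt p) ↔ I.fst ≤ p ∧ p ≤ I.snd := by
  rw [Covers, toLo_hi]
  simp [lt_def, hi, lo, pt, le_iff_lt_or_eq]

end Item

theorem Inst.pt_mem_items {X : Inst} {p : ℝ} : Item.pt p ∈ X.items ↔ p ∈ X.points := by
  constructor
  · rintro (⟨q, hq, h⟩ | ⟨I, -, h | h⟩)
    · rwa [Item.pt_injective h]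
    · exact absurd h.symm (Item.lo_ne_pt I p)
    · exact absurd h.symm (Item.hi_ne_pt I p)
  · exact fun h => .inl ⟨p, h, rfl⟩

theorem Inst.lo_mem_items {X : Inst} {I : NonemptyInterval ℝ} :
    Item.lo I ∈ X.items ↔ I ∈ X.intervals := by
  constructor
  · rintro (⟨q, hq, h⟩ | ⟨J, hJ, h | h⟩)
    · exact absurd h (Item.lo_ne_pt I q)
    · rwa [Item.lo_injective h]
    · exact absurd h (Item.lo_ne_hi I J)
  · exact fun h => .inr ⟨I, h, .inl rfl⟩

theorem Inst.hi_mem_items {X : Inst} {I : NonemptyInterval ℝ} :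
    Item.hi I ∈ X.items ↔ I ∈ X.intervals := by
  constructor
  · rintro (⟨q, hq, h⟩ | ⟨J, hJ, h | h⟩)
    · exact absurd h (Item.hi_ne_pt I q)
    · exact absurd h.symm (Item.lo_ne_hi J I)
    · rwa [Item.hi_injective h]
  · exact fun h => .inr ⟨I, h, .inr rfl⟩

theorem Inst.exists_of_mem_items {X : Inst} {e : Item} (he : e ∈ X.items) (hk : e.kind = 2) :
    ∃ I ∈ X.intervals, e = Item.hi I := by
  rcases he with ⟨p, -, rfl⟩ | ⟨I, hI, rfl | rfl⟩
  · simp [Item.pt] at hk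
  · simp [Item.lo] at hk
  · exact ⟨I, hI, rfl⟩

theorem Inst.exists_of_mem_items' {X : Inst} {e : Item} (he : e ∈ X.items) (hk : e.kind = 0) :
    ∃ I ∈ X.intervals, e = Item.lo I := by
  rcases he with ⟨p, -, rfl⟩ | ⟨I, hI, rfl | rfl⟩
  · simp [Item.pt] at hk
  · exact ⟨I, hI, rfl⟩
  · simp [Item.hi] at hk

theorem Inst.exists_of_toLo_mem {X : Inst} {e : Item} (h1 : e.tag = 1) (h2 : e.kind = 2)
    (he : e.toLo ∈ X.items) : ∃ I ∈ X.intervals, e = Item.hi I := by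
  obtain ⟨I, hI, h⟩ := Inst.exists_of_mem_items' he (by simp [Item.toLo, h2])
  refine ⟨I, hI, ?_⟩
  rw [← Item.toHi_toLo h1 h2, h]
  simp [Item.toHi, Item.lo, Item.hi]

namespace Stores

variable {f : Tree → Tree → Tree} {X : Inst} {t : Tree}

/-- The whole sequence contains both endpoints of every interval, so the order conditions in
`Segment` are not even needed at the root. -/
theorem segment (h : Stores f X.items t) : Segment t.toList := by
  refine ⟨fun x hx => ?_, fun e h1 h2 h3 _ => ?_, fun e h1 h2 h3 _ => ?_⟩
  · rcases (h.mem x).1 hx with ⟨p, -, rfl⟩ | ⟨I, -, rfl | rfl⟩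
    · exact ⟨rfl, by simp [Item.pt], by simp [Item.pt]⟩
    · exact ⟨rfl, fun _ => I.fst_le_snd, by simp [Item.lo]⟩
    · exact ⟨rfl, by simp [Item.hi], fun _ => I.fst_le_snd⟩
  · obtain ⟨I, hI, rfl⟩ := Inst.exists_of_toLo_mem h1 h2 ((h.mem _).1 h3)
    exact (h.mem _).2 (Inst.hi_mem_items.2 hI)
  · obtain ⟨I, hI, rfl⟩ := Inst.exists_of_mem_items ((h.mem _).1 h3) h2
    exact (h.mem _).2 (Inst.lo_mem_items.2 hI)

theorem exists_of_mem_ivs (h : Stores f X.items t) {e : Item} (he : e ∈ ivs t.toList) :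
    ∃ I ∈ X.intervals, e = Item.hi I := by
  obtain ⟨h1, h2, h3 | h3⟩ := he
  · exact Inst.exists_of_mem_items ((h.mem _).1 h3) h2
  · exact Inst.exists_of_toLo_mem h1 h2 ((h.mem _).1 h3)

theorem hi_mem_ivs (h : Stores f X.items t) {I : NonemptyInterval ℝ} (hI : I ∈ X.intervals) :
    Item.hi I ∈ ivs t.toList :=
  ⟨rfl, rfl, .inl ((h.mem _).2 (Inst.hi_mem_items.2 hI))⟩

theorem mem_pts (h : Stores f X.items t) {x : Item} : x ∈ t.pts ↔ ∃ p ∈ X.points, x = Item.pt p := by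
  rw [Tree.mem_pts, h.mem]
  constructor
  · rintro ⟨⟨p, hp, rfl⟩ | ⟨I, hI, rfl | rfl⟩, hk⟩
    · exact ⟨p, hp, rfl⟩
    · simp [Item.lo] at hk
    · simp [Item.hi] at hk
  · rintro ⟨p, hp, rfl⟩
    exact ⟨.inl ⟨p, hp, rfl⟩, rfl⟩

open Classical in
theorem size_le (h : Stores f X.items t) : t.size ≤ 2 * X.size := by
  have hnd : t.toList.Nodup := h.sorted.imp fun hab => hab.ne
  rw [h.ok.size_eq, ← List.toFinset_card_of_nodup hnd]
  have hsub : t.toList.toFinset ⊆ X.points.image Item.pt ∪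
      (X.intervals.image Item.lo ∪ X.intervals.image Item.hi) := by
    intro x hx
    simp only [Finset.mem_union, Finset.mem_image]
    rcases (h.mem x).1 (List.mem_toFinset.1 hx) with ⟨p, hp, rfl⟩ | ⟨I, hI, rfl | rfl⟩
    · exact .inl ⟨p, hp, rfl⟩
    · exact .inr (.inl ⟨I, hI, rfl⟩)
    · exact .inr (.inr ⟨I, hI, rfl⟩)
  refine (Finset.card_le_card hsub).trans ((Finset.card_union_le _ _).trans ?_)
  have h1 := Finset.card_image_le (s := X.points) (f := Item.pt)
  have h2 := Finset.card_image_le (s := X.intervals) (f := Item.lo)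
  have h3 := Finset.card_image_le (s := X.intervals) (f := Item.hi)
  have h4 := Finset.card_union_le (X.intervals.image Item.lo) (X.intervals.image Item.hi)
  unfold Inst.size
  omega

theorem insert {V : Set Item} (h : Stores f V t) (x : Item) :
    Stores f (Insert.insert x V) (insert f x t) := by
  obtain ⟨h1, h2⟩ := insert_spec x h.ok h.sorted
  exact ⟨(bal_insert h.ok).1.ok, h1, fun y => by rw [h2, Set.mem_insert_iff, h.mem]⟩

theorem delete {V : Set Item} (h : Stores f V t) (x : Item) :
    Stores f (V \ {x}) (delete f x t) := by
  refine ⟨(ok_delete h.ok).1, List.Pairwise.sublist (delete_sublist x t) h.sorted, fun y => ?_⟩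
  rw [mem_delete x h.ok h.sorted, h.mem, Set.mem_sdiff, Set.mem_singleton_iff, and_comm]

theorem rebuild {V : Set Item} (h : Stores f V t) (f' : Tree → Tree → Tree) :
    Stores f' V (rebuild f' t) ∧ (rebuild f' t).h = t.h ∧ (rebuild f' t).size = t.size := by
  rcases h.ok with rfl | hb
  · exact ⟨⟨.inl rfl, h.sorted, h.mem⟩, rfl, rfl⟩
  · obtain ⟨h1, h2, h3⟩ := rebuild_spec (f' := f') hb
    exact ⟨⟨h1.ok, by rw [Sorted, h3]; exact h.sorted, fun x => by rw [h3]; exact h.mem x⟩, h2,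
      hb.size_rebuild⟩

end Stores

theorem Inst.items_apply (X : Inst) (u : Update) : (X.apply u).items = match u with
    | .insertPoint x => Insert.insert (Item.pt x) X.items
    | .deletePoint x => X.items \ {Item.pt x}
    | .insertInterval I => Insert.insert (Item.lo I) (Insert.insert (Item.hi I) X.items)
    | .deleteInterval I => (X.items \ {Item.hi I}) \ {Item.lo I} := by
  ext e
  cases u with
  | insertPoint x =>
    simp only [items, Inst.apply, Finset.mem_insert, Set.mem_ofPred_eq, Set.mem_insert_iff,
      or_and_right, exists_or, exists_eq_left, or_assoc]
  | deletePoint x =>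
    simp only [items, Inst.apply, Finset.mem_erase, Set.mem_ofPred_eq, Set.mem_sdiff,
      Set.mem_singleton_iff]
    constructor
    · rintro (⟨p, ⟨hp, hp'⟩, rfl⟩ | ⟨I, hI, rfl | rfl⟩)
      · exact ⟨.inl ⟨p, hp', rfl⟩, fun h => hp (Item.pt_injective h)⟩
      · exact ⟨.inr ⟨I, hI, .inl rfl⟩, Item.lo_ne_pt I x⟩
      · exact ⟨.inr ⟨I, hI, .inr rfl⟩, Item.hi_ne_pt I x⟩
    · rintro ⟨⟨p, hp, rfl⟩ | h, hne⟩
      · exact .inl ⟨p, ⟨fun h => hne (by rw [h]), hp⟩, rfl⟩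
      · exact .inr h
  | insertInterval I =>
    simp only [items, Inst.apply, Finset.mem_insert, Set.mem_ofPred_eq, Set.mem_insert_iff,
      or_and_right, exists_or, exists_eq_left, or_assoc]
    rw [or_left_comm, or_congr_right or_left_comm]
  | deleteInterval I =>
    simp only [items, Inst.apply, Finset.mem_erase, Set.mem_ofPred_eq, Set.mem_sdiff,
      Set.mem_singleton_iff]
    constructor
    · rintro (⟨p, hp, rfl⟩ | ⟨J, ⟨hne, hJ⟩, rfl | rfl⟩)
      · exact ⟨⟨.inl ⟨p, hp, rfl⟩, (Item.hi_ne_pt I p).symm⟩, (Item.lo_ne_pt I p).symm⟩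
      · exact ⟨⟨.inr ⟨J, hJ, .inl rfl⟩, Item.lo_ne_hi J I⟩, fun h => hne (Item.lo_injective h)⟩
      · exact ⟨⟨.inr ⟨J, hJ, .inr rfl⟩, fun h => hne (Item.hi_injective h)⟩,
          (Item.lo_ne_hi I J).symm⟩
    · rintro ⟨⟨h | ⟨J, hJ, rfl | rfl⟩, h1⟩, h2⟩
      · exact .inl h
      · exact .inr ⟨J, ⟨fun h => h2 (by rw [h]), hJ⟩, .inl rfl⟩
      · exact .inr ⟨J, ⟨fun h => h1 (by rw [h]), hJ⟩, .inr rfl⟩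

namespace Glob

/-- The state belongs to the instance `X`. -/
structure Inv (X : Inst) (g : Glob) : Prop where
  stores : Stores g.f X.items g.t
  eps : 0 < g.ε ∧ g.ε ≤ 1
  -- `h₀` is the height at the last rebuilding.
  bound : ∃ h₀ : ℕ, g.θ = 4 * h₀ + 12 ∧ h₀ + 2 ≤ lam g.base ∧ g.base ≤ 2 ^ h₀
  le : g.cnt ≤ g.base
  -- In this and the next bound an update changes `2 * g.t.size` by at most `4`, which the decrease
  -- of `g.cnt` compensates.
  lower : g.base + g.cnt ≤ 2 * g.t.size
  upper : 2 * g.t.size + g.cnt ≤ 3 * g.base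

theorem inv_renew {f : Tree → Tree → Tree} {X : Inst} {ε : ℝ} {t : Tree}
    (h : Stores f X.items t) (hε : 0 < ε ∧ ε ≤ 1) : (renew ε t).Inv X := by
  obtain ⟨h1, h2, h3⟩ := h.rebuild (annot ε (4 * t.h + 12))
  refine ⟨h1, hε, ⟨t.h, rfl, h.ok.h_lt le_rfl, ?_⟩, le_rfl, ?_, ?_⟩
  · rcases h.ok with rfl | hb
    · simp [renew, size, data]
    · exact hb.two_pow_le.2
  · change t.size + t.size ≤ 2 * (rebuild _ t).size
    omega
  · change 2 * (rebuild _ t).size + t.size ≤ 3 * t.size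
    omega

/-- Between the two halves of an interval update the tree holds a single endpoint. This does no
harm: `Stores` requires annotations to be computed as prescribed, not that the items form a
`Segment`. -/
theorem stores_edit {X : Inst} {g : Glob} (h : Stores g.f X.items g.t) (u : Update) :
    Stores g.f (X.apply u).items (g.edit u) ∧ (g.edit u).size ≤ g.t.size + 2 ∧
      g.t.size ≤ (g.edit u).size + 2 := by
  have hi (t : Tree) (V : Set Item) (h : Stores g.f V t) (x : Item) :
      (Tree.insert g.f x t).size ≤ t.size + 1 ∧ t.size ≤ (Tree.insert g.f x t).size := by
    refine ⟨size_insert_le x h.ok, ?_⟩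
    rw [(h.insert x).ok.size_eq, h.ok.size_eq]
    exact (List.subperm_of_subset (h.sorted.imp fun hab => hab.ne)
      fun y hy => ((h.insert x).mem y).2 (.inr ((h.mem y).1 hy))).length_le
  have hd (t : Tree) (V : Set Item) (h : Stores g.f V t) (x : Item) :
      (Tree.delete g.f x t).size ≤ t.size ∧ t.size ≤ (Tree.delete g.f x t).size + 1 := by
    refine ⟨size_delete_le x h.ok, ?_⟩
    rw [(h.delete x).ok.size_eq, h.ok.size_eq]
    have := (List.subperm_of_subset (l₂ := x :: (Tree.delete g.f x t).toList)
      (h.sorted.imp fun hab => hab.ne) fun y hy => by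
        by_cases hyx : y = x
        · simp [hyx]
        · exact List.mem_cons_of_mem _ (((h.delete x).mem y).2 ⟨(h.mem y).1 hy, hyx⟩)).length_le
    simpa using this
  rw [Inst.items_apply]
  cases u with
  | insertPoint x =>
    have := hi _ _ h (Item.pt x)
    exact ⟨h.insert _, by simp only [edit]; omega, by simp only [edit]; omega⟩
  | deletePoint x =>
    have := hd _ _ h (Item.pt x)
    exact ⟨h.delete _, by simp only [edit]; omega, by simp only [edit]; omega⟩
  | insertInterval I =>
    have := hi _ _ h (Item.hi I)
    have := hi _ _ (h.insert (Item.hi I)) (Item.lo I)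
    exact ⟨(h.insert _).insert _, by simp only [edit]; omega, by simp only [edit]; omega⟩
  | deleteInterval I =>
    have := hd _ _ h (Item.hi I)
    have := hd _ _ (h.delete (Item.hi I)) (Item.lo I)
    exact ⟨(h.delete _).delete _, by simp only [edit]; omega, by simp only [edit]; omega⟩

theorem Inv.update {X : Inst} {g : Glob} (h : g.Inv X) (u : Update) :
    (g.update u).Inv (X.apply u) := by
  obtain ⟨h1, h2, h3⟩ := stores_edit h.stores u
  unfold Glob.update finish
  split_ifs with hc
  · have := h.le
    have := h.lower
    have := h.upper
    refine ⟨h1, h.eps, h.bound, ?_, ?_, ?_⟩ <;> simp only <;> omega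
  · exact inv_renew h1 h.eps

/-- Until the next rebuilding the size is at most `3 / 2 * g.base ≤ 2 ^ (h₀ + 1)`, hence the height
is at most `2 * h₀ + 2`. So the fixed `θ = 4 * h₀ + 12`, with `H = 2 * h₀ + 6`, stays valid. -/
theorem Inv.height {X : Inst} {g : Glob} (h : g.Inv X) :
    ∃ H : ℝ, 0 < H ∧ g.θ = 2 * H ∧ g.t.h ≤ H := by
  obtain ⟨h₀, h1, -, h2⟩ := h.bound
  refine ⟨2 * h₀ + 6, by positivity, by rw [h1]; ring, ?_⟩
  rcases h.stores.ok with hn | hb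
  · rw [hn, h_nil]; push_cast; positivity
  have h3 := hb.two_pow_le.1
  have h4 := h.upper
  have h5 : g.t.size ≤ 2 ^ (h₀ + 1) := by rw [pow_succ]; omega
  have h6 : 2 ^ g.t.h ≤ 2 ^ ((h₀ + 1) * 2) := by
    rw [pow_mul]
    exact h3.trans (Nat.pow_le_pow_left h5 2)
  have := (Nat.pow_le_pow_iff_right (by simp : 1 < 2)).1 h6
  have h7 : g.t.h ≤ 2 * h₀ + 6 := by omega
  exact_mod_cast h7

theorem Inv.solves {X : Inst} {g : Glob} (h : g.Inv X) (hn : g.t ≠ nil) :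
    ∃ H : ℝ, 0 < H ∧ Best (ivs g.t.toList) g.t.pts (reach g.t) ∧
      Solves (H * (1 + g.ε)) H (reach g.t) g.t.pts g.t.sol.toList := by
  obtain ⟨H, hH, hθ, hh⟩ := h.height
  have hb := h.stores.ok.bal hn
  have hseg := h.stores.segment
  rw [Glob.f, hθ] at hb
  have hs := sol_solves h.eps.1 h.eps.2 hb h.stores.sorted hseg hh
  refine ⟨H, hH, best_reach hb h.stores.sorted hseg, hs.sorted, hs.mem, hs.covers,
    fun hF => (hs.card hF).trans ?_⟩
  gcongr
  nlinarith [h.eps.1]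

open Classical in
/-- The set of intervals that is stored at the root. -/
def solution (X : Inst) (g : Glob) : Finset (NonemptyInterval ℝ) :=
  X.intervals.filter fun I => Item.hi I ∈ g.t.sol.toList

theorem Inv.sorted_sol {X : Inst} {g : Glob} (h : g.Inv X) :
    g.t.sol.Sorted ∧ Ok plain g.t.sol ∧ g.t.sol.size = (g.solution X).card ∧
      ∀ e ∈ g.t.sol.toList, ∃ I ∈ X.intervals, e = Item.hi I := by
  classical
  have h0 : Ok plain g.t.sol := by
    rcases h.stores.ok with hn | hb
    · rw [hn]; exact .inl rfl
    · exact hb.ok_sol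
  have key : g.t.sol.Sorted ∧ ∀ e ∈ g.t.sol.toList, ∃ I ∈ X.intervals, e = Item.hi I := by
    by_cases hn : g.t = nil
    · rw [hn]; simp [Sorted, sol, toList]
    obtain ⟨H, -, hbest, hs⟩ := h.solves hn
    refine ⟨hs.sorted, fun e he => ?_⟩
    obtain ⟨p, hp, rfl, hlt⟩ := hs.mem e he
    exact h.stores.exists_of_mem_ivs (hbest.mem p hp hlt)
  refine ⟨key.1, h0, ?_, key.2⟩
  rw [h0.size_eq, ← List.toFinset_card_of_nodup (key.1.imp fun hab => hab.ne),
    ← Finset.card_image_of_injective _ Item.hi_injective]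
  congr 1
  ext e
  simp only [List.mem_toFinset, solution, Finset.mem_image, Finset.mem_filter]
  constructor
  · intro he
    obtain ⟨I, hI, rfl⟩ := key.2 e he
    exact ⟨I, ⟨hI, he⟩, rfl⟩
  · rintro ⟨I, ⟨-, hI⟩, rfl⟩
    exact hI

theorem Inv.approx {X : Inst} {g : Glob} (h : g.Inv X) (hX : ∃ A, X.IsCover A) :
    X.IsApproxCover (1 + g.ε) (g.solution X) := by
  classical
  obtain ⟨hsrt, -, hcard, hmem⟩ := h.sorted_sol
  by_cases hn : g.t = nil
  · have hp : ∀ p, p ∉ X.points := fun p hp => by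
      have := (h.stores.mem _).2 (Inst.pt_mem_items.2 hp)
      rw [hn] at this
      simp [toList] at this
    refine ⟨⟨Finset.filter_subset _ _, fun p hp' => absurd hp' (hp p)⟩, fun B _ => ?_⟩
    rw [← hcard, hn]
    have := h.eps.1
    simp only [sol, size, data, Nat.cast_zero]
    positivity
  obtain ⟨H, hH, hbest, hs⟩ := h.solves hn
  have hcov (A) (hA : X.IsCover A) : ∀ p ∈ g.t.pts, ∃ I ∈ A, Covers (Item.hi I) p := by
    intro p hp
    obtain ⟨x, hx, rfl⟩ := h.stores.mem_pts.1 hp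
    obtain ⟨I, hI, hIx⟩ := hA.2 x hx
    exact ⟨I, hI, (Item.covers_iff I x).2 hIx⟩
  obtain ⟨A, hA⟩ := hX
  -- The instance has a cover, so the best interval at every point contains it; this is the
  -- condition under which the stored solution covers all points.
  have hF : ∀ p ∈ g.t.pts, p < reach g.t p := by
    intro p hp
    obtain ⟨I, hI, hc⟩ := hcov A hA p hp
    exact hc.2.trans_le (hbest.le p hp _ (h.stores.hi_mem_ivs (hA.1 hI)) hc)
  refine ⟨⟨Finset.filter_subset _ _, fun x hx => ?_⟩, fun B hB => ?_⟩
  · obtain ⟨e, he, hc⟩ := hs.covers hF _ (h.stores.mem_pts.2 ⟨x, hx, rfl⟩)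
    obtain ⟨I, hI, rfl⟩ := hmem e he
    exact ⟨I, Finset.mem_filter.2 ⟨hI, he⟩, (Item.covers_iff I x).1 hc⟩
  · have h1 := hs.card hF
    have h2 : gcount (reach g.t) g.t.pts ≤ (B.image Item.hi).card := by
      refine gcount_le_card hbest (fun e he => ?_) fun p hp => ?_
      · obtain ⟨I, hI, rfl⟩ := Finset.mem_image.1 he
        exact h.stores.hi_mem_ivs (hB.1 hI)
      · obtain ⟨I, hI, hc⟩ := hcov B hB p hp
        exact ⟨_, Finset.mem_image_of_mem _ hI, hc⟩
    rw [Finset.card_image_of_injective _ Item.hi_injective] at h2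
    have h3 : (gcount (reach g.t) g.t.pts : ℝ) ≤ B.card := by exact_mod_cast h2
    have h4 : ((g.solution X).card : ℝ) = g.t.sol.toList.length := by
      rw [← hcard, h.sorted_sol.2.1.size_eq]
    rw [h4]
    have := h.eps.1
    have h5 : H * (1 + g.ε) * gcount (reach g.t) g.t.pts ≤ H * (1 + g.ε) * B.card := by gcongr
    refine le_of_mul_le_mul_right ?_ hH
    linarith

theorem Inv.mem_sol {X : Inst} {g : Glob} (h : g.Inv X) (I : NonemptyInterval ℝ) :
    Mem (Item.hi I) g.t.sol ↔ I ∈ g.solution X := by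
  classical
  obtain ⟨h1, h2, -, h3⟩ := h.sorted_sol
  rw [mem_iff _ h2 h1, solution, Finset.mem_filter]
  refine ⟨fun hI => ⟨?_, hI⟩, fun hI => hI.2⟩
  obtain ⟨J, hJ, hIJ⟩ := h3 _ hI
  rwa [Item.hi_injective hIJ]

theorem Inv.perm_sol {X : Inst} {g : Glob} (h : g.Inv X) :
    (g.t.sol.toList.map fun x => (x.oth, x.crd)).Perm
      ((g.solution X).toList.map NonemptyInterval.toProd) := by
  classical
  obtain ⟨h1, -, -, h3⟩ := h.sorted_sol
  have hp : g.t.sol.toList.Perm ((g.solution X).toList.map Item.hi) := by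
    refine (List.perm_ext_iff_of_nodup (h1.imp fun hab => hab.ne)
      ((Finset.nodup_toList _).map Item.hi_injective)).2 fun e => ?_
    simp only [List.mem_map, Finset.mem_toList, solution, Finset.mem_filter]
    constructor
    · intro he
      obtain ⟨I, hI, rfl⟩ := h3 e he
      exact ⟨I, ⟨hI, he⟩, rfl⟩
    · rintro ⟨I, ⟨-, hI⟩, rfl⟩
      exact hI
  refine (hp.map _).trans ?_
  rw [List.map_map]
  exact List.Perm.of_eq rfl

end Glob

end DynCover
end

noncomputable section

namespace DynCover

open Item (bot top)
open DynCover.Tree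

variable {inp : Input} {Q : Val → ℕ → Prop}

theorem wp_mono {S : CallSpec} {e : Prog} {x : Val} {Q' : Val → ℕ → Prop}
    (h : ∀ v t, Q v t → Q' v t) (hw : wp S inp e x Q) : wp S inp e x Q' := by
  induction e generalizing x Q Q' with
  | id | natc | realc => exact h _ _ hw
  | fst | snd =>
    cases x with
    | pair a b => exact h _ _ hw
    | _ => exact hw
  | add | sub | radd =>
    unfold wp at hw ⊢
    split at hw
    · exact h _ _ hw
    · exact hw.elim
  | peek =>
    cases x with
    | nat a => exact ⟨hw.1, h _ _ hw.2⟩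
    | _ => exact hw
  | cons f g ihf ihg => exact ihf (fun _ _ => ihg fun _ _ => h _ _) hw
  | comp f g ihf ihg => exact ihf (fun _ _ => ihg fun _ _ => h _ _) hw
  | ite k c f g ihc ihf ihg =>
    refine ihc (fun y t hy => ?_) hw
    match hp : k.sat y with
    | none => rw [hp] at hy; exact hy.elim
    | some p =>
      rw [hp] at hy
      exact ⟨fun q => ihf (fun _ _ => h _ _) (hy.1 q), fun q => ihg (fun _ _ => h _ _) (hy.2 q)⟩
  | call i =>
    obtain ⟨v, t, hs, hq⟩ := hw
    exact ⟨v, t, hs, h _ _ hq⟩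

/-! ## Programs for the operations -/

def Glob.enc (g : Glob) : List Val :=
  [encTree g.t, .real g.ε, .real g.θ, .nat g.cnt, .nat g.base]

namespace Proc

open Prog

/-! In the environment `x, y, t, ε, θ, cnt, base`. -/

def ptP : Prog := itemP 1 (arg 0) 1 (realc 0)
def loP : Prog := itemP 1 (arg 0) 0 (arg 1)
def hiP : Prog := itemP 1 (arg 1) 2 (arg 0)

/-- Insert or delete a point. -/
def editPoint (i : ℕ) : Prog := callp i [arg 3, arg 4, ptP, arg 2]

/-- Insert or delete an interval. -/
def editInterval (i : ℕ) : Prog :=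
  callp i [arg 3, arg 4, loP, callp i [arg 3, arg 4, hiP, arg 2]]

def edit : Update → Prog
  | .insertPoint _ => editPoint 17
  | .deletePoint _ => editPoint 18
  | .insertInterval _ => editInterval 17
  | .deleteInterval _ => editInterval 18

/-- The fresh state for `ε` and the tree `t`. -/
def renew (ε t : Prog) : Prog :=
  letp t (letp (comp snd ε) (letp (callp 22 [hP (arg 1)])
    (args [callp 20 [arg 1, arg 0, arg 2], arg 1, arg 0, sizeP (arg 2), sizeP (arg 2)])))

/-- In the environment `t', x, y, t, ε, θ, cnt, base`. -/
def finish : Prog :=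
  .ite .natLt (cons (natc 4) (arg 6))
    (args [arg 0, arg 4, arg 5, comp (cons (arg 6) (natc 4)) sub, arg 7])
    (renew (arg 4) (arg 0))

def update (u : Update) : Prog := letp (edit u) finish

/-- In the environment `ε, n₀, n₁`. -/
def build : Prog :=
  letp (.ite .realLt (cons (arg 0) (realc 1)) (arg 0) (realc 1))
    (renew (arg 0) (callp 24 [arg 3, arg 2, callp 23 [arg 2, natc 0, nilP]]))

def size : Prog := cases (arg 0) (natc 0) (sizeP (solP (arg 0))) (sizeP (solP (arg 0)))

def member : Prog :=
  cases (arg 2) (natc 0) (callp 19 [hiP, solP (arg 2)]) (callp 19 [hiP, solP (arg 2)])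

def outNil : Prog := cons (natc 0) (natc 0)

def flatten : Prog :=
  letp (cases (arg 0) nilP (solP (arg 0)) (solP (arg 0)))
    (cases (arg 0) outNil (callp 21 [arg 0, outNil]) (callp 21 [arg 0, outNil]))

end Proc

/-- The arguments of an update, as they are found in the real registers `0` and `1`. -/
def Update.Args : Update → ℝ → ℝ → Prop
  | .insertPoint x, a, _ | .deletePoint x, a, _ => a = x
  | .insertInterval I, a, b | .deleteInterval I, a, b => a = I.fst ∧ b = I.snd

/-! ### Costs of the operations in calls -/

theorem fit_floor {ε θ : ℝ} (hε : 0 < ε) (M : ℕ) : Fit ε θ ⌊θ / ε⌋₊ M := by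
  right; right
  have := Nat.lt_floor_add_one (θ / ε)
  rwa [div_lt_iff₀' hε] at this

theorem mkCost_bound {θ : ℝ} (B M : ℕ) (hθ : 0 ≤ θ) :
    9 * mkCost θ B M + 30 ≤ 18010 * lam M * (B + 2) := by
  rw [mkCost, if_neg (not_lt.2 hθ)]
  have : 3 * 2 ≤ lam M * (B + 2) := Nat.mul_le_mul (three_le_lam M) (by omega)
  have e1 : 2000 * lam M * (B + 2) = 2000 * (lam M * (B + 2)) := by ring
  have e2 : 18010 * lam M * (B + 2) = 18010 * (lam M * (B + 2)) := by ring
  omega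

/-- A bound for the cost of the insertion or deletion of items. -/
def editCost (ε θ : ℝ) (M : ℕ) : ℕ := 36020 * lam M ^ 2 * (⌊θ / ε⌋₊ + 2)

/-- `a` and `b` count the levels passed by the two edits of an interval update; for a point update
`b = 0`. -/
theorem edit_cost_le {ε θ : ℝ} {M a b : ℕ} (ha : a ≤ lam M) (hb : b ≤ lam M) (hθ : 0 ≤ θ) :
    a * (9 * mkCost θ ⌊θ / ε⌋₊ M + 30) + b * (9 * mkCost θ ⌊θ / ε⌋₊ M + 30) ≤ editCost ε θ M := by
  have h := mkCost_bound ⌊θ / ε⌋₊ M hθ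
  have h1 := Nat.mul_le_mul ha h
  have h2 := Nat.mul_le_mul hb h
  have e : editCost ε θ M = lam M * (18010 * lam M * (⌊θ / ε⌋₊ + 2)) +
    lam M * (18010 * lam M * (⌊θ / ε⌋₊ + 2)) := by unfold editCost; ring
  omega

theorem runs_edit {X : Inst} {g : Glob} (hg : Stores g.f X.items g.t) (hε : 0 < g.ε)
    (hθ : 0 ≤ g.θ) (u : Update) {x y : ℝ} (ha : u.Args x y) :
    wp (Spec inp) inp (Proc.edit u) (vl (.real x :: .real y :: g.enc)) fun v t =>
      v = encTree (g.edit u) ∧ t ≤ editCost g.ε g.θ (g.t.size + 2) := by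
  have hfit := fit_floor (θ := g.θ) hε (g.t.size + 2)
  have h0 := hg.ok.h_lt (M := g.t.size + 2) (by omega)
  cases u with
  | insertPoint p =>
    obtain rfl : x = p := ha
    simp [Proc.edit, Proc.editPoint, Proc.ptP, Prog.itemP, Glob.enc]
    refine wp_call_of (.insert g.ε g.θ (Item.pt x) g.t _ _ hg.ok (by omega) hfit) ⟨rfl, ?_⟩
    have := edit_cost_le (ε := g.ε) (M := g.t.size + 2) (a := g.t.h + 1) (b := 0) (by omega)
      (by omega) hθ
    omega
  | deletePoint p =>
    obtain rfl : x = p := ha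
    simp [Proc.edit, Proc.editPoint, Proc.ptP, Prog.itemP, Glob.enc]
    refine wp_call_of (.delete g.ε g.θ (Item.pt x) g.t _ _ hg.ok (by omega) hfit) ⟨rfl, ?_⟩
    have := edit_cost_le (ε := g.ε) (M := g.t.size + 2) (a := g.t.h + 1) (b := 0) (by omega)
      (by omega) hθ
    omega
  | insertInterval I =>
    obtain ⟨rfl, rfl⟩ : x = I.fst ∧ y = I.snd := ha
    simp [Proc.edit, Proc.editInterval, Proc.loP, Proc.hiP, Prog.itemP, Glob.enc]
    refine wp_call_of (.insert g.ε g.θ (Item.hi I) g.t _ _ hg.ok (by omega) hfit) ?_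
    have h1 : Ok (annot g.ε g.θ) (Tree.insert (annot g.ε g.θ) (Item.hi I) g.t) :=
      (hg.insert (Item.hi I)).ok
    have h2 := size_insert_le (f := annot g.ε g.θ) (Item.hi I) hg.ok
    refine wp_call_of (.insert g.ε g.θ (Item.lo I) _ (g.t.size + 2) _ h1 (by omega) hfit)
      ⟨rfl, ?_⟩
    have h3 := h1.h_lt (M := g.t.size + 2) (by omega)
    exact edit_cost_le (by omega) (by omega) hθ
  | deleteInterval I =>
    obtain ⟨rfl, rfl⟩ : x = I.fst ∧ y = I.snd := ha
    simp [Proc.edit, Proc.editInterval, Proc.loP, Proc.hiP, Prog.itemP, Glob.enc]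
    refine wp_call_of (.delete g.ε g.θ (Item.hi I) g.t _ _ hg.ok (by omega) hfit) ?_
    have h1 : Ok (annot g.ε g.θ) (Tree.delete (annot g.ε g.θ) (Item.hi I) g.t) :=
      (hg.delete (Item.hi I)).ok
    have h2 := size_delete_le (f := annot g.ε g.θ) (Item.hi I) hg.ok
    refine wp_call_of (.delete g.ε g.θ (Item.lo I) _ (g.t.size + 2) _ h1 (by omega) hfit)
      ⟨rfl, ?_⟩
    have h3 := h1.h_lt (M := g.t.size + 2) (by omega)
    exact edit_cost_le (by omega) (by omega) hθ

/-- A bound for the cost of recomputing everything. -/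
def renewCost (M : ℕ) : ℕ := 7001 * lam M ^ 2 * (M + 1)

/-- The hypotheses on `e` and `e'` are semantic, so the lemma serves both for `finish`, where `e'`
is a variable, and for the construction, where `e'` loads the input. -/
theorem wp_renew {f : Tree → Tree → Tree} {e e' : Prog} {env : List Val} {ε : ℝ} {t : Tree} {c M : ℕ}
    (he' : wp (Spec inp) inp e' (vl env) fun v k => v = encTree t ∧ k ≤ c)
    (he : ∀ Q, wp (Spec inp) inp e (vl env) Q ↔ Q (.real ε) 0)
    (ht : Ok f t) (hM : t.size ≤ M) :
    wp (Spec inp) inp (Proc.renew e e') (vl env) fun v k =>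
      v = vl (Glob.renew ε t).enc ∧ k ≤ c + renewCost M := by
  simp only [Proc.renew, wp_letp]
  refine wp_mono ?_ he'
  rintro v k ⟨rfl, hk⟩
  have h2 : ∀ Q, wp (Spec inp) inp (.comp .snd e) (vl (encTree t :: env)) Q ↔ Q (.real ε) 0 := by
    intro Q
    rw [vl, wp_comp, wp_snd, he]
  rw [h2]
  simp
  refine wp_call_of (.theta t.h) ?_
  refine wp_call_of (.rebuild ε _ t M f ht (by positivity) hM) ⟨rfl, ?_⟩
  have h := ht.h_lt hM
  have h3 : (t.h + 1) * (7000 * lam M * t.size) ≤ lam M * (7000 * lam M * M) := by gcongr; omega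
  have h4 : renewCost M = lam M * (7000 * lam M * M) + 7000 * (lam M * lam M) +
    lam M * lam M * (M + 1) := by unfold renewCost; ring
  have h5 : 3 * lam M ≤ lam M * lam M := Nat.mul_le_mul_right _ (three_le_lam M)
  omega

theorem runs_update {X : Inst} {g : Glob} (hg : g.Inv X) (u : Update) {x y : ℝ}
    (ha : u.Args x y) :
    wp (Spec inp) inp (Proc.update u) (vl (.real x :: .real y :: g.enc)) fun v t =>
      v = vl (g.update u).enc ∧ t ≤ editCost g.ε g.θ (g.t.size + 2) +
        if 4 < g.cnt then 0 else renewCost (g.t.size + 2) := by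
  have hθ : 0 ≤ g.θ := by
    obtain ⟨h₀, h1, -⟩ := hg.bound
    rw [h1]; positivity
  obtain ⟨hs, h1, -⟩ := Glob.stores_edit hg.stores u
  rw [Proc.update, wp_letp]
  refine wp_mono ?_ (runs_edit hg.stores hg.eps.1 hθ u ha)
  rintro v k ⟨rfl, hk⟩
  unfold Glob.update Glob.finish
  by_cases hc : 4 < g.cnt
  · simp [Proc.finish, Glob.enc, hc, hk]
  · have := wp_renew (inp := inp) (e := Prog.arg 4) (e' := Prog.arg 0)
      (env := encTree (g.edit u) :: .real x :: .real y :: g.enc)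
      (ε := g.ε) (t := g.edit u) (c := 0) (M := g.t.size + 2) (by simp) (fun Q => by
        simp [Glob.enc]) hs.ok h1
    simp only [Glob.enc] at this
    simp [Proc.finish, Glob.enc, hc]
    refine wp_mono ?_ this
    rintro v k ⟨rfl, hk⟩
    refine ⟨rfl, ?_⟩
    omega

theorem runs_size (g : Glob) :
    wp (Spec inp) inp Proc.size (vl g.enc) fun v t => v = .nat g.t.sol.size ∧ t ≤ 0 := by
  obtain ⟨t, ε, θ, cnt, base⟩ := g
  cases t <;> simp [Proc.size, Glob.enc, sol, Tree.size, data]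

open Classical in
theorem runs_member {g : Glob} (h : Ok plain g.t.sol) (I : NonemptyInterval ℝ) :
    wp (Spec inp) inp Proc.member (vl (.real I.fst :: .real I.snd :: g.enc)) fun v t =>
      v = .nat (if Mem (Item.hi I) g.t.sol then 1 else 0) ∧ t ≤ 3 * (g.t.sol.h + 1) := by
  obtain ⟨t, ε, θ, cnt, base⟩ := g
  cases t with
  | nil => simp [Proc.member, Glob.enc, sol, Mem]
  | leaf x =>
    simp [Proc.member, Glob.enc, Proc.hiP, Prog.itemP]
    exact wp_call_of (.mem (Item.hi I) nil trivial) ⟨rfl, le_rfl⟩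
  | node d s l r =>
    simp [Proc.member, Glob.enc, Proc.hiP, Prog.itemP]
    exact wp_call_of (.mem (Item.hi I) s h.hgt) ⟨rfl, le_rfl⟩

theorem runs_flatten {g : Glob} (h : Ok plain g.t.sol) :
    wp (Spec inp) inp Proc.flatten (vl g.enc) fun v t =>
      v = encOut (g.t.sol.toList.map fun x => (x.oth, x.crd)) ∧ t ≤ 2 * g.t.sol.size := by
  obtain ⟨t, ε, θ, cnt, base⟩ := g
  have key : ∀ s : Tree, Ok plain s → wp (Spec inp) inp
      (Prog.cases (Prog.arg 0) Proc.outNil (Prog.callp 21 [Prog.arg 0, Proc.outNil])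
        (Prog.callp 21 [Prog.arg 0, Proc.outNil]))
      (vl (encTree s :: Glob.enc ⟨t, ε, θ, cnt, base⟩)) fun v k =>
      v = encOut (s.toList.map fun x => (x.oth, x.crd)) ∧ k ≤ 2 * s.size := by
    intro s hs
    have e0 : Val.pair (.nat 0) (.nat 0) = encOut [] := rfl
    rcases hs with rfl | hb
    · simp [Proc.outNil, toList, encOut]
    · have := wp_call_of (inp := inp) (S := Spec inp) (Q := fun v k =>
        v = encOut (s.toList.map fun x => (x.oth, x.crd)) ∧ k ≤ 2 * s.size)
        (Spec.flat (inp := inp) _ s [] hb) (by simp)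
      cases s with
      | nil => exact hb.elim
      | leaf x => simpa [Proc.outNil, e0] using this
      | node d s l r => simpa [Proc.outNil, e0] using this
  cases t with
  | nil =>
    have := key nil (.inl rfl)
    simpa [Proc.flatten, Glob.enc, sol] using this
  | leaf x =>
    have := key nil (.inl rfl)
    simpa [Proc.flatten, Glob.enc, sol] using this
  | node d s l r =>
    have := key s h
    simp [Glob.enc] at this
    simp [Proc.flatten, Glob.enc, sol]
    convert this

end DynCover
end

noncomputable section

namespace DynCover

open Item (bot top)
open DynCover.Tree

variable {inp : Input}

/-! ### Loading the initial instance -/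

theorem Stores.nil (f : Tree → Tree → Tree) : Stores f ∅ nil :=
  ⟨.inl rfl, List.Pairwise.nil, by simp [toList]⟩

theorem loadPoints_spec {ps : List ℝ} {i : ℕ} {V : Set Item} {t : Tree}
    (hp : ∀ j (h : j < ps.length), inp.val (i + j) = ps[j]) (ht : Stores plain V t) :
    Stores plain (V ∪ {x | ∃ p ∈ ps, x = Item.pt p}) (loadPoints inp ps.length i t) ∧
      (loadPoints inp ps.length i t).size ≤ t.size + ps.length := by
  induction ps generalizing i V t with
  | nil => simpa [loadPoints] using ht
  | cons p ps ih =>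
    have h0 : inp.val i = p := hp 0 (by simp)
    obtain ⟨h1, h2⟩ := ih (i := i + 1) (t := Tree.insert plain (Item.pt p) t) (fun j hj => by
      have := hp (j + 1) (by simpa using hj)
      rw [add_right_comm, add_assoc, this]
      simp) (ht.insert _)
    have h3 := size_insert_le (f := plain) (Item.pt p) ht.ok
    have hV : V ∪ {x | ∃ q ∈ p :: ps, x = Item.pt q} =
        Insert.insert (Item.pt p) V ∪ {x | ∃ q ∈ ps, x = Item.pt q} := by
      ext x
      simp only [Set.mem_union, Set.mem_insert_iff, Set.mem_ofPred_eq, List.mem_cons,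
        exists_eq_or_imp]
      rw [or_left_comm, or_assoc]
    simp only [List.length_cons, loadPoints, h0]
    exact ⟨hV ▸ h1, h2.trans (by omega)⟩

theorem loadIntervals_spec {Is : List (NonemptyInterval ℝ)} {i : ℕ} {V : Set Item} {t : Tree}
    (hp : ∀ j (h : j < Is.length), inp.val (i + 2 * j) = Is[j].fst ∧
      inp.val (i + 2 * j + 1) = Is[j].snd) (ht : Stores plain V t) :
    Stores plain (V ∪ {x | ∃ I ∈ Is, x = Item.lo I ∨ x = Item.hi I})
      (loadIntervals inp Is.length i t) ∧
      (loadIntervals inp Is.length i t).size ≤ t.size + 2 * Is.length := by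
  induction Is generalizing i V t with
  | nil => simpa [loadIntervals] using ht
  | cons I Is ih =>
    obtain ⟨h0, h0'⟩ : inp.val i = I.fst ∧ inp.val (i + 1) = I.snd := hp 0 (by simp)
    obtain ⟨h1, h2⟩ := ih (i := i + 1 + 1)
      (t := Tree.insert plain (Item.lo I) (Tree.insert plain (Item.hi I) t)) (fun j hj => by
      have := hp (j + 1) (by simpa using hj)
      rw [show i + 1 + 1 + 2 * j = i + 2 * (j + 1) by ring]
      simpa using this) ((ht.insert _).insert _)
    have h3 := size_insert_le (f := plain) (Item.hi I) ht.ok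
    have h4 := size_insert_le (f := plain) (Item.lo I) (ht.insert (Item.hi I)).ok
    have hV : V ∪ {x | ∃ J ∈ I :: Is, x = Item.lo J ∨ x = Item.hi J} =
        Insert.insert (Item.lo I) (Insert.insert (Item.hi I) V) ∪
          {x | ∃ J ∈ Is, x = Item.lo J ∨ x = Item.hi J} := by
      ext x
      simp only [Set.mem_union, Set.mem_insert_iff, Set.mem_ofPred_eq, List.mem_cons,
        exists_eq_or_imp]
      rw [or_left_comm, ← or_assoc (b := x = Item.hi I), or_assoc (c := _ ∈ V) (b := x = Item.hi I)]
      simp only [or_assoc, or_left_comm]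
    simp only [List.length_cons, loadIntervals, h0, h0']
    exact ⟨hV ▸ h1, h2.trans (by omega)⟩

/-- The contents of the real memory at the beginning. -/
def inputOf (ps : List ℝ) (Is : List (NonemptyInterval ℝ)) : Input :=
  ⟨fun a => (ps ++ Is.flatMap fun I => [I.fst, I.snd]).getD a 0, ps.length + 2 * Is.length⟩

theorem getD_flatMap (Is : List (NonemptyInterval ℝ)) (j : ℕ) (h : j < Is.length) :
    (Is.flatMap fun I => [I.fst, I.snd]).getD (2 * j) 0 = Is[j].fst ∧
      (Is.flatMap fun I => [I.fst, I.snd]).getD (2 * j + 1) 0 = Is[j].snd := by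
  induction Is generalizing j with
  | nil => simp at h
  | cons I Is ih =>
    cases j with
    | zero => simp
    | succ j =>
      have := ih j (by simpa using h)
      rw [show 2 * (j + 1) = 2 * j + 1 + 1 by ring]
      simpa using this

/-- The tree that holds the initial instance, without annotations. -/
def loadTree (ps : List ℝ) (Is : List (NonemptyInterval ℝ)) : Tree :=
  loadIntervals (inputOf ps Is) Is.length ps.length
    (loadPoints (inputOf ps Is) ps.length 0 nil)

theorem loadTree_spec (ps : List ℝ) (Is : List (NonemptyInterval ℝ)) :
    Stores plain (Inst.ofLists ps Is).items (loadTree ps Is) ∧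
      (loadTree ps Is).size ≤ ps.length + 2 * Is.length ∧
      Ok plain (loadPoints (inputOf ps Is) ps.length 0 nil) ∧
      (loadPoints (inputOf ps Is) ps.length 0 nil).size ≤ ps.length := by
  classical
  obtain ⟨h1, h2⟩ := loadPoints_spec (inp := inputOf ps Is) (ps := ps) (i := 0) (fun j hj => by
    simp [inputOf, List.getElem?_append_left hj, hj]) (Stores.nil plain)
  rw [show (nil : Tree).size = 0 from rfl, zero_add] at h2
  obtain ⟨h3, h4⟩ := loadIntervals_spec (inp := inputOf ps Is) (Is := Is) (i := ps.length)
    (fun j hj => by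
      have := getD_flatMap Is j hj
      simpa [inputOf, add_assoc, List.getElem?_append_right] using this) h1
  have hV : (Inst.ofLists ps Is).items = (∅ ∪ {x | ∃ p ∈ ps, x = Item.pt p}) ∪
      {x | ∃ I ∈ Is, x = Item.lo I ∨ x = Item.hi I} := by
    ext x
    simp [Inst.items, Inst.ofLists]
  exact ⟨hV ▸ h3, h4.trans (by omega), h1.ok, h2⟩

/-- The state after the construction. -/
def Glob.init (ε : ℝ) (ps : List ℝ) (Is : List (NonemptyInterval ℝ)) : Glob :=
  .renew (min ε 1) (loadTree ps Is)

theorem Glob.inv_init {ε : ℝ} (hε : 0 < ε) (ps : List ℝ) (Is : List (NonemptyInterval ℝ)) :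
    (Glob.init ε ps Is).Inv (Inst.ofLists ps Is) :=
  inv_renew (loadTree_spec ps Is).1 ⟨lt_min hε one_pos, min_le_right _ _⟩

/-- One `renewCost` pays for the insertions into a plain tree and one for annotating it. Annotating
only at the end keeps `ε` out of the construction time. -/
theorem runs_build (ε : ℝ) (ps : List ℝ) (Is : List (NonemptyInterval ℝ)) :
    wp (Spec (inputOf ps Is)) (inputOf ps Is) Proc.build
      (vl [.real ε, .nat ps.length, .nat Is.length]) fun v t =>
      v = vl (Glob.init ε ps Is).enc ∧ t ≤ 2 * renewCost (ps.length + 2 * Is.length) := by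
  obtain ⟨h1, h2, h3, h4⟩ := loadTree_spec ps Is
  set M := ps.length + 2 * Is.length with hM
  have hload : wp (Spec (inputOf ps Is)) (inputOf ps Is)
      (Prog.callp 24 [Prog.arg 3, Prog.arg 2, Prog.callp 23 [Prog.arg 2, .natc 0, Prog.nilP]])
      (vl [.real (min ε 1), .real ε, .nat ps.length, .nat Is.length]) fun v k =>
      v = encTree (loadTree ps Is) ∧ k ≤ renewCost M := by
    simp
    refine wp_call_of (.loadPoints ps.length 0 nil M (.inl rfl) ?_ ?_) ?_
    · change 0 + ps.length ≤ ps.length + 2 * Is.length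
      omega
    · change 0 + ps.length ≤ M
      omega
    · refine wp_call_of (.loadIntervals Is.length ps.length _ M h3 le_rfl (by omega)) ⟨rfl, ?_⟩
      have e1 : ps.length * (220 * lam M) + Is.length * (440 * lam M) = 220 * (lam M * M) := by
        rw [hM]; ring
      have e2 : renewCost M = 7001 * (lam M * (lam M * M)) + 7001 * (lam M * lam M) := by
        unfold renewCost; ring
      have e3 : 1 * (lam M * M) ≤ lam M * (lam M * M) :=
        Nat.mul_le_mul_right _ ((by omega : 1 ≤ 3).trans (three_le_lam M))
      have e4 : 3 * 3 ≤ lam M * lam M := Nat.mul_le_mul (three_le_lam M) (three_le_lam M)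
      omega
  have := wp_renew (e := Prog.arg 0) (ε := min ε 1) hload (fun Q => by simp) h1.ok h2
  rw [← two_mul] at this
  by_cases hε : ε < 1
  · rw [min_eq_left hε.le] at this
    simp [Proc.build, hε, Glob.init, min_eq_left hε.le]
    exact this
  · rw [min_eq_right (not_lt.1 hε)] at this
    simp [Proc.build, hε, Glob.init, min_eq_right (not_lt.1 hε)]
    exact this

end DynCover
end

noncomputable section

namespace DynCover

open Item (bot top)
open DynCover.Tree

variable {inp : Input}

/-! ## The machine program

Register `9` holds the address of the encoded state of the data structure. -/

/-- The machine state `s` holds the value `v`. -/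
structure State.Holds (s : State) (inp : Input) (v : Val) : Prop where
  input : s.HasInput inp
  root : Rep s v (s.nreg 9)

theorem State.Holds.ext {s s' : State} {v : Val} (h : s.Holds inp v) (e : Ext s s') :
    s'.Holds inp v :=
  ⟨h.input.ext e, e.regs 9 le_rfl ▸ h.root.ext e⟩

theorem State.Holds.congr {s s' : State} {v : Val} (h : s.Holds inp v)
    (h4 : s'.nreg 4 = s.nreg 4) (h9 : s'.nreg 9 = s.nreg 9) (hn : s'.nmem = s.nmem)
    (hr : s'.rmem = s.rmem) : s'.Holds inp v :=
  ⟨⟨h4 ▸ h.input.1, fun n hn => hr ▸ h.input.2 n hn⟩,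
    h9 ▸ h.root.mono h4.ge (fun _ _ => hn ▸ rfl) fun _ _ => hr ▸ rfl⟩

theorem State.Holds.load {s : State} {v : Val} (h : s.Holds inp v) (op : Op) :
    (s.load op).Holds inp v := by
  rcases op with (_ | _ | _ | _) | (_ | _ | _) <;> exact h.congr rfl rfl rfl rfl

theorem State.load_out (s : State) (op : Op) : (s.load op).out = [] := by
  rcases op with (_ | _ | _ | _) | (_ | _ | _) <;> rfl

/-- Put the real registers `0` and `1` in front of the encoded state. -/
def withArgs : List Instr :=
  allocReal 1 ++ allocPair 2 9 7 ++ allocReal 0 ++ allocPair 2 7 2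

theorem yields_withArgs {procs : List Cmd} {s : State} {v : Val} (h : Rep s v (s.nreg 9)) :
    Yields procs (block withArgs) s (.pair (.real (s.rreg 0)) (.pair (.real (s.rreg 1)) v)) 23 := by
  have e : Ext s (withArgs.foldl (fun s c => c.apply s) s) := by
    constructor
    · simp [withArgs, allocReal, allocPair, Instr.apply]
      omega
    · intro a ha
      simp [withArgs, allocReal, allocPair, Instr.apply, Function.update_apply]
      split_ifs <;> omega
    · intro a ha
      simp [withArgs, allocReal, allocPair, Instr.apply, Function.update_apply]
      split_ifs <;> first | omega | rfl
    · simp [withArgs, allocReal, allocPair, Instr.apply]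
    · intro i hi
      simp [withArgs, allocReal, allocPair, Instr.apply,
        show i ≠ 4 by omega, show i ≠ 8 by omega, show i ≠ 2 by omega, show i ≠ 7 by omega]
    · simp [withArgs, allocReal, allocPair, Instr.apply]
  refine yields_block (by simp [withArgs, allocReal, allocPair]) ⟨e, ?_⟩
  have h' := h.ext e
  generalize hw : withArgs.foldl (fun s c => c.apply s) s = s' at h' ⊢
  simp [withArgs, allocReal, allocPair, Instr.apply] at hw
  subst hw
  simpa [Rep, Function.update_apply, add_assoc] using h'

/-- Put the encoded state into the accumulator. -/
def getRoot : List Instr := [.natCopy 2 9]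

theorem yields_getRoot {procs : List Cmd} {s : State} {v : Val} (h : Rep s v (s.nreg 9)) :
    Yields procs (block getRoot) s v 2 := by
  refine yields_block (by simp [getRoot]) ⟨⟨?_, ?_, ?_, ?_, ?_, ?_⟩, ?_⟩
  · simp [getRoot, Instr.apply]
  · simp [getRoot, Instr.apply]
  · simp [getRoot, Instr.apply]
  · simp [getRoot, Instr.apply]
  · intro i hi
    simp [getRoot, Instr.apply, show i ≠ 2 by omega]
  · simp [getRoot, Instr.apply]
  · exact h.mono (s' := _) (by simp [getRoot, Instr.apply]) (by simp [getRoot, Instr.apply])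
      (by simp [getRoot, Instr.apply])

theorem Ext.trans {s s' s'' : State} (h : Ext s s') (h' : Ext s' s'') : Ext s s'' :=
  ⟨h.le.trans h'.le, fun a ha => (h'.nmem a (ha.trans_le h.le)).trans (h.nmem a ha),
    fun a ha => (h'.rmem a (ha.trans_le h.le)).trans (h.rmem a ha), h'.stack.trans h.stack,
    fun i hi => (h'.regs i hi).trans (h.regs i hi), h'.out.trans h.out⟩

theorem Yields.then {c : Cmd} {s : State} {x v : Val} {k : ℕ}
    (h : Yields (bodies.map compile) c s x k) (hin : s.HasInput inp) {e : Prog} {T : ℕ}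
    (hw : wp (Spec inp) inp e x fun v' t' => v' = v ∧ t' ≤ T) :
    Yields (bodies.map compile) (.seq c (compile e)) s v (k + (e.steps + stepBound bodies * T)) := by
  obtain ⟨t₁, s₁, h1, h2, h3, h4⟩ := h
  obtain ⟨t₂, s₂, k1, k2, k3, k4⟩ := (meets inp).yields_wp hw (hin.ext h3) h4
  exact ⟨_, s₂, .seq h1 k1, by omega, h3.trans k3, k4⟩

/-- Run `c` and make the result the new state of the data structure. -/
def storeRoot (c : Cmd) : Cmd := .seq c (block [.natCopy 9 2])

theorem Yields.storeRoot {procs : List Cmd} {c : Cmd} {s : State} {v : Val} {k : ℕ}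
    (h : Yields procs c s v k) (hin : s.HasInput inp) :
    ∃ t s', Exec procs (storeRoot c) s t s' ∧ t ≤ k + 2 ∧ s'.Holds inp v := by
  obtain ⟨t, s', h1, h2, h3, h4⟩ := h
  refine ⟨_, _, .seq h1 (exec_block _ _ _), by simp; omega, ⟨?_, ?_⟩, ?_⟩
  · exact (hin.ext h3).1
  · exact (hin.ext h3).2
  · exact h4.mono (s := s') (s' := (Instr.natCopy 9 2).apply s') le_rfl (fun _ _ => rfl) fun _ _ => rfl

/-- Run `c` and put the number it returns into register `0`. -/
def answer (c : Cmd) : Cmd := .seq c (block [.natLoad 0 2])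

theorem Yields.answer {procs : List Cmd} {c : Cmd} {s : State} {n k : ℕ} {v : Val}
    (h : Yields procs c s (.nat n) k) (hs : s.Holds inp v) :
    ∃ t s', Exec procs (answer c) s t s' ∧ t ≤ k + 2 ∧ s'.Holds inp v ∧ s'.nreg 0 = n := by
  obtain ⟨t, s', h1, h2, h3, h4⟩ := h
  refine ⟨_, _, .seq h1 (exec_block _ _ _), by simp; omega,
    (hs.ext h3).congr rfl rfl rfl rfl, ?_⟩
  simpa [Instr.apply] using h4.2

/-- Write the first entry of the list in register `2`, and load the tag of the rest. -/
def outStep : List Instr :=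
  [.natConst 8 1, .natAdd 8 2 8, .natLoad 2 8, .natLoad 6 2, .natConst 8 1, .natAdd 8 2 8,
    .natLoad 2 8, .natConst 8 1, .natAdd 8 6 8, .natLoad 7 8, .natLoad 6 6, .realLoad 2 6,
    .realLoad 3 7, .output 2 3, .natLoad 6 2, .natLoad 6 6]

def outLoop : Cmd := .loop (.natLt 5 6) (block outStep)

/-- An entry takes the `16` instructions of `outStep`, the closing `nop` and the test. Register `5`
holds `0`, and register `6` the tag that tells whether an entry follows. -/
theorem exec_outLoop {procs : List Cmd} (l : List (ℝ × ℝ)) {s : State}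
    (h : Rep s (encOut l) (s.nreg 2)) (h5 : s.nreg 5 = 0)
    (h6 : s.nreg 6 = s.nmem (s.nmem (s.nreg 2))) :
    ∃ s', Exec procs outLoop s (18 * l.length + 1) s' ∧ s'.nreg 4 = s.nreg 4 ∧
      s'.nreg 9 = s.nreg 9 ∧ s'.nmem = s.nmem ∧ s'.rmem = s.rmem ∧ s'.out = s.out ++ l := by
  induction l generalizing s with
  | nil =>
    refine ⟨s, .loopDone ?_, rfl, rfl, rfl, rfl, (List.append_nil _).symm⟩
    obtain ⟨-, ⟨-, h⟩, -⟩ := h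
    simp [Test.Holds, h5, h6, h]
  | cons p l ih =>
    obtain ⟨-, ⟨-, h1⟩, -, ⟨-, ⟨-, h2⟩, ⟨-, h3⟩⟩, h4⟩ := h
    have hb : Test.Holds (.natLt 5 6) s := by simp [Test.Holds, h5, h6, h1]
    obtain ⟨s', k1, k2, k3, k4, k5, k6⟩ := ih
      (s := outStep.foldl (fun s c => c.apply s) s)
      (by
        refine Rep.mono (s := s) (le_of_eq ?_) (fun a _ => ?_) (fun a _ => ?_) ?_
        · simp [outStep, Instr.apply]
        · simp [outStep, Instr.apply]
        · simp [outStep, Instr.apply]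
        · simpa [outStep, Instr.apply, Function.update_apply] using h4)
      (by simpa [outStep, Instr.apply, Function.update_apply] using h5)
      (by simp [outStep, Instr.apply])
    refine ⟨s', ?_, k2.trans ?_, k3.trans ?_, k4.trans ?_, k5.trans ?_, k6.trans ?_⟩
    · have := Exec.loopStep hb (exec_block procs outStep s) k1
      rwa [show outStep.length + 1 + (18 * l.length + 1) + 1 = 18 * (p :: l).length + 1 by
        simp only [outStep, List.length_cons, List.length_nil]; ring] at this
    · simp [outStep, Instr.apply]
    · simp [outStep, Instr.apply]
    · simp [outStep, Instr.apply]
    · simp [outStep, Instr.apply]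
    · simp [outStep, Instr.apply, h2, h3]

/-- Run `c` and write the list it returns. -/
def writeOut (c : Cmd) : Cmd :=
  .seq c (.seq (block [.natConst 5 0, .natLoad 6 2, .natLoad 6 6]) outLoop)

theorem Yields.writeOut {procs : List Cmd} {c : Cmd} {s : State} {l : List (ℝ × ℝ)} {k : ℕ}
    {v : Val} (h : Yields procs c s (encOut l) k) (hs : s.Holds inp v) (ho : s.out = []) :
    ∃ t s', Exec procs (writeOut c) s t s' ∧ t ≤ k + 18 * l.length + 6 ∧ s'.Holds inp v ∧
      s'.out = l := by
  obtain ⟨t, s', h1, h2, h3, h4⟩ := h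
  obtain ⟨s'', k1, k2, k3, k4, k5, k6⟩ := exec_outLoop (procs := procs) l
    (s := [Instr.natConst 5 0, .natLoad 6 2, .natLoad 6 6].foldl (fun s c => Instr.apply c s) s')
    (h4.mono (s := s') (s' := (Instr.natLoad 6 6).apply ((Instr.natLoad 6 2).apply
      ((Instr.natConst 5 0).apply s'))) le_rfl (fun _ _ => rfl) fun _ _ => rfl) (by simp [Instr.apply])
    (by simp [Instr.apply])
  refine ⟨_, s'', .seq h1 (.seq (exec_block _ _ _) k1), ?_, ?_, ?_⟩
  · simp only [List.length_cons, List.length_nil]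
    omega
  · exact (hs.ext h3).congr k2 k3 k4 k5
  · rw [k6]
    change s'.out ++ l = l
    rw [h3.out, ho, List.nil_append]

/-- Set up the heap behind the input and collect the parameters of the construction. -/
def initHeap : List Instr :=
  [.natAdd 4 0 1, .natAdd 4 4 1] ++ allocNat 5 ++ [.natCopy 7 2] ++ allocNat 1 ++
    allocPair 2 7 7 ++ allocNat 0 ++ allocPair 2 7 7 ++ allocReal 0 ++ allocPair 2 7 2

/-- The heap starts behind the input, so allocation never overwrites it. Register `5` is still zero
and supplies the end marker of the list. -/
theorem exec_initHeap (ε : ℝ) (ps : List ℝ) (Is : List (NonemptyInterval ℝ)) :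
    let s := initHeap.foldl (fun s c => c.apply s) (initialState ε ps Is)
    s.HasInput (inputOf ps Is) ∧
      Rep s (vl [.real ε, .nat ps.length, .nat Is.length]) (s.nreg 2) := by
  refine ⟨⟨?_, ?_⟩, ?_⟩
  · simp [initHeap, allocNat, allocReal, allocPair, Instr.apply,
      initialState, inputOf]
    omega
  · intro a ha
    have ha : a < ps.length + 2 * Is.length := ha
    simp [initHeap, allocNat, allocReal, allocPair, Instr.apply, Function.update_apply,
      initialState, inputOf]
    intro h
    omega
  · generalize hw : initHeap.foldl (fun s c => c.apply s) (initialState ε ps Is) = s'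
    simp [initHeap, allocNat, allocReal, allocPair, Instr.apply,
      initialState] at hw
    subst hw
    simp [vl, Rep, add_assoc]

/-- The data structure. -/
def dataStructure : DataStructure :=
  let upd (u : Update) := storeRoot (.seq (block withArgs) (compile (Proc.update u)))
  -- The program of an update depends only on its kind, so any argument will do here.
  let I : NonemptyInterval ℝ := ⟨(0, 0), le_rfl⟩
  { procs := bodies.map compile
    build := storeRoot (.seq (block initHeap) (compile Proc.build))
    insertPoint := upd (.insertPoint 0)
    deletePoint := upd (.deletePoint 0)
    insertInterval := upd (.insertInterval I)
    deleteInterval := upd (.deleteInterval I)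
    size := answer (.seq (block getRoot) (compile Proc.size))
    member := answer (.seq (block withArgs) (compile Proc.member))
    report := writeOut (.seq (block getRoot) (compile Proc.flatten)) }

/-- A bound for the number of steps of the straight-line parts of the program. -/
def overhead : ℕ :=
  100 + Proc.build.steps + (Proc.update (.insertPoint 0)).steps +
    (Proc.update (.deletePoint 0)).steps +
    (Proc.update (.insertInterval ⟨(0, 0), le_rfl⟩)).steps +
    (Proc.update (.deleteInterval ⟨(0, 0), le_rfl⟩)).steps + Proc.size.steps +
    Proc.member.steps + Proc.flatten.steps + stepBound bodies

theorem exec_build (ε : ℝ) (ps : List ℝ) (Is : List (NonemptyInterval ℝ)) :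
    ∃ t s, Exec dataStructure.procs dataStructure.build (initialState ε ps Is) t s ∧
      t ≤ overhead * (1 + 2 * renewCost (ps.length + 2 * Is.length)) ∧
      s.Holds (inputOf ps Is) (vl (Glob.init ε ps Is).enc) := by
  obtain ⟨h1, h2⟩ := exec_initHeap ε ps Is
  obtain ⟨t, s, k1, k2, k3, k4⟩ := (meets (inputOf ps Is)).yields_wp (runs_build ε ps Is) h1 h2
  refine ⟨_, _, .seq (.seq (exec_block _ _ _) k1) (exec_block _ _ _), ?_,
    ⟨(h1.ext k3).1, (h1.ext k3).2⟩, k4.mono (s := s) (s' := (Instr.natCopy 9 2).apply s) le_rfl (fun _ _ => rfl) fun _ _ => rfl⟩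
  have e1 : stepBound bodies * (2 * renewCost (ps.length + 2 * Is.length)) ≤
      overhead * (2 * renewCost (ps.length + 2 * Is.length)) :=
    Nat.mul_le_mul_right _ (by unfold overhead; omega)
  have e2 : 100 + Proc.build.steps ≤ overhead := by unfold overhead; omega
  rw [mul_add, mul_one]
  simp only [initHeap, allocNat, allocReal, allocPair, List.length_append, List.length_cons,
    List.length_nil]
  omega

theorem exec_update {X : Inst} {g : Glob} (hg : g.Inv X) {s : State} (hs : s.Holds inp (vl g.enc))
    (u : Update) :
    ∃ t s', Exec dataStructure.procs (dataStructure.code (.update u)) (s.load (.update u)) t s' ∧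
      t ≤ overhead * (1 + (editCost g.ε g.θ (g.t.size + 2) +
        if 4 < g.cnt then 0 else renewCost (g.t.size + 2))) ∧
      s'.Holds inp (vl (g.update u).enc) := by
  have hl := hs.load (.update u)
  have ha : u.Args ((s.load (.update u)).rreg 0) ((s.load (.update u)).rreg 1) := by
    cases u <;> simp [Update.Args, State.load]
  obtain ⟨t, s', h1, h2, h3⟩ := ((yields_withArgs (procs := bodies.map compile) hl.root).then
    hl.input (runs_update hg u ha)).storeRoot hl.input
  refine ⟨t, s', ?_, ?_, h3⟩
  · cases u <;> exact h1
  · generalize editCost g.ε g.θ (g.t.size + 2) +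
      (if 4 < g.cnt then 0 else renewCost (g.t.size + 2)) = T at h2 ⊢
    have e1 : stepBound bodies * T ≤ overhead * T :=
      Nat.mul_le_mul_right _ (by unfold overhead; omega)
    have e2 : 100 + (Proc.update u).steps ≤ overhead := by
      have : (Proc.update u).steps ≤ (Proc.update (.insertPoint 0)).steps +
          (Proc.update (.deletePoint 0)).steps +
          (Proc.update (.insertInterval ⟨(0, 0), le_rfl⟩)).steps +
          (Proc.update (.deleteInterval ⟨(0, 0), le_rfl⟩)).steps := by
        cases u with
        | insertPoint x =>
          change (Proc.update (.insertPoint 0)).steps ≤ _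
          omega
        | deletePoint x =>
          change (Proc.update (.deletePoint 0)).steps ≤ _
          omega
        | insertInterval I =>
          change (Proc.update (.insertInterval ⟨(0, 0), le_rfl⟩)).steps ≤ _
          omega
        | deleteInterval I =>
          change (Proc.update (.deleteInterval ⟨(0, 0), le_rfl⟩)).steps ≤ _
          omega
      unfold overhead
      omega
    rw [mul_add, mul_one]
    omega

theorem exec_size (g : Glob) {s : State} (hs : s.Holds inp (vl g.enc)) :
    ∃ t s', Exec dataStructure.procs (dataStructure.code (.query .size))
      (s.load (.query .size)) t s' ∧ t ≤ overhead ∧ s'.Holds inp (vl g.enc) ∧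
      s'.nreg 0 = g.t.sol.size := by
  have hl := hs.load (.query .size)
  obtain ⟨t, s', h1, h2, h3⟩ := ((yields_getRoot (procs := bodies.map compile) hl.root).then
    hl.input (runs_size g)).answer hl
  refine ⟨t, s', h1, h2.trans ?_, h3⟩
  unfold overhead
  omega

open Classical in
theorem exec_member {g : Glob} (h : Ok plain g.t.sol) (I : NonemptyInterval ℝ) {s : State}
    (hs : s.Holds inp (vl g.enc)) :
    ∃ t s', Exec dataStructure.procs (dataStructure.code (.query (.member I)))
      (s.load (.query (.member I))) t s' ∧ t ≤ overhead * (1 + 3 * (g.t.sol.h + 1)) ∧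
      s'.Holds inp (vl g.enc) ∧ s'.nreg 0 = if Mem (Item.hi I) g.t.sol then 1 else 0 := by
  have hl := hs.load (.query (.member I))
  have hw := runs_member (inp := inp) h I
  have hy := yields_withArgs (procs := bodies.map compile) hl.root
  rw [show (s.load (.query (.member I))).rreg 0 = I.fst by simp [State.load],
    show (s.load (.query (.member I))).rreg 1 = I.snd by simp [State.load]] at hy
  obtain ⟨t, s', h1, h2, h3⟩ := (hy.then hl.input hw).answer hl
  refine ⟨t, s', h1, h2.trans ?_, h3⟩
  generalize 3 * (g.t.sol.h + 1) = T
  have e1 : stepBound bodies * T ≤ overhead * T :=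
    Nat.mul_le_mul_right _ (by unfold overhead; omega)
  have e2 : 100 + Proc.member.steps ≤ overhead := by unfold overhead; omega
  rw [mul_add, mul_one]
  omega

theorem exec_report {g : Glob} (h : Ok plain g.t.sol) {s : State} (hs : s.Holds inp (vl g.enc)) :
    ∃ t s', Exec dataStructure.procs (dataStructure.code (.query .report))
      (s.load (.query .report)) t s' ∧ t ≤ overhead * (1 + 20 * g.t.sol.size) ∧
      s'.Holds inp (vl g.enc) ∧ s'.out = g.t.sol.toList.map fun x => (x.oth, x.crd) := by
  have hl := hs.load (.query .report)
  obtain ⟨t, s', h1, h2, h3⟩ := ((yields_getRoot (procs := bodies.map compile) hl.root).then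
    hl.input (runs_flatten h)).writeOut hl (s.load_out _)
  refine ⟨t, s', h1, h2.trans ?_, h3⟩
  rw [List.length_map, ← h.size_eq]
  have e1 : stepBound bodies * (2 * g.t.sol.size) ≤ overhead * (2 * g.t.sol.size) :=
    Nat.mul_le_mul_right _ (by unfold overhead; omega)
  have e2 : 100 + Proc.flatten.steps ≤ overhead := by unfold overhead; omega
  have e3 : 1 * (18 * g.t.sol.size) ≤ overhead * (18 * g.t.sol.size) :=
    Nat.mul_le_mul_right _ (by unfold overhead; omega)
  have e4 : overhead * (1 + 20 * g.t.sol.size) =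
    overhead + overhead * (2 * g.t.sol.size) + overhead * (18 * g.t.sol.size) := by ring
  omega

end DynCover
end

noncomputable section

namespace DynCover

open Item (bot top)
open DynCover.Tree

/-! ## Running times -/

theorem log_add_two_ge (n : ℕ) : 1 / 2 ≤ Real.log (n + 2) := by
  have h1 : Real.log 2 ≤ Real.log (n + 2) :=
    Real.log_le_log (by norm_num) (by have := n.cast_nonneg (α := ℝ); linarith)
  have := Real.log_two_gt_d9
  linarith

/-- The argument `8 * n + 8` dominates the sizes that occur: trees have at most `2 * n` items, and
`base` is at most `4 * n`. -/
theorem lam_le_log (n : ℕ) : (lam (8 * n + 8) : ℝ) ≤ 17 * Real.log (n + 2) := by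
  have hn := n.cast_nonneg (α := ℝ)
  have h1 : (Nat.log 2 (8 * n + 8) : ℝ) * Real.log 2 ≤ Real.log (8 * n + 8) := by
    rw [← Real.log_pow]
    refine Real.log_le_log (by positivity) ?_
    exact_mod_cast Nat.pow_log_le_self 2 (x := 8 * n + 8) (by omega)
  have h2 : Real.log (8 * n + 8) ≤ 3 * Real.log 2 + Real.log (n + 2) := by
    rw [← Nat.cast_ofNat (n := 3), ← Real.log_pow, ← Real.log_mul (by norm_num) (by positivity)]
    exact Real.log_le_log (by positivity) (by norm_num; linarith)
  have h3 : Real.log 2 ≤ Real.log (n + 2) := Real.log_le_log (by norm_num) (by linarith)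
  have h4 := Real.log_two_gt_d9
  have h5 : (Nat.log 2 (8 * n + 8) : ℝ) * (2 / 3) ≤ Nat.log 2 (8 * n + 8) * Real.log 2 :=
    mul_le_mul_of_nonneg_left (by linarith) (Nat.cast_nonneg _)
  unfold lam
  push_cast
  linarith

/-- The time that has been saved for the next rebuilding. -/
def Glob.potential (g : Glob) : ℕ :=
  overhead * 14002 * lam (2 * g.base + 2) ^ 2 * (g.base - g.cnt)

theorem Glob.Inv.base_le {X : Inst} {g : Glob} (hg : g.Inv X) :
    g.base ≤ 4 * X.size ∧ g.t.size ≤ 2 * X.size := by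
  have h1 := hg.stores.size_le
  have h2 := hg.lower
  omega

theorem Glob.Inv.editCost_le {X : Inst} {g : Glob} (hg : g.Inv X) :
    (editCost g.ε g.θ (g.t.size + 2) : ℝ) ≤ 216120 * lam (8 * X.size + 8) ^ 3 / g.ε := by
  obtain ⟨h1, h2⟩ := hg.base_le
  obtain ⟨hε, hε1⟩ := hg.eps
  obtain ⟨h₀, hθ, h3, -⟩ := hg.bound
  have h4 : lam (g.t.size + 2) ≤ lam (8 * X.size + 8) := lam_mono (by omega)
  have h5 : h₀ + 2 ≤ lam (8 * X.size + 8) := h3.trans (lam_mono (by omega))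
  have h6 := three_le_lam (8 * X.size + 8)
  generalize lam (8 * X.size + 8) = L at h4 h5 h6 ⊢
  have h5' : (h₀ : ℝ) + 2 ≤ L := by exact_mod_cast h5
  have h6' : (3 : ℝ) ≤ L := by exact_mod_cast h6
  have h7 : (⌊g.θ / g.ε⌋₊ : ℝ) + 2 ≤ 6 * L / g.ε := by
    have e1 : (⌊g.θ / g.ε⌋₊ : ℝ) ≤ g.θ / g.ε := Nat.floor_le (by rw [hθ]; positivity)
    -- From `h₀ + 2 ≤ L` and `ε ≤ 1` one gets `θ + 2 ε ≤ 4 (L - 2) + 14 = 4 L + 6`, which is at most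
    -- `6 L` because `L ≥ 3`.
    have e2 : g.θ / g.ε + 2 ≤ 6 * L / g.ε := by
      rw [div_add' _ _ _ hε.ne']
      gcongr
      rw [hθ]
      linarith
    linarith
  have h4' : (lam (g.t.size + 2) : ℝ) ≤ L := by exact_mod_cast h4
  calc (editCost g.ε g.θ (g.t.size + 2) : ℝ)
      = 36020 * (lam (g.t.size + 2) : ℝ) ^ 2 * (⌊g.θ / g.ε⌋₊ + 2) := by
        unfold editCost; push_cast; ring
    _ ≤ 36020 * (L : ℝ) ^ 2 * (6 * L / g.ε) := by gcongr
    _ = _ := by ring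

theorem Glob.Inv.potential_update {X : Inst} {g : Glob} (hg : g.Inv X) (u : Update) :
    overhead * (if 4 < g.cnt then 0 else renewCost (g.t.size + 2)) + (g.update u).potential ≤
      g.potential + overhead * (77011 * lam (8 * X.size + 8) ^ 2) := by
  have h1 := hg.base_le.1
  have h2 := hg.upper
  have h3 := hg.le
  have h4 : lam (2 * g.base + 2) ^ 2 ≤ lam (8 * X.size + 8) ^ 2 :=
    Nat.pow_le_pow_left (lam_mono (by omega)) 2
  split_ifs with hc
  -- Without rebuilding the countdown deposits `4 * 14002` units, fewer than the allowance of
  -- `77011`.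
  · have e : (g.update u).potential =
        g.potential + overhead * (14002 * 4 * lam (2 * g.base + 2) ^ 2) := by
      simp only [Glob.update, Glob.finish, if_pos hc, Glob.potential]
      rw [show g.base - (g.cnt - 4) = g.base - g.cnt + 4 by omega]
      ring
    rw [e, mul_zero, zero_add]
    gcongr
    norm_num
  -- When `g.cnt ≤ 4`, the upper bound in the invariant gives `g.t.size + 3 ≤ 2 * (g.base - g.cnt) +
  -- 11`. Since `14002 = 2 * 7001` and `77011 = 11 * 7001`, the potential and one allowance pay for
  -- the rebuilding.
  · have e : (g.update u).potential = 0 := by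
      simp [Glob.update, Glob.finish, if_neg hc, Glob.potential, Glob.renew]
    have h5 : lam (g.t.size + 2) ^ 2 ≤ lam (2 * g.base + 2) ^ 2 :=
      Nat.pow_le_pow_left (lam_mono (by omega)) 2
    rw [e, add_zero]
    calc overhead * renewCost (g.t.size + 2)
        ≤ overhead * (7001 * lam (2 * g.base + 2) ^ 2 * (2 * (g.base - g.cnt) + 11)) := by
          have h6 : g.t.size + 2 + 1 ≤ 2 * (g.base - g.cnt) + 11 := by omega
          unfold renewCost
          gcongr overhead * (7001 * ?_ * ?_)
      _ = g.potential + overhead * (77011 * lam (2 * g.base + 2) ^ 2) := by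
          unfold Glob.potential; ring
      _ ≤ _ := by gcongr

/-- The constant in the running times. -/
def timeConst : ℝ := 10 ^ 10 * overhead

theorem Glob.Inv.update_time {X : Inst} {g : Glob} (hg : g.Inv X) (u : Update) {t : ℕ}
    (ht : t ≤ overhead * (1 + (editCost g.ε g.θ (g.t.size + 2) +
        if 4 < g.cnt then 0 else renewCost (g.t.size + 2)))) :
    (t : ℝ) + (g.update u).potential ≤
      g.potential + timeConst * Real.log (X.size + 2) ^ 3 / g.ε := by
  obtain ⟨hε, hε1⟩ := hg.eps
  have h1 := hg.editCost_le
  have h2 := hg.potential_update u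
  generalize (if 4 < g.cnt then 0 else renewCost (g.t.size + 2)) = R at ht h2
  have ht' : (t : ℝ) ≤ overhead * (1 + (editCost g.ε g.θ (g.t.size + 2) + R)) := by
    exact_mod_cast ht
  have h2' : (overhead : ℝ) * R + (g.update u).potential ≤
      g.potential + overhead * (77011 * lam (8 * X.size + 8) ^ 2) := by exact_mod_cast h2
  have h3 := lam_le_log X.size
  have h4 : (3 : ℝ) ≤ lam (8 * X.size + 8) := by exact_mod_cast three_le_lam _
  generalize (lam (8 * X.size + 8) : ℝ) = L at *
  generalize Real.log (X.size + 2) = ℓ at *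
  have ho : (0 : ℝ) ≤ overhead := Nat.cast_nonneg _
  have h5 : L ^ 3 ≤ (17 * ℓ) ^ 3 := by gcongr
  have h6 : 77011 * L ^ 2 + 1 ≤ 77012 * L ^ 3 / g.ε := by
    have e1 : 77011 * L ^ 2 + 1 ≤ 77012 * L ^ 3 := by nlinarith [sq_nonneg L]
    exact e1.trans (le_div_self (by positivity) hε hε1)
  have h7 : 293132 * L ^ 3 / g.ε ≤ 293132 * (17 * ℓ) ^ 3 / g.ε := by gcongr
  have h8 : 1 + 216120 * L ^ 3 / g.ε + 77011 * L ^ 2 ≤ 293132 * L ^ 3 / g.ε := by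
    have : 293132 * L ^ 3 / g.ε = 216120 * L ^ 3 / g.ε + 77012 * L ^ 3 / g.ε := by ring
    linarith
  -- `293132 * 17 ^ 3` is below `10 ^ 10`.
  have h9 : 293132 * (17 * ℓ) ^ 3 / g.ε ≤ 10 ^ 10 * ℓ ^ 3 / g.ε := by
    have : 0 ≤ ℓ := by linarith
    gcongr ?_ / _
    have := pow_nonneg this 3
    nlinarith
  have h10 : (overhead : ℝ) * (1 + editCost g.ε g.θ (g.t.size + 2) + 77011 * L ^ 2) ≤
      overhead * (10 ^ 10 * ℓ ^ 3 / g.ε) := mul_le_mul_of_nonneg_left (by linarith) ho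
  have h11 : timeConst * ℓ ^ 3 / g.ε = overhead * (10 ^ 10 * ℓ ^ 3 / g.ε) := by
    unfold timeConst; ring
  rw [h11]
  linarith

theorem build_time {n M t : ℕ} (hM : M ≤ 2 * n) (ht : t ≤ overhead * (1 + 2 * renewCost M)) :
    (t : ℝ) ≤ timeConst * ((n : ℝ) + 1) * Real.log (n + 2) ^ 2 := by
  have h1 : (lam M : ℝ) ≤ 17 * Real.log (n + 2) :=
    le_trans (by exact_mod_cast lam_mono (by omega)) (lam_le_log n)
  have h2 : (3 : ℝ) ≤ lam M := by exact_mod_cast three_le_lam M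
  have ht' : (t : ℝ) ≤ overhead * (1 + 2 * (7001 * lam M ^ 2 * (M + 1))) := by
    exact_mod_cast ht
  have hM' : (M : ℝ) ≤ 2 * n := by exact_mod_cast hM
  generalize (lam M : ℝ) = L at *
  generalize Real.log (n + 2) = ℓ at *
  have h3 : L ^ 2 ≤ (17 * ℓ) ^ 2 := by gcongr
  have hn : (0 : ℝ) ≤ n := Nat.cast_nonneg _
  have h4 : (1 : ℝ) ≤ L ^ 2 := by nlinarith
  calc (t : ℝ) ≤ overhead * (1 + 2 * (7001 * L ^ 2 * (M + 1))) := ht'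
    _ ≤ overhead * (28005 * (17 * ℓ) ^ 2 * (n + 1)) := by
        gcongr
        have e1 : L ^ 2 * (M + 1) ≤ (17 * ℓ) ^ 2 * (2 * (n + 1)) := by
          gcongr
          linarith
        have e2 : 1 * (0 + 1) ≤ (17 * ℓ) ^ 2 * (n + 1) := by
          gcongr
          linarith
        linarith
    _ ≤ overhead * (10 ^ 10 * ℓ ^ 2 * (n + 1)) := by
        gcongr overhead * (?_ * _)
        linarith [sq_nonneg ℓ]
    _ = timeConst * (n + 1) * ℓ ^ 2 := by unfold timeConst; ring

theorem Glob.Inv.member_time {X : Inst} {g : Glob} (hg : g.Inv X) {t : ℕ}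
    (ht : t ≤ overhead * (1 + 3 * (g.t.sol.h + 1))) :
    (t : ℝ) ≤ timeConst * Real.log (X.size + 2) := by
  obtain ⟨-, h1, h2, -⟩ := hg.sorted_sol
  have h3 : (g.solution X).card ≤ X.size :=
    (Finset.card_le_card (Finset.filter_subset _ _)).trans (Nat.le_add_left _ _)
  have h4 : g.t.sol.h + 2 ≤ lam (8 * X.size + 8) := h1.h_lt (by omega)
  have h5 : (t : ℝ) ≤ overhead * (4 * lam (8 * X.size + 8)) := by
    exact_mod_cast ht.trans (Nat.mul_le_mul_left _ (by omega))
  have h6 : (0 : ℝ) ≤ Real.log (X.size + 2) := by linarith [log_add_two_ge X.size]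
  calc (t : ℝ) ≤ overhead * (4 * lam (8 * X.size + 8)) := h5
    _ ≤ overhead * (4 * (17 * Real.log (X.size + 2))) := by
        gcongr
        exact lam_le_log _
    _ ≤ overhead * (10 ^ 10 * Real.log (X.size + 2)) := by
        gcongr overhead * ?_
        linarith
    _ = _ := by unfold timeConst; ring

/-- Reporting is linear in `k`; as the logarithm is at least `1 / 2`, the weaker bound follows. -/
theorem report_time {n k t : ℕ} (ht : t ≤ overhead * (1 + 20 * k)) :
    (t : ℝ) ≤ timeConst * (k * Real.log (n + 2) + 1) := by
  have h1 : (t : ℝ) ≤ overhead * (1 + 20 * k) := by exact_mod_cast ht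
  have h2 : (k : ℝ) * (1 / 2) ≤ k * Real.log (n + 2) := by
    gcongr
    exact log_add_two_ge n
  have hk : (0 : ℝ) ≤ k := Nat.cast_nonneg _
  calc (t : ℝ) ≤ overhead * (1 + 20 * k) := h1
    _ ≤ overhead * (10 ^ 10 * (k * Real.log (n + 2) + 1)) := by
        gcongr
        linarith
    _ = _ := by unfold timeConst; ring

end DynCover
end

noncomputable section

namespace DynCover

open Item (bot top)
open DynCover.Tree

variable {inp : Input}

/-! ## Sequences of operations -/

/-- The state of the data structure after an operation. -/
def Glob.next (g : Glob) : Op → Glob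
  | .update u => g.update u
  | .query _ => g

/-- What is required of the execution of an operation in `t` steps, ending in state `s`. -/
structure Performs (X : Inst) (g : Glob) (op : Op) (t : ℕ) (s : State) : Prop where
  holds : s.Holds inp (vl (g.next op).enc)
  update : ∀ u, op = .update u →
    (t : ℝ) + (g.update u).potential ≤
      g.potential + timeConst * Real.log (X.size + 2) ^ 3 / g.ε
  size : op = .query .size → s.nreg 0 = (g.solution X).card ∧ (t : ℝ) ≤ timeConst
  member : ∀ I, op = .query (.member I) →
    (I ∈ g.solution X → s.nreg 0 = 1) ∧ (I ∉ g.solution X → s.nreg 0 = 0) ∧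
      (t : ℝ) ≤ timeConst * Real.log (X.size + 2)
  report : op = .query .report →
    s.out.Perm ((g.solution X).toList.map NonemptyInterval.toProd) ∧
      (t : ℝ) ≤ timeConst * ((g.solution X).card * Real.log (X.size + 2) + 1)

theorem Glob.Inv.performs {X : Inst} {g : Glob} (hg : g.Inv X) {s : State}
    (hs : s.Holds inp (vl g.enc)) (op : Op) :
    ∃ t s', Exec dataStructure.procs (dataStructure.code op) (s.load op) t s' ∧
      Performs (inp := inp) X g op t s' := by
  obtain ⟨-, h1, h2, -⟩ := hg.sorted_sol
  rcases op with u | (_ | I | _)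
  · obtain ⟨t, s', k1, k2, k3⟩ := exec_update hg hs u
    refine ⟨t, s', k1, k3, ?_, by simp, by simp, by simp⟩
    rintro u ⟨⟩
    exact hg.update_time u k2
  · obtain ⟨t, s', k1, k2, k3, k4⟩ := exec_size g hs
    refine ⟨t, s', k1, k3, by simp, fun _ => ⟨k4.trans h2, ?_⟩, by simp, by simp⟩
    have : (t : ℝ) ≤ overhead := by exact_mod_cast k2
    unfold timeConst
    linarith
  · obtain ⟨t, s', k1, k2, k3, k4⟩ := exec_member h1 I hs
    refine ⟨t, s', k1, k3, by simp, by simp, ?_, by simp⟩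
    rintro I ⟨⟩
    rw [hg.mem_sol] at k4
    exact ⟨fun h => by rw [k4, if_pos h], fun h => by rw [k4, if_neg h], hg.member_time k2⟩
  · obtain ⟨t, s', k1, k2, k3, k4⟩ := exec_report h1 hs
    refine ⟨t, s', k1, k3, by simp, by simp, by simp, fun _ => ⟨k4 ▸ hg.perm_sol, ?_⟩⟩
    rw [← h2]
    exact report_time k2

theorem Glob.Inv.after {X : Inst} {g : Glob} (hg : g.Inv X) (us : List Update) :
    (us.foldl Glob.update g).Inv (X.after us) ∧ (us.foldl Glob.update g).ε = g.ε := by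
  induction us generalizing X g with
  | nil => exact ⟨hg, rfl⟩
  | cons u us ih =>
    obtain ⟨h1, h2⟩ := ih (hg.update u)
    refine ⟨h1, h2.trans ?_⟩
    unfold Glob.update Glob.finish
    split_ifs <;> rfl

theorem foldl_history (g : Glob) (ops : ℕ → Op) (i : ℕ) :
    (history ops (i + 1)).foldl Glob.update g =
      ((history ops i).foldl Glob.update g).next (ops i) := by
  unfold history
  rw [List.range_succ, List.filterMap_append, List.foldl_append]
  cases h : ops i <;> simp [h, Op.toUpdate?, Glob.next]

end DynCover
end

open DynCover Classical in
theorem mainTheorem1 :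
    ∃ (D : DataStructure) (C : ℝ) (c : ℕ),
      ∀ (ε : ℝ), 0 < ε →
      ∀ (ps : List ℝ) (Is : List (NonemptyInterval ℝ)), ps.Nodup → Is.Nodup →
      ∃ (t₀ : ℕ) (s₀ : State) (sol : List Update → Finset (NonemptyInterval ℝ)),
        -- construction time
        (Exec D.procs D.build (initialState ε ps Is) t₀ s₀ ∧
          (t₀ : ℝ) ≤ C * (((Inst.ofLists ps Is).size : ℝ) + 1) *
            Real.log (((Inst.ofLists ps Is).size : ℝ) + 2) ^ c) ∧
        -- `sol us`, the solution maintained after the updates `us`, is an approximate set cover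
        (∀ us : List Update, (∃ A, ((Inst.ofLists ps Is).after us).IsCover A) →
          ((Inst.ofLists ps Is).after us).IsApproxCover (1 + ε) (sol us)) ∧
        -- the `i`-th operation leads from state `s i` to state `s (i + 1)` in `t i` steps
        ∀ ops : ℕ → Op, ∃ (s : ℕ → State) (t : ℕ → ℕ),
          s 0 = s₀ ∧
          (∀ i, Exec D.procs (D.code (ops i)) ((s i).load (ops i)) (t i) (s (i + 1))) ∧
          -- amortized update time
          (∀ m : ℕ,
            ∑ i ∈ Finset.range m with (∃ u, ops i = .update u), (t i : ℝ) ≤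
              ∑ i ∈ Finset.range m with (∃ u, ops i = .update u),
                C * Real.log
                  ((((Inst.ofLists ps Is).after (history ops i)).size : ℝ) + 2) ^ 3 / min ε 1) ∧
          -- size queries
          (∀ i, ops i = .query .size →
            (s (i + 1)).nreg 0 = (sol (history ops i)).card ∧ (t i : ℝ) ≤ C) ∧
          -- membership queries
          (∀ i I, ops i = .query (.member I) →
            (s (i + 1)).nreg 0 = (if I ∈ sol (history ops i) then 1 else 0) ∧
            (t i : ℝ) ≤ C * Real.log
              ((((Inst.ofLists ps Is).after (history ops i)).size : ℝ) + 2)) ∧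
          -- reporting queries
          (∀ i, ops i = .query .report →
            (s (i + 1)).out.Perm
              ((sol (history ops i)).toList.map NonemptyInterval.toProd) ∧
            (t i : ℝ) ≤ C * (((sol (history ops i)).card : ℝ) * Real.log
              ((((Inst.ofLists ps Is).after (history ops i)).size : ℝ) + 2) + 1)) := by
  refine ⟨dataStructure, timeConst, 2, fun ε hε ps Is hps hIs => ?_⟩
  obtain ⟨t₀, s₀, h1, h2, h3⟩ := exec_build ε ps Is
  have hinv := Glob.inv_init hε ps Is
  have hG := hinv.after
  refine ⟨t₀, s₀, fun us => (us.foldl Glob.update (Glob.init ε ps Is)).solution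
    ((Inst.ofLists ps Is).after us), ⟨h1, build_time ?_ h2⟩, fun us hus => ?_, fun ops => ?_⟩
  · rw [Inst.size, Inst.ofLists, List.toFinset_card_of_nodup hps, List.toFinset_card_of_nodup hIs]
    omega
  · obtain ⟨h4, h5⟩ := (hG us).1.approx hus
    refine ⟨h4, fun B hB => (h5 B hB).trans ?_⟩
    -- The data structure works with `min ε 1` throughout, which only improves the approximation
    -- when `ε > 1`.
    have h6 : (us.foldl Glob.update (Glob.init ε ps Is)).ε ≤ ε := by
      rw [(hG us).2]
      exact min_le_left _ _
    gcongr
  set G : ℕ → Glob := fun i => (history ops i).foldl Glob.update (Glob.init ε ps Is) with hGdef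
  -- Machine states that do not represent `G i` get a dummy successor, so that a total transition
  -- function can be chosen.
  have hstep (i : ℕ) (s : State) : ∃ p : ℕ × State, s.Holds (inputOf ps Is) (vl (G i).enc) →
      Exec dataStructure.procs (dataStructure.code (ops i)) (s.load (ops i)) p.1 p.2 ∧
        Performs (inp := inputOf ps Is) ((Inst.ofLists ps Is).after (history ops i)) (G i) (ops i)
          p.1 p.2 := by
    by_cases hs : s.Holds (inputOf ps Is) (vl (G i).enc)
    · obtain ⟨t, s', k⟩ := (hG (history ops i)).1.performs hs (ops i)
      exact ⟨(t, s'), fun _ => k⟩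
    · exact ⟨(0, s), fun h => absurd h hs⟩
  choose f hf using hstep
  let s : ℕ → State := fun i => Nat.rec s₀ (fun i s => (f i s).2) i
  have hs (i : ℕ) : (s i).Holds (inputOf ps Is) (vl (G i).enc) := by
    induction i with
    | zero => exact h3
    | succ i ih =>
      have := (hf i (s i) ih).2.holds
      rwa [← foldl_history] at this
  have hp (i : ℕ) := (hf i (s i) (hs i)).2
  refine ⟨s, fun i => (f i (s i)).1, rfl, fun i => (hf i (s i) (hs i)).1, fun m => ?_,
    fun i hi => (hp i).size hi, fun i I hi => ?_, fun i hi => (hp i).report hi⟩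
  -- The amortized bounds telescope: the potential vanishes after the construction, is never
  -- negative, and is not changed by queries.
  · suffices (∑ i ∈ Finset.range m with (∃ u, ops i = .update u), ((f i (s i)).1 : ℝ)) +
        (G m).potential ≤ ∑ i ∈ Finset.range m with (∃ u, ops i = .update u),
          timeConst * Real.log
            ((((Inst.ofLists ps Is).after (history ops i)).size : ℝ) + 2) ^ 3 / min ε 1 from
      (le_add_of_nonneg_right (Nat.cast_nonneg _)).trans this
    induction m with
    | zero =>
      have : (G 0).potential = 0 := by
        simp [hGdef, history, Glob.init, Glob.renew, Glob.potential]
      simp [this]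
    | succ m ih =>
      have hnext : G (m + 1) = (G m).next (ops m) := foldl_history _ _ _
      rw [Finset.range_add_one, Finset.filter_insert, hnext]
      split_ifs with hu
      · obtain ⟨u, hu⟩ := hu
        rw [Finset.sum_insert (by simp), Finset.sum_insert (by simp)]
        have k1 := (hp m).update u hu
        rw [show (G m).ε = min ε 1 from (hG (history ops m)).2] at k1
        rw [hu]
        change _ + (((G m).update u).potential : ℝ) ≤ _
        linarith
      · rw [show (G m).next (ops m) = G m by
          cases h : ops m with
          | update u => exact absurd ⟨u, h⟩ hu
          | query q => rfl]
        exact ih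
  · obtain ⟨k1, k2, k3⟩ := (hp i).member I hi
    refine ⟨?_, k3⟩
    split_ifs with h
    · exact k1 h
    · exact k2 h
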